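/- **Lemma 2.4.** Let $\mathbb T=\mathbb R/2\pi\mathbb Z$, $\hat f_k=\frac1{2\pi}\int_{\mathbb T}e^{-ikx}f(x)\,dx$, $\langle k\rangle=(1+k^2)^{1/2}$, $\widehat{(J^sf)}_k=\langle k\rangle^s\hat f_k$, $\|f\|_{H^s}^2=2\pi\sum_k\langle k\rangle^{2s}|\hat f_k|^2$, and let $e^{is\partial_x^2}$ be the Fourier multiplier with symbol $e^{-isk^2}$. For $j\ge1$ let $\Pi_{2^j}$ be the projection onto the frequencies $\frac18 2^j\le|k|\le 8\cdot2^j$, and let $\Pi_{1}$ (the case $j=0$) be the projection onto $|k|\le 8$. Let $T_0,\dots,T_3$ be Fourier multipliers, $\widehat{(T_if)}_k=m_i(k)\hat f_k$, with $m_i:\mathbb Z\to\mathbb C$ satisfying, for some constant $A$, $$\sum_{k\in\mathbb Z}|m_i(k+1)-m_i(k)|\le A,\qquad \lim_{k\to-\infty}m_i(k)=0 .$$ For $I=[t_0,t_1]$ put $$\begin{aligned}Tv={}& i\int_{t_0}^{t_1} e^{-is\partial_x^2}T_0\Big[e^{-is\partial_x^2}T_1\bar v(s)\cdot e^{is\partial_x^2}T_2v(s)\cdot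 e^{is\partial_x^2}T_3v(s)\Big]ds\\ &-i\int_{t_0}^{t_1}T_0T_3v(s)\cdot\frac1{2\pi}\int_{\mathbb T}T_1\bar v(s)\,T_2v(s)\,dx\,ds -i\int_{t_0}^{t_1}T_0T_2v(s)\cdot\frac1{2\pi}\int_{\mathbb T}T_1\bar v(s)\,T_3v(s)\,dx\,ds ,\end{aligned}$$ where the time integrals are taken for each Fourier coefficient, and $$\|v\|_{X^\gamma(I)}=\|v\|_{L^\infty_tH^\gamma_x(I)}+\|\partial_tv\|_{L^1_tH^\gamma_x(I)} .$$ Let $\gamma\in\mathbb R$ and $\varepsilon>0$ be such that, with $a_+=\max\{a,0\}$, $$\alpha=\alpha(\gamma)=1+\gamma-\Big(\frac{(1-2\gamma)_+^2}{1+(1-2\gamma)_+}+\varepsilon\Big)\ge0 .$$ Then there is a constant $C$, depending only on $\gamma$, $\varepsilon$ and $A$, such that for all such multipliers, all $t_0\le t_1$ and all $v$ with $\|v\|_{X^\gamma(I)}<\infty$ (represented so that its Fourier coefficients are absolutely continuous on $I$, and, if $\gamma<0$, with $e^{is\partial_x^2}v\in L^3_tL^4_x(I)$, so that $Tv$ is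 defined), $$\begin{aligned}\|Tv\|_{L^2_x}\le C\Big(&\sum_{j\ge0}2^{-3\gamma j}\big\|\Pi_{2^j}e^{is\partial_x^2}J^\gamma v\big\|^3_{L^3_tL^6_x(I)}\\ &+\sum_{j_1\ge j_2\ge j_3\ge0}2^{-\alpha j_1}\big\|\Pi_{2^{j_1}}v\big\|_{X^\gamma(I)}\big\|\Pi_{2^{j_2}}v\big\|_{X^\gamma(I)}\big\|\Pi_{2^{j_3}}v\big\|_{X^\gamma(I)}\Big),\end{aligned}$$ where the right-hand side may be infinite. -/

import Mathlib

open MeasureTheory Filter Topology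
open scoped ENNReal NNReal Real

noncomputable section

namespace TorusNLS

instance factTwoPiPos : Fact (0 < 2 * π) := ⟨Real.two_pi_pos⟩

/-- The torus `ℝ / 2πℤ`. Its `volume` has total mass `2π`. -/
abbrev Torus : Type := AddCircle (2 * π)

/-- Periodic distributions, given by their Fourier coefficients
`c k = (1 / 2π) ∫ e^{-ikx} f(x) dx`. An element of `H^s`, `s ∈ ℝ` (also `s < 0`), is such a
sequence of finite norm `sobolevNorm s`. -/
abbrev FourierSeq : Type := ℤ → ℂ

/-- The `L²` function on the torus whose Fourier coefficients are `c`
(unique up to null sets; the value is `0` when there is none, that is when `c ∉ ℓ²`). -/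
def toFun (c : FourierSeq) : Torus → ℂ := by
  classical
  exact if h : ∃ f : Torus → ℂ, MemLp f 2 volume ∧ ∀ k, fourierCoeff f k = c k
    then h.choose else 0

/-- The norm of `L^p`, `p ≥ 1`, on the torus: the norm of the function in `L^p` with Fourier
coefficients `c`, and `∞` if there is no such function. -/
def torusNorm (p : ℝ≥0∞) (c : FourierSeq) : ℝ≥0∞ :=
  ⨅ (f : Torus → ℂ) (_ : MemLp f p volume) (_ : ∀ k, fourierCoeff f k = c k),
    eLpNorm f p volume

/-- The Japanese bracket `⟨k⟩ = (1 + k²)^{1/2}`. -/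
def bracket (k : ℤ) : ℝ := (1 + (k : ℝ) ^ 2) ^ (1 / 2 : ℝ)

/-- `‖f‖_{H^s}² = 2π ∑ (1 + k²)^s |f_k|²`. -/
def sobolevNorm (s : ℝ) (c : FourierSeq) : ℝ≥0∞ :=
  (ENNReal.ofReal (2 * π) *
    ∑' k : ℤ, ENNReal.ofReal ((1 + (k : ℝ) ^ 2) ^ s) * ‖c k‖ₑ ^ 2) ^ (1 / 2 : ℝ)

/-- The Fourier multiplier with symbol `m`. -/
def mult (m : ℤ → ℂ) (c : FourierSeq) : FourierSeq := fun k => m k * c k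

/-- `J^s = ⟨-i ∂_x⟩^s`. -/
def bessel (s : ℝ) : FourierSeq → FourierSeq := mult fun k => ((bracket k ^ s : ℝ) : ℂ)

/-- The linear flow `e^{i t ∂_x²}`, with symbol `e^{-i t k²}`. -/
def flow (t : ℝ) : FourierSeq → FourierSeq :=
  mult fun k => Complex.exp (-(Complex.I * (t : ℂ) * (k : ℂ) ^ 2))

/-- Complex conjugation of the distribution. -/
def conjSeq (c : FourierSeq) : FourierSeq := fun k => (starRingEnd ℂ) (c (-k))

open Classical in
/-- The dyadic piece `Π_{2^j}`: frequencies `2^j / 8 ≤ |k| ≤ 8 · 2^j`; the first piece `j = 0`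
carries all the low frequencies `|k| ≤ 8`. -/
def dyadic (j : ℕ) : FourierSeq → FourierSeq :=
  mult fun k => if (j = 0 ∨ (2 : ℝ) ^ j / 8 ≤ |(k : ℝ)|) ∧ |(k : ℝ)| ≤ 8 * (2 : ℝ) ^ j
    then 1 else 0

/-- The condition on a symbol `m`: total variation at most `A`, and limit `0` at `-∞`. -/
def IsBVSymbol (A : ℝ) (m : ℤ → ℂ) : Prop :=
  ∑' k : ℤ, ‖m (k + 1) - m k‖ₑ ≤ ENNReal.ofReal A ∧ Tendsto m atBot (𝓝 0)

/-- The norm of `L^q_t L^r_x([t₀, t₁])`, for `1 ≤ q < ∞`. -/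
def mixedNorm (q : ℝ) (r : ℝ≥0∞) (t₀ t₁ : ℝ) (u : ℝ → FourierSeq) : ℝ≥0∞ :=
  (∫⁻ s in Set.Icc t₀ t₁, torusNorm r (u s) ^ q) ^ (1 / q)

/-- `w` is the time derivative of `v` on `[t₀, t₁]`: every Fourier coefficient of `v` is
absolutely continuous on `[t₀, t₁]`, with (almost everywhere) derivative that of `w`. -/
def HasTimeDeriv (t₀ t₁ : ℝ) (v w : ℝ → FourierSeq) : Prop :=
  ∀ k : ℤ, IntervalIntegrable (fun s => w s k) volume t₀ t₁ ∧
    ∀ s ∈ Set.Icc t₀ t₁, v s k = v t₀ k + ∫ r in t₀..s, w r k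

/-- The norm of `X^γ([t₀, t₁])`, that is `‖v‖_{L^∞_t H^γ_x} + ‖∂_t v‖_{L^1_t H^γ_x}`, where
`w = ∂_t v`. -/
def xNorm (γ t₀ t₁ : ℝ) (v w : ℝ → FourierSeq) : ℝ≥0∞ :=
  essSup (fun s => sobolevNorm γ (v s)) (volume.restrict (Set.Icc t₀ t₁)) +
    ∫⁻ s in Set.Icc t₀ t₁, sobolevNorm γ (w s)

/-- The time-`s` value of
`e^{-is∂²} T₀ [e^{-is∂²} T₁ v̄ · e^{is∂²} T₂ v · e^{is∂²} T₃ v]`, with a pointwise product of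
functions on the torus; here `T_j` has symbol `m j`, and `c` stands for `v(s)`. -/
def cubicTerm (m : Fin 4 → ℤ → ℂ) (s : ℝ) (c : FourierSeq) : FourierSeq :=
  flow (-s) (mult (m 0) (fourierCoeff fun x : Torus =>
    toFun (flow (-s) (mult (m 1) (conjSeq c))) x *
      toFun (flow s (mult (m 2) c)) x * toFun (flow s (mult (m 3) c)) x))

/-- The mean `(1 / 2π) ∫ f g dx` over the torus of the product of two `L²` functions. -/
def pairMean (f g : FourierSeq) : ℂ :=
  ((2 * π : ℝ) : ℂ)⁻¹ * ∫ x : Torus, toFun f x * toFun g x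

/-- The trilinear Duhamel operator on `[t₀, t₁]` with the resonant terms subtracted. The integrals
in time are taken for each Fourier coefficient. -/
def trilinearT (m : Fin 4 → ℤ → ℂ) (t₀ t₁ : ℝ) (v : ℝ → FourierSeq) : FourierSeq := fun k =>
  Complex.I * (∫ s in t₀..t₁, cubicTerm m s (v s) k)
    - Complex.I * (∫ s in t₀..t₁, mult (m 0) (mult (m 3) (v s)) k *
        pairMean (mult (m 1) (conjSeq (v s))) (mult (m 2) (v s)))
    - Complex.I * (∫ s in t₀..t₁, mult (m 0) (mult (m 2) (v s)) k *
        pairMean (mult (m 1) (conjSeq (v s))) (mult (m 3) (v s)))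

/-- `α(γ) = 1 + γ - (d² / (1 + d) + ε)` with `d = (1 - 2γ)_+`, and `ε > 0` arbitrarily small. -/
def alpha (γ ε : ℝ) : ℝ :=
  1 + γ - ((max (1 - 2 * γ) 0) ^ 2 / (1 + max (1 - 2 * γ) 0) + ε)

end TorusNLS

end

open TorusNLS

/-!
The proof works on the Fourier side. With `k + k₁ = k₂ + k₃` the phase of the cubic term is
`k² + k₁² - k₂² - k₃² = 2 (k₂ - k₁) (k₃ - k₁)`, and the two subtracted terms of the trilinear
operator are the resonant interactions `k₂ = k₁` and `k₃ = k₁`, up to the diagonal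
`k₂ = k₃ = k₁`, which they subtract twice. All interactions are thus summed against one kernel,
`fullKernel`, and `v` is split into disjoint dyadic blocks `2^j ≤ |k| < 2^(j+1)`, with `k = 0`
put into the first one. There are two cases.

* *Comparable blocks.* If the indices `j₁`, `j₂`, `j₃` differ by a bounded amount, there is
  nothing to gain from oscillation. The cubic term is bounded in `L¹_t L²_x` by Hölder's
  inequality with three factors in `L⁶_x`. The symbols `m`, the sharp cutoffs to blocks and the
  weights `⟨k⟩^{-γ}` on a block all have bounded variation, so they act on `L⁶` by Riesz'
  theorem on the projection to positive frequencies (`eLpNorm_positive_le`) and summation by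
  parts (`multBdd_of_variation`). The resonant terms are bounded in `ℓ²` directly. See
  `exists_l2_integral_triSum_le_of_comparable`.
* *Other blocks.* The diagonal does not occur, the resonant interactions cancel exactly
  (`fullKernel_eq_of_not_comparable`), and for the others the phase does not vanish. One
  integration by parts in time gains `|k₂ - k₁|⁻¹ |k₃ - k₁|⁻¹`. One of these factors is of the
  size of the inverse of the highest frequency `2^J`, the other one is summable up to a loss of
  `2^{εJ}` (`exists_l2_nonresonantSum_le`). This gives `2^{(ε-1)J - γ(j₁+j₂+j₃)}`, which is at
  most `2^{-α(γ)J}` (`alpha_mul_le`). See `exists_l2_integral_triSum_le`.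

Riesz' theorem is needed for the exponents `4` and `6` only. There it follows from a pointwise
inequality `|z|^q ≤ C |Re z|^q + σ Re z^q` (`RieszExponent`), because the mean of the `q`-th
power of an analytic polynomial without constant term is zero.

These estimates concern frequency truncations of `v`, for which everything is a finite sum. To
pass to the limit in each Fourier coefficient of the trilinear operator
(`tendsto_integral_triSum_low`) one needs `e^{is∂_x²} v` in `L³_t L⁴_x`, on which sharp
truncations are bounded. For `γ < 0` this is assumed. For `γ ≥ 0` it follows from Zygmund's
inequality, that is, the periodic `L⁴` Strichartz estimate, together with Duhamel's formula
(`exists_lintegral_trig_pow_four_le`). Fatou's lemma in `ℓ²` then gives the bound for `v`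
itself.
-/

namespace TorusNLS

/-! ### Fourier series of square integrable functions -/

/-- The trigonometric polynomial `∑_{k ∈ S} c k e^{ikx}`. -/
noncomputable def trig (S : Finset ℤ) (c : FourierSeq) : C(Torus, ℂ) := ∑ k ∈ S, c k • fourier k

theorem trig_apply (S : Finset ℤ) (c : FourierSeq) (x : Torus) :
    trig S c x = ∑ k ∈ S, c k * fourier k x := by
  simp [trig]

theorem memLp_continuousMap (f : C(Torus, ℂ)) (p : ℝ≥0∞) : MemLp f p (volume : Measure Torus) :=
  (MemLp.of_bound f.continuous.aestronglyMeasurable ‖f‖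
    (Eventually.of_forall fun x => f.norm_coe_le_norm x) : MemLp f ∞ _).mono_exponent le_top

theorem fourierCoeff_trig (S : Finset ℤ) (c : FourierSeq) (k : ℤ) :
    fourierCoeff (trig S c) k = if k ∈ S then c k else 0 := by
  have h : ∀ i ∈ S, Integrable (fun x : Torus => c i * fourier i x) AddCircle.haarAddCircle := by
    intro i _
    exact (memLp_one_iff_integrable.1
      (memLp_haarAddCircle_iff.2 (memLp_continuousMap (fourier i) 1))).const_mul _
  have h2 : (trig S c : Torus → ℂ) = ∑ i ∈ S, fun x => c i * fourier i x := by
    ext x; simp [trig_apply]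
  rw [h2, fourierCoeff.sum _ _ h]
  simp only [Finset.sum_apply, fourierCoeff.const_mul, fourierCoeff_fourier, Pi.single_apply]
  simp

theorem fourierCoeff_toLp_of_memLp {f : Torus → ℂ}
    (hf : MemLp f 2 (AddCircle.haarAddCircle : Measure Torus)) (k : ℤ) :
    fourierCoeff (hf.toLp f) k = fourierCoeff f k :=
  congrFun (fourierCoeff_congr_ae hf.coeFn_toLp) k

/-- An `L²` function on the torus is determined by its Fourier coefficients. -/
theorem ae_eq_of_fourierCoeff_eq {f g : Torus → ℂ} (hf : MemLp f 2 volume) (hg : MemLp g 2 volume)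
    (h : ∀ k, fourierCoeff f k = fourierCoeff g k) : f =ᵐ[volume] g := by
  have hf' := memLp_haarAddCircle_iff.2 hf
  have hg' := memLp_haarAddCircle_iff.2 hg
  have h1 : hf'.toLp f = hg'.toLp g := by
    apply fourierBasis.repr.injective
    ext k
    rw [fourierBasis_repr, fourierBasis_repr, fourierCoeff_toLp_of_memLp,
      fourierCoeff_toLp_of_memLp, h]
  have h2 : f =ᵐ[AddCircle.haarAddCircle] g :=
    (hf'.coeFn_toLp.symm.trans (by rw [h1])).trans hg'.coeFn_toLp
  rw [AddCircle.volume_eq_smul_haarAddCircle]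
  exact Measure.ae_smul_measure h2 _

theorem exists_memLp_of_summable {c : FourierSeq} (hc : Summable fun k => ‖c k‖ ^ 2) :
    ∃ f : Torus → ℂ, MemLp f 2 volume ∧ ∀ k, fourierCoeff f k = c k := by
  have hm : Memℓp c 2 := by
    rw [memℓp_gen_iff (by norm_num)]
    simpa using hc
  let F : Lp ℂ 2 (AddCircle.haarAddCircle : Measure Torus) := fourierBasis.repr.symm ⟨c, hm⟩
  refine ⟨F, memLp_haarAddCircle_iff.1 (Lp.memLp F), fun k => ?_⟩
  rw [← fourierBasis_repr]
  simp [F]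

/-- **Parseval's identity** for the probability measure on the torus. -/
theorem eLpNorm_two_haar_sq {f : Torus → ℂ} (hf : MemLp f 2 volume) :
    eLpNorm f 2 AddCircle.haarAddCircle ^ 2 = ∑' k, ‖fourierCoeff f k‖ₑ ^ 2 := by
  have hf' := memLp_haarAddCircle_iff.2 hf
  have h1 := hasSum_sq_fourierCoeff (hf'.toLp f)
  simp only [fourierCoeff_toLp_of_memLp] at h1
  have h2 : ∫ t, ‖hf'.toLp f t‖ ^ 2 ∂AddCircle.haarAddCircle
      = ∫ t, ‖f t‖ ^ 2 ∂AddCircle.haarAddCircle := by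
    apply integral_congr_ae
    filter_upwards [hf'.coeFn_toLp] with t ht
    rw [ht]
  rw [h2] at h1
  have h4 : ∑' k, ‖fourierCoeff f k‖ₑ ^ 2
      = ENNReal.ofReal (∫ t, ‖f t‖ ^ 2 ∂AddCircle.haarAddCircle) := by
    rw [← h1.tsum_eq, ENNReal.ofReal_tsum_of_nonneg (fun _ => by positivity) h1.summable]
    congr 1; ext k
    rw [ENNReal.ofReal_pow (norm_nonneg _), ofReal_norm]
  rw [h4, ← ENNReal.ofReal_toReal hf'.eLpNorm_ne_top, ← ENNReal.ofReal_pow ENNReal.toReal_nonneg]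
  congr 1
  rw [hf'.eLpNorm_eq_integral_rpow_norm (by norm_num) (by norm_num), ENNReal.toReal_ofReal]
  · rw [← Real.rpow_natCast, ← Real.rpow_mul (by positivity)]
    norm_num
  · positivity

theorem eLpNorm_two_sq {f : Torus → ℂ} (hf : MemLp f 2 volume) :
    eLpNorm f 2 volume ^ 2 = ENNReal.ofReal (2 * π) * ∑' k, ‖fourierCoeff f k‖ₑ ^ 2 := by
  rw [← eLpNorm_two_haar_sq hf, AddCircle.volume_eq_smul_haarAddCircle,
    eLpNorm_smul_measure_of_ne_top (by norm_num), smul_eq_mul, mul_pow]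
  congr 1
  rw [← ENNReal.rpow_natCast, ← ENNReal.rpow_mul]
  norm_num

theorem toFun_ae_eq {c : FourierSeq} {f : Torus → ℂ} (hf : MemLp f 2 volume)
    (h : ∀ k, fourierCoeff f k = c k) : toFun c =ᵐ[volume] f := by
  have hex : ∃ f : Torus → ℂ, MemLp f 2 volume ∧ ∀ k, fourierCoeff f k = c k := ⟨f, hf, h⟩
  have : toFun c = hex.choose := by
    rw [toFun, dif_pos hex]
  rw [this]
  exact ae_eq_of_fourierCoeff_eq hex.choose_spec.1 hf fun k => by
    rw [hex.choose_spec.2, h]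

theorem torusNorm_eq {p : ℝ≥0∞} (hp : 2 ≤ p) {c : FourierSeq} {f : Torus → ℂ}
    (hf : MemLp f p volume) (h : ∀ k, fourierCoeff f k = c k) :
    torusNorm p c = eLpNorm f p volume := by
  apply le_antisymm
  · exact iInf_le_of_le f (iInf_le_of_le hf (iInf_le_of_le h le_rfl))
  · refine le_iInf fun g => le_iInf fun hg => le_iInf fun hgc => le_of_eq ?_
    exact eLpNorm_congr_ae (ae_eq_of_fourierCoeff_eq (hf.mono_exponent hp) (hg.mono_exponent hp)
      fun k => by rw [h, hgc])

theorem exists_of_torusNorm_lt_top {p : ℝ≥0∞} {c : FourierSeq} (h : torusNorm p c < ∞) :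
    ∃ f : Torus → ℂ, MemLp f p volume ∧ ∀ k, fourierCoeff f k = c k := by
  by_contra hne
  push Not at hne
  refine h.ne (top_unique ?_)
  refine le_iInf fun f => le_iInf fun hf => le_iInf fun hfc => ?_
  obtain ⟨k, hk⟩ := hne f hf
  exact absurd (hfc k) hk

/-- The `ℓ²` norm of a nonnegative sequence. -/
noncomputable def l2 (x : ℤ → ℝ≥0∞) : ℝ≥0∞ := (∑' k, x k ^ 2) ^ (1 / 2 : ℝ)

theorem l2_sq (x : ℤ → ℝ≥0∞) : l2 x ^ 2 = ∑' k, x k ^ 2 := by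
  rw [l2, ← ENNReal.rpow_natCast, ← ENNReal.rpow_mul]; norm_num

theorem l2_le_iff {x : ℤ → ℝ≥0∞} {B : ℝ≥0∞} : l2 x ≤ B ↔ ∑' k, x k ^ 2 ≤ B ^ 2 := by
  rw [← l2_sq]
  exact (ENNReal.pow_le_pow_left_iff two_ne_zero).symm

theorem summable_of_tsum_enorm_sq {c : FourierSeq} (h : ∑' k, ‖c k‖ₑ ^ 2 ≠ ∞) :
    Summable fun k => ‖c k‖ ^ 2 := by
  have := ENNReal.summable_toReal h
  simpa using this

/-- `‖f‖_{L²} = (2π)^{1/2} ‖f̂‖_{ℓ²}`. -/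
theorem torusNorm_two_le (c : FourierSeq) :
    torusNorm 2 c ≤ ENNReal.ofReal (2 * π) ^ (1 / 2 : ℝ) * l2 fun k => ‖c k‖ₑ := by
  by_cases h : ∑' k, ‖c k‖ₑ ^ 2 = ∞
  · rw [l2, h]
    rw [ENNReal.top_rpow_of_pos (by norm_num), ENNReal.mul_top]
    · exact le_top
    · simp [Real.pi_pos]
  · obtain ⟨f, hf, hc⟩ := exists_memLp_of_summable (summable_of_tsum_enorm_sq h)
    rw [torusNorm_eq le_rfl hf hc]
    apply le_of_eq
    have := eLpNorm_two_sq hf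
    simp only [hc] at this
    rw [l2, ← ENNReal.mul_rpow_of_nonneg _ _ (by norm_num), ← this, ← ENNReal.rpow_natCast,
      ← ENNReal.rpow_mul]
    norm_num

/-! ### Minkowski's integral inequality for the exponents two and four -/

section Minkowski

variable {α β : Type*} [MeasurableSpace α] [MeasurableSpace β] {μ : Measure α} {ν : Measure β}

theorem lintegral_mul_le_sqrt {f g : α → ℝ≥0∞} (hf : AEMeasurable f μ) (hg : AEMeasurable g μ) :
    ∫⁻ x, f x * g x ∂μ ≤
      (∫⁻ x, f x ^ 2 ∂μ) ^ (1 / 2 : ℝ) * (∫⁻ x, g x ^ 2 ∂μ) ^ (1 / 2 : ℝ) := by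
  have := ENNReal.lintegral_mul_le_Lp_mul_Lq μ Real.HolderConjugate.two_two hf hg
  simpa using this

/-- Minkowski's inequality in `L²`: the square of the inner integral is a double integral, to which
Tonelli's theorem and the Cauchy–Schwarz inequality apply. -/
theorem minkowski_two [SFinite μ] [SFinite ν] {f : α → β → ℝ≥0∞}
    (hf : Measurable (Function.uncurry f)) :
    ∫⁻ x, (∫⁻ y, f x y ∂ν) ^ 2 ∂μ ≤ (∫⁻ y, (∫⁻ x, f x y ^ 2 ∂μ) ^ (1 / 2 : ℝ) ∂ν) ^ 2 := by
  have hx : ∀ x, Measurable (f x) := fun x => hf.comp measurable_prodMk_left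
  have hy : ∀ y, Measurable fun x => f x y := fun y => hf.comp measurable_prodMk_right
  have hN : Measurable fun y => (∫⁻ x, f x y ^ 2 ∂μ) ^ (1 / 2 : ℝ) :=
    ((hf.pow_const 2).lintegral_prod_left').pow_const _
  have hH : Measurable fun x => ∫⁻ y, f x y ∂ν := hf.lintegral_prod_right'
  set N := fun y => (∫⁻ x, f x y ^ 2 ∂μ) ^ (1 / 2 : ℝ)
  calc ∫⁻ x, (∫⁻ y, f x y ∂ν) ^ 2 ∂μ
      = ∫⁻ x, ∫⁻ y, f x y * ∫⁻ y', f x y' ∂ν ∂ν ∂μ := by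
        refine lintegral_congr fun x => ?_
        rw [lintegral_mul_const _ (hx x), sq]
    _ = ∫⁻ y, ∫⁻ x, f x y * ∫⁻ y', f x y' ∂ν ∂μ ∂ν :=
        lintegral_lintegral_swap (hf.mul (hH.comp measurable_fst)).aemeasurable
    _ = ∫⁻ y, ∫⁻ y', ∫⁻ x, f x y * f x y' ∂μ ∂ν ∂ν := by
        refine lintegral_congr fun y => ?_
        rw [← lintegral_lintegral_swap]
        · exact lintegral_congr fun x => (lintegral_const_mul _ (hx x)).symm
        · exact (((hy y).comp measurable_fst).mul hf).aemeasurable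
    _ ≤ ∫⁻ y, ∫⁻ y', N y * N y' ∂ν ∂ν :=
        lintegral_mono fun y => lintegral_mono fun y' =>
          lintegral_mul_le_sqrt (hy y).aemeasurable (hy y').aemeasurable
    _ = (∫⁻ y, N y ∂ν) ^ 2 := by
        simp_rw [lintegral_const_mul _ hN]
        rw [lintegral_mul_const _ hN, sq]

/-- Minkowski's inequality in `L⁴`, from the one in `L²` for the kernel `f x y * f x y'` on the
product `β × β`. -/
theorem minkowski_four [SFinite μ] [SFinite ν] {f : α → β → ℝ≥0∞}
    (hf : Measurable (Function.uncurry f)) :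
    ∫⁻ x, (∫⁻ y, f x y ∂ν) ^ 4 ∂μ ≤ (∫⁻ y, (∫⁻ x, f x y ^ 4 ∂μ) ^ (1 / 4 : ℝ) ∂ν) ^ 4 := by
  have hx : ∀ x, Measurable (f x) := fun x => hf.comp measurable_prodMk_left
  have hy : ∀ y, Measurable fun x => f x y := fun y => hf.comp measurable_prodMk_right
  have hN : Measurable fun y => (∫⁻ x, f x y ^ 4 ∂μ) ^ (1 / 4 : ℝ) :=
    ((hf.pow_const 4).lintegral_prod_left').pow_const _
  have hm : Measurable (Function.uncurry fun (x : α) (z : β × β) => f x z.1 * f x z.2) :=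
    (hf.comp (measurable_fst.prodMk (measurable_fst.comp measurable_snd))).mul
      (hf.comp (measurable_fst.prodMk (measurable_snd.comp measurable_snd)))
  have h1 : ∀ x, ∫⁻ z, f x z.1 * f x z.2 ∂(ν.prod ν) = (∫⁻ y, f x y ∂ν) ^ 2 := by
    intro x
    rw [lintegral_prod_mul (hx x).aemeasurable (hx x).aemeasurable, sq]
  have h2 := minkowski_two (μ := μ) (ν := ν.prod ν) hm
  simp only [h1, ← pow_mul] at h2
  refine h2.trans ?_
  rw [show (4 : ℕ) = 2 * 2 from rfl, pow_mul (∫⁻ y, _ ∂ν)]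
  gcongr
  rw [sq (∫⁻ y, _ ∂ν), ← lintegral_prod_mul hN.aemeasurable hN.aemeasurable]
  refine lintegral_mono fun z => ?_
  have h3 := lintegral_mul_le_sqrt (μ := μ) ((hy z.1).pow_const 2).aemeasurable
    ((hy z.2).pow_const 2).aemeasurable
  simp only [← mul_pow, ← pow_mul] at h3
  refine (ENNReal.rpow_le_rpow h3 (by norm_num : (0 : ℝ) ≤ 1 / 2)).trans_eq ?_
  rw [ENNReal.mul_rpow_of_nonneg _ _ (by norm_num), ← ENNReal.rpow_mul, ← ENNReal.rpow_mul]
  norm_num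

end Minkowski

/-! ### The norm of square summable sequences -/

theorem l2_eq_eLpNorm (x : ℤ → ℝ≥0∞) : l2 x = eLpNorm x 2 Measure.count := by
  rw [eLpNorm_eq_lintegral_rpow_enorm_toReal (by norm_num) (by norm_num), lintegral_count]
  simp [l2]

theorem l2_mono {x y : ℤ → ℝ≥0∞} (h : ∀ k, x k ≤ y k) : l2 x ≤ l2 y := by
  unfold l2; gcongr; exact h _

theorem le_l2 (x : ℤ → ℝ≥0∞) (k : ℤ) : x k ≤ l2 x := by
  rw [← ENNReal.pow_le_pow_left_iff two_ne_zero, l2_sq]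
  exact ENNReal.le_tsum k

theorem l2_sum_le {ι : Type*} (s : Finset ι) (x : ι → ℤ → ℝ≥0∞) :
    l2 (fun k => ∑ i ∈ s, x i k) ≤ ∑ i ∈ s, l2 (x i) := by
  simp_rw [l2_eq_eLpNorm]
  rw [show (fun k => ∑ i ∈ s, x i k) = ∑ i ∈ s, x i by ext k; simp]
  exact eLpNorm_sum_le (fun i _ => (measurable_of_countable _).aestronglyMeasurable) (by norm_num)

theorem l2_add_le (x y : ℤ → ℝ≥0∞) : l2 (fun k => x k + y k) ≤ l2 x + l2 y := by
  simp_rw [l2_eq_eLpNorm]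
  exact eLpNorm_add_le (measurable_of_countable _).aestronglyMeasurable
    (measurable_of_countable _).aestronglyMeasurable (by norm_num)

theorem l2_const_mul (a : ℝ≥0∞) (x : ℤ → ℝ≥0∞) : l2 (fun k => a * x k) = a * l2 x := by
  unfold l2
  simp_rw [mul_pow]
  rw [ENNReal.tsum_mul_left, ENNReal.mul_rpow_of_nonneg _ _ (by norm_num), ← ENNReal.rpow_natCast,
    ← ENNReal.rpow_mul]
  norm_num

theorem l2_comp_equiv (e : ℤ ≃ ℤ) (x : ℤ → ℝ≥0∞) : l2 (fun k => x (e k)) = l2 x := by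
  unfold l2
  rw [e.tsum_eq fun k => x k ^ 2]

theorem tsum_mul_le_l2 (x y : ℤ → ℝ≥0∞) : ∑' k, x k * y k ≤ l2 x * l2 y := by
  have := lintegral_mul_le_sqrt (μ := (Measure.count : Measure ℤ)) (f := x) (g := y)
    (measurable_of_countable _).aemeasurable (measurable_of_countable _).aemeasurable
  simpa [lintegral_count, l2] using this

/-- Minkowski's inequality: the `ℓ²` norm of an integral is at most the integral of the norms. -/
theorem l2_lintegral_le {β : Type*} [MeasurableSpace β] {ν : Measure β} [SFinite ν]
    {f : ℤ → β → ℝ≥0∞} (hf : ∀ k, AEMeasurable (f k) ν) :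
    l2 (fun k => ∫⁻ y, f k y ∂ν) ≤ ∫⁻ y, l2 (fun k => f k y) ∂ν := by
  have hae : ∀ᵐ y ∂ν, ∀ k, f k y = (hf k).mk (f k) y := ae_all_iff.2 fun k => (hf k).ae_eq_mk
  have h1 : (fun k => ∫⁻ y, f k y ∂ν) = fun k => ∫⁻ y, (hf k).mk (f k) y ∂ν := by
    ext k; exact lintegral_congr_ae (hf k).ae_eq_mk
  have h2 : ∫⁻ y, l2 (fun k => f k y) ∂ν = ∫⁻ y, l2 (fun k => (hf k).mk (f k) y) ∂ν := by
    refine lintegral_congr_ae (hae.mono fun y hy => ?_)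
    simp only [hy]
  rw [h1, h2, l2_le_iff]
  have := minkowski_two (μ := (Measure.count : Measure ℤ)) (ν := ν)
    (f := fun k y => (hf k).mk (f k) y)
    (measurable_from_prod_countable_right fun k => (hf k).measurable_mk)
  simpa [lintegral_count, l2] using this

theorem aemeasurable_l2 {β : Type*} [MeasurableSpace β] {ν : Measure β}
    {f : ℤ → β → ℝ≥0∞} (hf : ∀ k, AEMeasurable (f k) ν) :
    AEMeasurable (fun y => l2 fun k => f k y) ν :=
  (AEMeasurable.tsum fun k => (hf k).pow_const 2).pow_const _

/-! ### Products of absolutely continuous functions and oscillatory integrals -/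

/-- `f` is absolutely continuous on `[a, b]` with derivative `f'`, expressed by the fundamental
theorem of calculus. -/
def IsPrimitive (a b : ℝ) (f f' : ℝ → ℂ) : Prop :=
  IntervalIntegrable f' volume a b ∧ ∀ s ∈ Set.Icc a b, f s = f a + ∫ r in a..s, f' r

section

variable {a b : ℝ} {f f' g g' : ℝ → ℂ}

theorem IsPrimitive.continuousOn (hab : a ≤ b) (hf : IsPrimitive a b f f') :
    ContinuousOn f (Set.Icc a b) := by
  have h : ContinuousOn (fun s => f a + ∫ r in a..s, f' r) (Set.Icc a b) := by
    have := intervalIntegral.continuousOn_primitive_interval' hf.1 Set.left_mem_uIcc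
    rw [Set.uIcc_of_le hab] at this
    exact continuousOn_const.add this
  exact h.congr hf.2

theorem IsPrimitive.conj (hf : IsPrimitive a b f f') :
    IsPrimitive a b (fun s => (starRingEnd ℂ) (f s)) (fun s => (starRingEnd ℂ) (f' s)) := by
  refine ⟨⟨?_, ?_⟩, fun s hs => ?_⟩
  · exact (Complex.conjCLE : ℂ ≃L[ℝ] ℂ).toContinuousLinearMap.integrable_comp hf.1.1
  · exact (Complex.conjCLE : ℂ ≃L[ℝ] ℂ).toContinuousLinearMap.integrable_comp hf.1.2
  · beta_reduce
    rw [hf.2 s hs, map_add]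
    congr 1
    simp only [intervalIntegral]
    rw [map_sub, ← integral_conj, ← integral_conj]

/-- Integration by parts for two indefinite integrals: Fubini's theorem on the two triangles of a
square. -/
theorem intervalIntegral_mul_intervalIntegral {w z : ℝ → ℂ} {s : ℝ} (has : a ≤ s)
    (hw : IntervalIntegrable w volume a s) (hz : IntervalIntegrable z volume a s) :
    (∫ r in a..s, w r) * (∫ r in a..s, z r) =
      ∫ r in a..s, (w r * (∫ q in a..r, z q) + (∫ q in a..r, w q) * z r) := by
  have hwi : Integrable w (volume.restrict (Set.Ioc a s)) := hw.1
  have hzi : Integrable z (volume.restrict (Set.Ioc a s)) := hz.1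
  have hprod := hwi.mul_prod hzi
  have hset : MeasurableSet {p : ℝ × ℝ | p.2 ≤ p.1} :=
    measurableSet_le measurable_snd measurable_fst
  have hA := hprod.indicator hset
  have hB := hprod.indicator hset.compl
  have e1 : ∀ r ∈ Set.Ioc a s, ∫ q in Set.Ioc a s,
      Set.indicator {p : ℝ × ℝ | p.2 ≤ p.1} (fun p => w p.1 * z p.2) (r, q)
        = w r * ∫ q in a..r, z q := by
    intro r hr
    have : (fun q => Set.indicator {p : ℝ × ℝ | p.2 ≤ p.1} (fun p => w p.1 * z p.2) (r, q))
        = Set.indicator (Set.Iic r) fun q => w r * z q := by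
      ext q; simp [Set.indicator_apply]
    rw [this, setIntegral_indicator measurableSet_Iic, integral_const_mul,
      intervalIntegral.integral_of_le hr.1.le, Set.Ioc_inter_Iic, inf_eq_right.2 hr.2]
  have e2 : ∀ r ∈ Set.Ioc a s, ∫ q in Set.Ioc a s,
      Set.indicator {p : ℝ × ℝ | p.2 ≤ p.1}ᶜ (fun p => w p.1 * z p.2) (q, r)
        = (∫ q in a..r, w q) * z r := by
    intro r hr
    have : (fun q => Set.indicator {p : ℝ × ℝ | p.2 ≤ p.1}ᶜ (fun p => w p.1 * z p.2) (q, r))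
        = Set.indicator (Set.Iio r) fun q => w q * z r := by
      ext q; simp [Set.indicator_apply]
    rw [this, setIntegral_indicator measurableSet_Iio, integral_mul_const,
      intervalIntegral.integral_of_le hr.1.le, integral_Ioc_eq_integral_Ioo]
    congr 3
    ext q
    simp only [Set.mem_inter_iff, Set.mem_Ioc, Set.mem_Iio, Set.mem_Ioo]
    exact ⟨fun h => ⟨h.1.1, h.2⟩, fun h => ⟨⟨h.1, h.2.le.trans hr.2⟩, h.2⟩⟩
  have i1 : IntegrableOn (fun r => w r * ∫ q in a..r, z q) (Set.Ioc a s) :=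
    hA.integral_prod_left.congr (ae_restrict_of_forall_mem measurableSet_Ioc e1)
  have i2 : IntegrableOn (fun r => (∫ q in a..r, w q) * z r) (Set.Ioc a s) :=
    hB.integral_prod_right.congr (ae_restrict_of_forall_mem measurableSet_Ioc e2)
  rw [intervalIntegral.integral_of_le has, intervalIntegral.integral_of_le has,
    intervalIntegral.integral_of_le has, ← integral_prod_mul, integral_add i1 i2,
    ← setIntegral_congr_fun measurableSet_Ioc e1, ← setIntegral_congr_fun measurableSet_Ioc e2,
    ← integral_prod _ hA, ← integral_prod_symm _ hB, ← integral_add hA hB]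
  refine integral_congr_ae (Eventually.of_forall fun p => ?_)
  exact (congrFun (Set.indicator_self_add_compl {p : ℝ × ℝ | p.2 ≤ p.1}
    fun p : ℝ × ℝ => w p.1 * z p.2) p).symm

theorem IsPrimitive.mul (hab : a ≤ b) (hf : IsPrimitive a b f f') (hg : IsPrimitive a b g g') :
    IsPrimitive a b (fun s => f s * g s) (fun s => f' s * g s + f s * g' s) := by
  have hfc := hf.continuousOn hab
  have hgc := hg.continuousOn hab
  rw [← Set.uIcc_of_le hab] at hfc hgc
  have i1 := hf.1.mul_continuousOn hgc
  have i2 := hg.1.continuousOn_mul hfc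
  refine ⟨i1.add i2, fun s hs => ?_⟩
  have hsub : Set.uIcc a s ⊆ Set.uIcc a b := by
    rw [Set.uIcc_of_le hab, Set.uIcc_of_le hs.1]; exact Set.Icc_subset_Icc_right hs.2
  have hw := hf.1.mono_set hsub
  have hz := hg.1.mono_set hsub
  have j1 := i1.mono_set hsub
  have j2 := i2.mono_set hsub
  have h1 := intervalIntegral_mul_intervalIntegral hs.1 hw hz
  have hpt : ∫ r in a..s, (f' r * g r + f r * g' r) = ∫ r in a..s,
      (f' r * g a + f a * g' r + (f' r * (∫ q in a..r, g' q) + (∫ q in a..r, f' q) * g' r)) := by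
    apply intervalIntegral.integral_congr
    intro r hr
    rw [Set.uIcc_of_le hs.1] at hr
    have hr' : r ∈ Set.Icc a b := ⟨hr.1, hr.2.trans hs.2⟩
    simp only
    rw [hf.2 r hr', hg.2 r hr']
    ring
  have k1 : IntervalIntegrable (fun r => f' r * g a + f a * g' r) volume a s :=
    (hw.mul_const _).add (hz.const_mul _)
  have k2 : IntervalIntegrable (fun r => f' r * (∫ q in a..r, g' q) + (∫ q in a..r, f' q) * g' r)
      volume a s := by
    have := (j1.add j2).sub k1
    refine this.congr ?_
    intro r hr
    rw [Set.uIoc_of_le hs.1] at hr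
    have hr' : r ∈ Set.Icc a b := ⟨hr.1.le, hr.2.trans hs.2⟩
    simp only
    rw [hf.2 r hr', hg.2 r hr']
    ring
  rw [hpt, intervalIntegral.integral_add k1 k2, ← h1,
    intervalIntegral.integral_add (hw.mul_const _) (hz.const_mul _),
    intervalIntegral.integral_mul_const, intervalIntegral.integral_const_mul]
  beta_reduce
  rw [hf.2 s hs, hg.2 s hs]
  ring

theorem isPrimitive_exp (a b : ℝ) {φ : ℝ} (hφ : φ ≠ 0) :
    IsPrimitive a b (fun s => Complex.exp (Complex.I * (φ * s)) / (Complex.I * φ))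
      (fun s => Complex.exp (Complex.I * (φ * s))) := by
  have hc : (Complex.I * φ : ℂ) ≠ 0 := by simp [hφ]
  have hcont : Continuous fun s : ℝ => Complex.exp (Complex.I * (φ * s)) := by fun_prop
  refine ⟨hcont.intervalIntegrable _ _, fun s _ => ?_⟩
  rw [intervalIntegral.integral_eq_sub_of_hasDerivAt
    (f := fun s : ℝ => Complex.exp (Complex.I * (φ * s)) / (Complex.I * φ)) _
    (hcont.intervalIntegrable _ _)]
  · ring
  · intro x _
    have h1 : HasDerivAt (fun x : ℝ => Complex.I * φ * (x : ℂ)) (Complex.I * φ) x := by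
      simpa using (Complex.ofRealCLM.hasDerivAt (x := x)).const_mul (Complex.I * φ)
    have h2 := h1.cexp.div_const (Complex.I * φ)
    rw [mul_div_cancel_right₀ _ hc] at h2
    simpa only [mul_assoc] using h2

theorem enorm_exp_I_mul (x : ℝ) : ‖Complex.exp (Complex.I * x)‖ₑ = 1 := by
  rw [← ofReal_norm, mul_comm, Complex.norm_exp_ofReal_mul_I]; simp

/-- Integration by parts in an oscillatory integral with phase `φ`. -/
theorem enorm_integral_exp_mul_le (hab : a ≤ b) {φ : ℝ} (hφ : φ ≠ 0) (hf : IsPrimitive a b f f') :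
    ‖∫ s in a..b, Complex.exp (Complex.I * (φ * s)) * f s‖ₑ ≤
      ENNReal.ofReal |φ|⁻¹ * (‖f b‖ₑ + ‖f a‖ₑ + ∫⁻ s in Set.Icc a b, ‖f' s‖ₑ) := by
  have he := isPrimitive_exp a b hφ
  have hfc := hf.continuousOn hab
  have hec := he.continuousOn hab
  rw [← Set.uIcc_of_le hab] at hfc hec
  have hm := (he.mul hab hf).2 b ⟨hab, le_rfl⟩
  rw [intervalIntegral.integral_add (he.1.mul_continuousOn hfc) (hf.1.continuousOn_mul hec)] at hm
  set E : ℝ → ℂ := fun s => Complex.exp (Complex.I * (φ * s)) / (Complex.I * φ) with hE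
  have hEn : ∀ s, ‖E s‖ₑ = ENNReal.ofReal |φ|⁻¹ := by
    intro s
    have h1 : ‖E s‖ = |φ|⁻¹ := by
      rw [hE]
      simp only [norm_div, norm_mul, Complex.norm_I, Complex.norm_real, one_mul, Real.norm_eq_abs]
      have := Complex.norm_exp_ofReal_mul_I (φ * s)
      rw [mul_comm] at this
      push_cast at this
      rw [this, one_div]
    rw [← ofReal_norm, h1]
  have hm2 : ∫ s in a..b, Complex.exp (Complex.I * (φ * s)) * f s =
      E b * f b - E a * f a - ∫ s in a..b, E s * f' s := by
    have : E b * f b = E a * f a + ((∫ s in a..b, Complex.exp (Complex.I * (φ * s)) * f s) +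
      ∫ s in a..b, E s * f' s) := hm
    rw [this]; ring
  rw [hm2]
  have hI : ‖∫ s in a..b, E s * f' s‖ₑ ≤
      ENNReal.ofReal |φ|⁻¹ * ∫⁻ s in Set.Icc a b, ‖f' s‖ₑ := by
    rw [intervalIntegral.integral_of_le hab]
    refine (enorm_integral_le_lintegral_enorm _).trans ?_
    simp only [enorm_mul, hEn]
    rw [lintegral_const_mul' _ _ ENNReal.ofReal_ne_top]
    gcongr
    exact Set.Ioc_subset_Icc_self
  calc ‖E b * f b - E a * f a - ∫ s in a..b, E s * f' s‖ₑ
      ≤ ‖E b * f b‖ₑ + ‖E a * f a‖ₑ + ‖∫ s in a..b, E s * f' s‖ₑ := by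
        refine (enorm_sub_le).trans ?_
        gcongr
        exact enorm_sub_le
    _ ≤ _ := by
        simp only [enorm_mul, hEn, mul_add]
        gcongr

/-- Integration by parts in the oscillatory integral of a product `f̄ g h`. -/
theorem enorm_integral_exp_mul_three_le {h h' : ℝ → ℂ} (hab : a ≤ b) {φ : ℝ} (hφ : φ ≠ 0)
    (hf : IsPrimitive a b f f') (hg : IsPrimitive a b g g') (hh : IsPrimitive a b h h') :
    ‖∫ s in a..b, Complex.exp (Complex.I * (φ * s)) * ((starRingEnd ℂ) (f s) * g s * h s)‖ₑ ≤
      ENNReal.ofReal |φ|⁻¹ * (‖f b‖ₑ * ‖g b‖ₑ * ‖h b‖ₑ + ‖f a‖ₑ * ‖g a‖ₑ * ‖h a‖ₑ +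
        ∫⁻ s in Set.Icc a b, (‖f' s‖ₑ * ‖g s‖ₑ * ‖h s‖ₑ + ‖f s‖ₑ * ‖g' s‖ₑ * ‖h s‖ₑ +
          ‖f s‖ₑ * ‖g s‖ₑ * ‖h' s‖ₑ)) := by
  refine (enorm_integral_exp_mul_le hab hφ ((hf.conj.mul hab hg).mul hab hh)).trans ?_
  have hc : ∀ z : ℂ, ‖(starRingEnd ℂ) z‖ₑ = ‖z‖ₑ := fun z => by
    rw [← ofReal_norm, Complex.norm_conj, ofReal_norm]
  simp only [enorm_mul, hc]
  gcongr with s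
  refine (enorm_add_le _ _).trans ?_
  simp only [enorm_mul, hc]
  gcongr
  refine (mul_le_mul_left (enorm_add_le _ _) _).trans ?_
  simp only [enorm_mul, hc, add_mul]
  exact le_rfl

end

/-! ### The Riesz projection on `L⁴` and `L⁶` -/

/-- The pointwise inequality behind Riesz' bound for the exponent `q`: up to a multiple of the
harmonic function `Re z^q`, the power `|z|^q` is controlled by that of the real part. -/
def RieszExponent (q : ℕ) (C : ℝ≥0) : Prop :=
  2 ≤ q ∧ 1 ≤ C ∧ ∃ σ : ℝ, ∀ z : ℂ, ‖z‖ ^ q ≤ C * |z.re| ^ q + σ * (z ^ q).re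

theorem norm_sq_eq (z : ℂ) : ‖z‖ ^ 2 = z.re ^ 2 + z.im ^ 2 := by
  rw [Complex.sq_norm, Complex.normSq_apply]; ring

/-- With `x = Re z` and `y = Im z` the claim for the multiple `2` of `Re z⁴` is a quadratic
inequality in `x²` and `y²`. -/
theorem rieszExponent_four : RieszExponent 4 48 := by
  refine ⟨by norm_num, by norm_num, 2, fun z => ?_⟩
  have h1 : ‖z‖ ^ 4 = (z.re ^ 2 + z.im ^ 2) ^ 2 := by rw [← norm_sq_eq]; ring
  have h2 : |z.re| ^ 4 = z.re ^ 4 := (even_two_mul 2).pow_abs z.re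
  have h3 : (z ^ 4).re = z.re ^ 4 - 6 * z.re ^ 2 * z.im ^ 2 + z.im ^ 4 := by
    simp [pow_succ, Complex.mul_re, Complex.mul_im]; ring
  rw [h1, h2, h3]
  push_cast
  nlinarith [sq_nonneg (z.im ^ 2 - 7 * z.re ^ 2)]

/-- The multiple of `Re z⁶` is negative, since `Re (iy)⁶ = -y⁶`; the terms of mixed degree are
absorbed into `y⁶` when `33 x² ≤ y²`, and into `x⁶` otherwise. -/
theorem rieszExponent_six : RieszExponent 6 40000 := by
  refine ⟨by norm_num, by norm_num, -2, fun z => ?_⟩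
  have h1 : ‖z‖ ^ 6 = (z.re ^ 2 + z.im ^ 2) ^ 3 := by rw [← norm_sq_eq]; ring
  have h2 : |z.re| ^ 6 = z.re ^ 6 := (even_two_mul 3).pow_abs z.re
  have h3 : (z ^ 6).re = z.re ^ 6 - 15 * z.re ^ 4 * z.im ^ 2 + 15 * z.re ^ 2 * z.im ^ 4
      - z.im ^ 6 := by
    simp [pow_succ, Complex.mul_re, Complex.mul_im]; ring
  rw [h1, h2, h3]
  push_cast
  have hx := sq_nonneg z.re
  have hy := sq_nonneg z.im
  rcases le_total (33 * z.re ^ 2) (z.im ^ 2) with h | h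
  · nlinarith [mul_nonneg (pow_nonneg hy 2) (sub_nonneg.2 h), pow_nonneg hx 3,
      mul_nonneg (pow_nonneg hx 2) hy]
  · have h4 : (z.im ^ 2) ^ 2 ≤ (33 * z.re ^ 2) ^ 2 := by gcongr
    nlinarith [mul_nonneg hx (sub_nonneg.2 h4), pow_nonneg hx 3, pow_nonneg hy 3,
      mul_nonneg (pow_nonneg hx 2) hy]

theorem eLpNorm_haar_pow {q : ℕ} (hq : q ≠ 0) (f : C(Torus, ℂ)) :
    eLpNorm f q AddCircle.haarAddCircle ^ q =
      ENNReal.ofReal (∫ x, ‖f x‖ ^ q ∂AddCircle.haarAddCircle) := by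
  have hf := memLp_haarAddCircle_iff.2 (memLp_continuousMap f q)
  rw [hf.eLpNorm_eq_integral_rpow_norm (by exact_mod_cast hq) (by simp),
    ← ENNReal.ofReal_pow (by positivity)]
  congr 1
  rw [← Real.rpow_natCast, ← Real.rpow_mul (by positivity)]
  simp [hq]

theorem eLpNorm_le_of_haar {q : ℕ} {f g : Torus → ℂ} {B : ℝ≥0∞}
    (h : eLpNorm f q AddCircle.haarAddCircle ≤ B * eLpNorm g q AddCircle.haarAddCircle) :
    eLpNorm f q volume ≤ B * eLpNorm g q volume := by
  rw [AddCircle.volume_eq_smul_haarAddCircle,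
    eLpNorm_smul_measure_of_ne_top (by simp),
    eLpNorm_smul_measure_of_ne_top (by simp), smul_eq_mul, smul_eq_mul]
  calc _ ≤ _ := mul_le_mul_right h _
    _ = _ := by ring

theorem integrable_haar (f : C(Torus, ℂ)) :
    Integrable f (AddCircle.haarAddCircle : Measure Torus) :=
  memLp_one_iff_integrable.1 (memLp_haarAddCircle_iff.2 (memLp_continuousMap f 1))

theorem integrable_haar_real (f : C(Torus, ℝ)) :
    Integrable f (AddCircle.haarAddCircle : Measure Torus) := by
  simpa using f.continuous.continuousOn.integrableOn_compact isCompact_univ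

/-- An analytic trigonometric polynomial without constant term is controlled by its real part:
the integral of its `q`-th power vanishes. -/
theorem eLpNorm_analytic_le {q : ℕ} {C : ℝ≥0} (hq : RieszExponent q C) {p : Polynomial ℂ}
    (hp : p.coeff 0 = 0) :
    eLpNorm p.toAddCircle q AddCircle.haarAddCircle ≤
      C * eLpNorm (fun x => ((p.toAddCircle x).re : ℂ)) q AddCircle.haarAddCircle := by
  obtain ⟨hq2, hC, σ, hσ⟩ := hq
  have hq0 : q ≠ 0 := by omega
  set g := p.toAddCircle with hg
  let h : C(Torus, ℂ) := ⟨fun x => ((g x).re : ℂ), by fun_prop⟩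
  -- The power `p ^ q` has no constant term either, so the mean of `g ^ q` is zero.
  have hz : ∫ x, (g x ^ q).re ∂AddCircle.haarAddCircle = 0 := by
    have h1 := (p ^ q).fourierCoeff_toAddCircle 0
    have h2 : ((p ^ q).toAddCircle : Torus → ℂ) = fun x => g x ^ q := by ext x; simp [hg]
    have h3 : (p ^ q).coeff 0 = 0 := by
      rw [Polynomial.coeff_zero_eq_eval_zero, Polynomial.eval_pow,
        ← Polynomial.coeff_zero_eq_eval_zero, hp, zero_pow hq0]
    rw [h2] at h1
    simp only [le_refl, if_true, Int.natAbs_zero, h3] at h1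
    simp only [fourierCoeff, neg_zero, fourier_zero, one_smul] at h1
    have h4 := integral_re (𝕜 := ℂ) (integrable_haar (g ^ q))
    simp only [ContinuousMap.coe_pow, Pi.pow_apply, RCLike.re_to_complex] at h4
    rw [h4, h1]; simp
  have hle : ∫ x, ‖g x‖ ^ q ∂AddCircle.haarAddCircle ≤
      C * ∫ x, ‖h x‖ ^ q ∂AddCircle.haarAddCircle := by
    have i1 : Integrable (fun x => ‖g x‖ ^ q) (AddCircle.haarAddCircle : Measure Torus) :=
      integrable_haar_real ⟨fun x => ‖g x‖ ^ q, by fun_prop⟩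
    have i2 : Integrable (fun x => ‖h x‖ ^ q) (AddCircle.haarAddCircle : Measure Torus) :=
      integrable_haar_real ⟨fun x => ‖h x‖ ^ q, by fun_prop⟩
    have i3 : Integrable (fun x => (g x ^ q).re) (AddCircle.haarAddCircle : Measure Torus) :=
      integrable_haar_real ⟨fun x => (g x ^ q).re, by fun_prop⟩
    have h5 := integral_mono i1 ((i2.const_mul C).add (i3.const_mul σ)) fun x => by
      simpa [h] using hσ (g x)
    simp only [Pi.add_apply] at h5
    rwa [integral_add (i2.const_mul _) (i3.const_mul _), integral_const_mul, integral_const_mul, hz,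
      mul_zero, add_zero] at h5
  change _ ≤ C * eLpNorm h q AddCircle.haarAddCircle
  rw [← ENNReal.pow_le_pow_left_iff hq0, mul_pow, eLpNorm_haar_pow hq0, eLpNorm_haar_pow hq0]
  calc _ ≤ ENNReal.ofReal (C * ∫ x, ‖h x‖ ^ q ∂AddCircle.haarAddCircle) :=
        ENNReal.ofReal_le_ofReal hle
    _ = C * ENNReal.ofReal (∫ x, ‖h x‖ ^ q ∂AddCircle.haarAddCircle) := by
        rw [ENNReal.ofReal_mul (NNReal.coe_nonneg C), ENNReal.ofReal_coe_nnreal]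
    _ ≤ _ := by
        gcongr
        exact_mod_cast le_self_pow hC hq0

theorem enorm_fourierCoeff_le_haar {q : ℝ≥0∞} (hq : 1 ≤ q) {f : Torus → ℂ}
    (hf : AEStronglyMeasurable f AddCircle.haarAddCircle) (k : ℤ) :
    ‖fourierCoeff f k‖ₑ ≤ eLpNorm f q AddCircle.haarAddCircle := by
  refine (enorm_integral_le_lintegral_enorm _).trans
    (le_trans ?_ (eLpNorm_le_eLpNorm_of_exponent_le hq hf))
  rw [eLpNorm_one_eq_lintegral_enorm]
  refine lintegral_mono fun x => ?_
  rw [enorm_smul]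
  have : ‖(fourier (-k) x : ℂ)‖ₑ = 1 := by
    rw [fourier_apply, ← ofReal_norm, Circle.norm_coe, ENNReal.ofReal_one]
  rw [this, one_mul]

/-- The polynomial `∑_{k=1}^K d k X^k`. -/
noncomputable def analyticPoly (K : ℕ) (d : FourierSeq) : Polynomial ℂ :=
  ∑ k ∈ Finset.Icc 1 K, Polynomial.monomial k (d k)

theorem coeff_zero_analyticPoly (K : ℕ) (d : FourierSeq) : (analyticPoly K d).coeff 0 = 0 := by
  rw [analyticPoly, Polynomial.finsetSum_coeff]
  refine Finset.sum_eq_zero fun k hk => ?_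
  rw [Polynomial.coeff_monomial, if_neg]
  have := (Finset.mem_Icc.1 hk).1
  omega

theorem toAddCircle_analyticPoly (K : ℕ) (d : FourierSeq) (x : Torus) :
    (analyticPoly K d).toAddCircle x = ∑ k ∈ Finset.Icc 1 K, d k * fourier (k : ℤ) x := by
  simp [analyticPoly, Polynomial.toAddCircle_monomial_eq_smul_fourier, map_sum]

theorem sum_Icc_neg_eq {M : Type*} [AddCommMonoid M] (K : ℕ) (F : ℤ → M) :
    ∑ k ∈ Finset.Icc (-(K : ℤ)) K, F k = F 0 + ∑ k ∈ Finset.Icc 1 K, (F k + F (-k)) := by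
  induction K with
  | zero => simp
  | succ K ih =>
    have h : Finset.Icc (-((K + 1 : ℕ) : ℤ)) ((K + 1 : ℕ) : ℤ) =
        insert ((K + 1 : ℕ) : ℤ) (insert (-((K + 1 : ℕ) : ℤ)) (Finset.Icc (-(K : ℤ)) K)) := by
      ext k; simp only [Finset.mem_insert, Finset.mem_Icc]; omega
    rw [h, Finset.sum_insert, Finset.sum_insert, ih, Finset.sum_Icc_succ_top (by omega)]
    · rw [← add_assoc, add_comm (F _ + F _), add_assoc]
    · simp
    · simp only [Finset.mem_insert, Finset.mem_Icc]; omega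

/-- Projection of a real trigonometric polynomial, with coefficients `d`, to its positive
frequencies. -/
theorem eLpNorm_positive_of_real {q : ℕ} {C : ℝ≥0} (hq : RieszExponent q C) {K : ℕ}
    {d : FourierSeq} (hd : ∀ k, d (-k) = (starRingEnd ℂ) (d k)) {f : C(Torus, ℂ)}
    (hf : ∀ x, ‖trig (Finset.Icc (-(K : ℤ)) K) d x‖ ≤ ‖f x‖)
    (hd0 : ‖d 0‖ₑ ≤ eLpNorm f q AddCircle.haarAddCircle) :
    eLpNorm (analyticPoly K d).toAddCircle q AddCircle.haarAddCircle ≤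
      2 * C * eLpNorm f q AddCircle.haarAddCircle := by
  have hq1 : (1 : ℝ≥0∞) ≤ q := by have := hq.1; exact_mod_cast (by omega : 1 ≤ q)
  refine (eLpNorm_analytic_le hq (coeff_zero_analyticPoly K d)).trans ?_
  rw [show ∀ e : ℝ≥0∞, 2 * C * e = C * (e + e) from fun e => by ring]
  gcongr
  set g := (analyticPoly K d).toAddCircle with hg
  have hre : ∀ x, (g x).re = (trig (Finset.Icc (-(K : ℤ)) K) d x - d 0).re / 2 := by
    intro x
    have : trig (Finset.Icc (-(K : ℤ)) K) d x = d 0 + (g x + (starRingEnd ℂ) (g x)) := by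
      rw [trig_apply, sum_Icc_neg_eq, hg, toAddCircle_analyticPoly, map_sum,
        ← Finset.sum_add_distrib, fourier_zero, mul_one]
      congr 1
      exact Finset.sum_congr rfl fun k _ => by rw [map_mul, hd, fourier_neg]
    rw [this, add_sub_cancel_left, Complex.add_re, Complex.conj_re]
    ring
  have hle : ∀ x, ‖((g x).re : ℂ)‖ ≤ ‖(‖f x‖ + ‖d 0‖ : ℝ)‖ := by
    intro x
    rw [Complex.norm_real, hre, Real.norm_eq_abs, Real.norm_eq_abs, abs_div,
      abs_of_nonneg (by positivity : 0 ≤ ‖f x‖ + ‖d 0‖)]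
    have h1 := (Complex.abs_re_le_norm _).trans
      (norm_sub_le (trig (Finset.Icc (-(K : ℤ)) K) d x) (d 0))
    have h2 := hf x
    have : |(2 : ℝ)| = 2 := abs_two
    rw [this]
    linarith [norm_nonneg (f x), norm_nonneg (d 0)]
  refine (eLpNorm_mono hle).trans ?_
  refine (eLpNorm_add_le (f := fun x => ‖f x‖) (g := fun _ => ‖d 0‖)
    f.continuous.norm.aestronglyMeasurable aestronglyMeasurable_const hq1).trans ?_
  rw [eLpNorm_norm]
  gcongr
  rw [eLpNorm_const _ (by positivity) (IsProbabilityMeasure.ne_zero _)]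
  simpa using hd0

/-- **Riesz' theorem** for trigonometric polynomials: projection to the positive frequencies. -/
theorem eLpNorm_positive_le {q : ℕ} {C : ℝ≥0} (hq : RieszExponent q C) (K : ℕ) (c : FourierSeq) :
    eLpNorm (trig (Finset.Icc 1 (K : ℤ)) c) q AddCircle.haarAddCircle ≤
      4 * C * eLpNorm (trig (Finset.Icc (-(K : ℤ)) K) c) q AddCircle.haarAddCircle := by
  have hq1 : (1 : ℝ≥0∞) ≤ q := by have := hq.1; exact_mod_cast (by omega : 1 ≤ q)
  set f := trig (Finset.Icc (-(K : ℤ)) K) c with hf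
  -- `d₁` and `d₂` are the coefficients of the real and of the imaginary part of `f`
  let d₁ : FourierSeq := fun k => (c k + (starRingEnd ℂ) (c (-k))) / 2
  let d₂ : FourierSeq := fun k => (c k - (starRingEnd ℂ) (c (-k))) / (2 * Complex.I)
  have hconj : ∀ x, (starRingEnd ℂ) (f x) =
      trig (Finset.Icc (-(K : ℤ)) K) (fun k => (starRingEnd ℂ) (c (-k))) x := by
    intro x
    rw [hf, trig_apply, trig_apply, map_sum]
    refine Finset.sum_nbij' (fun k => -k) (fun k => -k) ?_ ?_ ?_ ?_ ?_
    · intro k hk; simp only [Finset.mem_Icc] at hk ⊢; omega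
    · intro k hk; simp only [Finset.mem_Icc] at hk ⊢; omega
    · simp
    · simp
    · intro k _; simp
  have hd₁ : ∀ x, trig (Finset.Icc (-(K : ℤ)) K) d₁ x = (f x + (starRingEnd ℂ) (f x)) / 2 := by
    intro x
    rw [hconj, hf, trig_apply, trig_apply, trig_apply, ← Finset.sum_add_distrib, Finset.sum_div]
    exact Finset.sum_congr rfl fun k _ => by simp only [d₁]; ring
  have hd₂ : ∀ x, trig (Finset.Icc (-(K : ℤ)) K) d₂ x =
      (f x - (starRingEnd ℂ) (f x)) / (2 * Complex.I) := by
    intro x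
    rw [hconj, hf, trig_apply, trig_apply, trig_apply, ← Finset.sum_sub_distrib, Finset.sum_div]
    exact Finset.sum_congr rfl fun k _ => by simp only [d₂]; ring
  have hc0 : ‖c 0‖ₑ ≤ eLpNorm f q AddCircle.haarAddCircle := by
    have := enorm_fourierCoeff_le_haar hq1 (f := f) f.continuous.aestronglyMeasurable 0
    rw [hf, fourierCoeff_trig, if_pos (by simp)] at this
    exact this
  have h₁ := eLpNorm_positive_of_real hq (K := K) (d := d₁) (f := f)
    (fun k => by simp [d₁, add_comm, map_ofNat]) (fun x => by
      rw [hd₁, Complex.add_conj, mul_comm, Complex.norm_div]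
      push_cast
      simpa using Complex.abs_re_le_norm (f x)) (by
      refine le_trans ?_ hc0
      rw [← ofReal_norm, ← ofReal_norm]
      refine ENNReal.ofReal_le_ofReal ?_
      simp only [d₁, neg_zero, Complex.add_conj]
      simpa using Complex.abs_re_le_norm (c 0))
  have h₂ := eLpNorm_positive_of_real hq (K := K) (d := d₂) (f := f)
    (fun k => by
      simp only [d₂, neg_neg, map_div₀, map_sub, Complex.conj_conj, map_mul, Complex.conj_I,
        map_ofNat]
      rw [mul_neg, div_neg, ← neg_div, neg_sub]) (fun x => by
      rw [hd₂, Complex.sub_conj]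
      simpa using Complex.abs_im_le_norm (f x)) (by
      refine le_trans ?_ hc0
      rw [← ofReal_norm, ← ofReal_norm]
      refine ENNReal.ofReal_le_ofReal ?_
      simp only [d₂, neg_zero, Complex.sub_conj]
      simpa using Complex.abs_im_le_norm (c 0))
  have hsum : (trig (Finset.Icc 1 (K : ℤ)) c : Torus → ℂ) =
      (analyticPoly K d₁).toAddCircle + Complex.I • (analyticPoly K d₂).toAddCircle := by
    ext x
    rw [trig_apply, Pi.add_apply, Pi.smul_apply, toAddCircle_analyticPoly, toAddCircle_analyticPoly,
      Finset.smul_sum, ← Finset.sum_add_distrib]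
    symm
    refine Finset.sum_nbij (fun k : ℕ => (k : ℤ)) ?_ ?_ ?_ ?_
    · intro k hk; simp only [Finset.mem_Icc] at hk ⊢; omega
    · exact Nat.cast_injective.injOn
    · intro k hk
      simp only [Finset.coe_Icc, Set.mem_Icc, Set.mem_image] at hk ⊢
      exact ⟨k.toNat, by omega, by omega⟩
    · intro k _
      have : d₁ k + Complex.I * d₂ k = c k := by
        simp only [d₁, d₂]
        field_simp
        ring
      rw [← this, smul_eq_mul]; ring
  rw [hsum]
  refine (eLpNorm_add_le (ContinuousMap.continuous _).aestronglyMeasurable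
    ((ContinuousMap.continuous _).aestronglyMeasurable.const_smul _) hq1).trans ?_
  rw [eLpNorm_const_smul]
  have : ‖Complex.I‖ₑ = 1 := by rw [← ofReal_norm]; simp
  rw [this, one_mul]
  calc _ ≤ _ := add_le_add h₁ h₂
    _ = _ := by ring

/-! ### Fourier multipliers of bounded variation -/

/-- The multiplier with symbol `m` is bounded on `L^q` with norm at most `B`; it is enough to ask
this for trigonometric polynomials. -/
def MultBdd (q : ℕ) (B : ℝ≥0) (m : ℤ → ℂ) : Prop :=
  ∀ (S : Finset ℤ) (c : FourierSeq),
    eLpNorm (trig S (mult m c)) q volume ≤ B * eLpNorm (trig S c) q volume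

theorem trig_congr {S : Finset ℤ} {c d : FourierSeq} (h : ∀ k ∈ S, c k = d k) :
    trig S c = trig S d :=
  Finset.sum_congr rfl fun k hk => by rw [h k hk]

theorem trig_subset {S S' : Finset ℤ} {c : FourierSeq} (hS : S ⊆ S')
    (h : ∀ k ∈ S', k ∉ S → c k = 0) : trig S c = trig S' c :=
  Finset.sum_subset hS fun k hk hk' => by rw [h k hk hk', zero_smul]

theorem trig_filter (S : Finset ℤ) (P : ℤ → Prop) [DecidablePred P] (c : FourierSeq) :
    trig (S.filter P) c = trig S (mult (fun k => if P k then 1 else 0) c) := by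
  rw [trig, trig, Finset.sum_filter]
  exact Finset.sum_congr rfl fun k _ => by simp [mult]

theorem trig_mult_mult (S : Finset ℤ) (m m' : ℤ → ℂ) (c : FourierSeq) :
    trig S (mult m (mult m' c)) = trig S (mult (fun k => m k * m' k) c) :=
  trig_congr fun k _ => by simp [mult, mul_assoc]

theorem enorm_fourier (k : ℤ) (x : Torus) : ‖(fourier k x : ℂ)‖ₑ = 1 := by
  rw [fourier_apply, ← ofReal_norm, Circle.norm_coe, ENNReal.ofReal_one]

/-- The projection to the frequencies above `l` is conjugate to that to the positive ones by the
unimodular factor `e^{ilx}`. -/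
theorem multBdd_halfLine {q : ℕ} {C : ℝ≥0} (hq : RieszExponent q C) (l : ℤ) :
    MultBdd q (4 * C) (fun k => if l < k then 1 else 0) := by
  intro S c
  rw [← trig_filter]
  set K := S.sup fun k => (k - l).natAbs with hK
  have hKS : ∀ k ∈ S, (k - l).natAbs ≤ K := fun k hk =>
    Finset.le_sup (f := fun k => (k - l).natAbs) hk
  let c' : FourierSeq := fun k => if k + l ∈ S then c (k + l) else 0
  have key : ∀ (T : Finset ℤ) (S' : Finset ℤ), (∀ k, k ∈ S' ↔ k ∈ S ∧ k - l ∈ T) →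
      eLpNorm (trig S' c) q (volume : Measure Torus) = eLpNorm (trig T c') q volume := by
    intro T S' hTS
    refine eLpNorm_congr_enorm_ae (Eventually.of_forall fun x => ?_)
    have : trig S' c x = fourier l x * trig T c' x := by
      rw [trig_apply, trig_apply, Finset.mul_sum]
      have h1 : ∑ k ∈ T, fourier l x * (c' k * fourier k x) =
          ∑ k ∈ T.filter (fun k => k + l ∈ S), fourier l x * (c' k * fourier k x) := by
        rw [Finset.sum_filter]
        exact Finset.sum_congr rfl fun k _ => by by_cases h : k + l ∈ S <;> simp [c', h]
      rw [h1]
      refine Finset.sum_nbij' (fun k => k - l) (fun k => k + l) ?_ ?_ ?_ ?_ ?_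
      · intro k hk
        rw [Finset.mem_filter]
        simpa [and_comm] using (hTS k).1 hk
      · intro k hk
        rw [Finset.mem_filter] at hk
        rw [hTS]
        simpa [and_comm] using hk
      · simp
      · simp
      · intro k hk
        have hkS := ((hTS k).1 hk).1
        simp only [c', sub_add_cancel, if_pos hkS]
        have : (fourier k x : ℂ) = fourier (l + (k - l)) x := by congr 2; ring
        rw [this, fourier_add]; ring
    rw [this, enorm_mul, enorm_fourier, one_mul]
  rw [key (Finset.Icc 1 (K : ℤ)) (S.filter fun k => l < k),
    key (Finset.Icc (-(K : ℤ)) K) S]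
  · exact_mod_cast eLpNorm_le_of_haar (eLpNorm_positive_le hq K c')
  · intro k
    refine ⟨fun hk => ⟨hk, ?_⟩, fun h => h.1⟩
    have := hKS k hk
    rw [Finset.mem_Icc]; omega
  · intro k
    simp only [Finset.mem_filter, Finset.mem_Icc]
    refine ⟨fun hk => ⟨hk.1, ?_⟩, fun h => ⟨h.1, ?_⟩⟩
    · have := hKS k hk.1
      omega
    · omega

theorem one_le_of_rieszExponent {q : ℕ} {C : ℝ≥0} (hq : RieszExponent q C) :
    (1 : ℝ≥0∞) ≤ q := by
  have := hq.1
  exact_mod_cast (by omega : 1 ≤ q)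

theorem MultBdd.congr {q : ℕ} {B : ℝ≥0} {m m' : ℤ → ℂ} (h : MultBdd q B m)
    (hm : ∀ k, m' k = m k) : MultBdd q B m' := by
  rwa [show m' = m from funext hm]

theorem MultBdd.mono {q : ℕ} {B B' : ℝ≥0} {m : ℤ → ℂ} (h : MultBdd q B m) (hB : B ≤ B') :
    MultBdd q B' m := fun S c => (h S c).trans (by gcongr)

theorem MultBdd.mul {q : ℕ} {B B' : ℝ≥0} {m m' : ℤ → ℂ} (h : MultBdd q B m)
    (h' : MultBdd q B' m') : MultBdd q (B * B') (fun k => m k * m' k) := by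
  intro S c
  rw [← trig_mult_mult]
  refine (h S _).trans ?_
  rw [ENNReal.coe_mul, mul_assoc]
  exact mul_le_mul_right (h' S c) _

theorem MultBdd.sum {q : ℕ} (hq : (1 : ℝ≥0∞) ≤ q) {ι : Type*} {s : Finset ι} {B : ι → ℝ≥0}
    {m : ι → ℤ → ℂ} (h : ∀ i ∈ s, MultBdd q (B i) (m i)) :
    MultBdd q (∑ i ∈ s, B i) (fun k => ∑ i ∈ s, m i k) := by
  intro S c
  have h1 : (trig S (mult (fun k => ∑ i ∈ s, m i k) c) : Torus → ℂ) =
      ∑ i ∈ s, (trig S (mult (m i) c) : Torus → ℂ) := by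
    ext x
    simp only [trig_apply, Finset.sum_apply, mult]
    rw [Finset.sum_comm]
    simp only [Finset.sum_mul]
  rw [h1]
  refine (eLpNorm_sum_le (fun i _ => (ContinuousMap.continuous _).aestronglyMeasurable) hq).trans ?_
  rw [ENNReal.ofNNReal_finsetSum, Finset.sum_mul]
  exact Finset.sum_le_sum fun i hi => h i hi S c

theorem MultBdd.add {q : ℕ} (hq : (1 : ℝ≥0∞) ≤ q) {B B' : ℝ≥0} {m m' : ℤ → ℂ}
    (h : MultBdd q B m) (h' : MultBdd q B' m') : MultBdd q (B + B') (fun k => m k + m' k) := by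
  have := MultBdd.sum hq (s := Finset.univ) (B := ![B, B']) (m := ![m, m'])
    (by intro i _; fin_cases i <;> simpa)
  simpa using this

theorem multBdd_const (q : ℕ) {B : ℝ≥0} {a : ℂ} (ha : ‖a‖ₑ ≤ B) : MultBdd q B (fun _ => a) := by
  intro S c
  have : (trig S (mult (fun _ => a) c) : Torus → ℂ) = a • (trig S c : Torus → ℂ) := by
    ext x; simp [trig_apply, mult, Finset.mul_sum, mul_assoc]
  rw [this, eLpNorm_const_smul]
  gcongr

theorem MultBdd.const_mul {q : ℕ} {B : ℝ≥0} {m : ℤ → ℂ} (h : MultBdd q B m) (a : ℂ) :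
    MultBdd q (‖a‖₊ * B) (fun k => a * m k) :=
  (multBdd_const q (a := a) (by simp)).mul h

theorem multBdd_Ioc {q : ℕ} {C : ℝ≥0} (hq : RieszExponent q C) (a b : ℤ) :
    MultBdd q (4 * C * (1 + 4 * C)) (fun k => if a < k ∧ k ≤ b then 1 else 0) := by
  have h1 := (multBdd_const q (B := 1) (a := 1) (by simp)).add (one_le_of_rieszExponent hq)
    ((multBdd_halfLine hq b).const_mul (-1))
  refine ((multBdd_halfLine hq a).mul h1).mono (by simp) |>.congr fun k => ?_
  by_cases h1 : a < k <;> by_cases h2 : b < k <;> simp [h1, h2]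

theorem sum_Ico_sub (m : ℤ → ℂ) {a b : ℤ} (h : a ≤ b) :
    ∑ l ∈ Finset.Ico a b, (m (l + 1) - m l) = m b - m a := by
  induction b, h using Int.leInduction with
  | base => simp
  | succ n hn ih =>
    have : Finset.Ico a (n + 1) = insert n (Finset.Ico a n) := by
      ext k; simp only [Finset.mem_insert, Finset.mem_Ico]; omega
    rw [this, Finset.sum_insert (by simp), ih]; ring

/-- Summation by parts: a bounded symbol of bounded variation defines a bounded multiplier, being
an average of projections to half lines. -/
theorem multBdd_of_variation {q : ℕ} {C : ℝ≥0} (hq : RieszExponent q C) {m : ℤ → ℂ} {B V : ℝ≥0}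
    (hB : ∀ k, ‖m k‖ₑ ≤ B) (hV : ∑' k, ‖m (k + 1) - m k‖ₑ ≤ V) :
    MultBdd q (B + V * (4 * C)) m := by
  intro S c
  obtain ⟨K, hK⟩ : ∃ K : ℕ, ∀ k ∈ S, k.natAbs ≤ K :=
    ⟨S.sup fun k => k.natAbs, fun k hk => Finset.le_sup (f := fun k : ℤ => k.natAbs) hk⟩
  set I := Finset.Ico (-(K : ℤ)) K
  have hm : ∀ k ∈ S, m k = m (-K) + ∑ l ∈ I, (m (l + 1) - m l) * (if l < k then 1 else 0) := by
    intro k hk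
    have h1 := hK k hk
    have h2 : ∑ l ∈ I, (m (l + 1) - m l) * (if l < k then 1 else 0) =
        ∑ l ∈ Finset.Ico (-(K : ℤ)) k, (m (l + 1) - m l) := by
      simp only [mul_ite, mul_one, mul_zero]
      rw [← Finset.sum_filter]
      congr 1
      ext l; simp only [I, Finset.mem_filter, Finset.mem_Ico]; omega
    rw [h2, sum_Ico_sub m (by omega)]; ring
  have h3 := ((multBdd_const q (hB (-K))).add (one_le_of_rieszExponent hq)
    (MultBdd.sum (one_le_of_rieszExponent hq) (s := I) fun l _ =>
      (multBdd_halfLine hq l).const_mul (m (l + 1) - m l)))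
  rw [trig_congr (d := mult (fun k => m (-K) + ∑ l ∈ I, (m (l + 1) - m l) *
    (if l < k then 1 else 0)) c) fun k hk => by rw [mult, mult, ← hm k hk]]
  refine (h3 S c).trans ?_
  gcongr
  rw [← Finset.sum_mul]
  gcongr
  rw [← ENNReal.coe_le_coe, ENNReal.ofNNReal_finsetSum]
  exact (ENNReal.sum_le_tsum _).trans hV

/-- Monotone real symbols with values in `[0, M]` have variation at most `M`. -/
theorem tsum_enorm_sub_le_of_monotone {g : ℤ → ℝ} {M : ℝ} (hg : Monotone g)
    (h0 : ∀ k, 0 ≤ g k) (hM : ∀ k, g k ≤ M) :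
    ∑' k, ‖((g (k + 1) : ℝ) : ℂ) - (g k : ℝ)‖ₑ ≤ ENNReal.ofReal M := by
  rw [ENNReal.tsum_eq_iSup_sum]
  refine iSup_le fun S => ?_
  obtain ⟨K, hK⟩ : ∃ K : ℕ, ∀ k ∈ S, k.natAbs ≤ K :=
    ⟨S.sup fun k => k.natAbs, fun k hk => Finset.le_sup (f := fun k : ℤ => k.natAbs) hk⟩
  have hsub : S ⊆ Finset.Ico (-(K : ℤ)) (K + 1) := fun k hk => by
    have := hK k hk
    rw [Finset.mem_Ico]; omega
  refine (Finset.sum_le_sum_of_subset hsub).trans ?_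
  have h1 : ∀ k, ‖((g (k + 1) : ℝ) : ℂ) - (g k : ℝ)‖ₑ = ENNReal.ofReal (g (k + 1) - g k) := by
    intro k
    rw [← Complex.ofReal_sub, ← ofReal_norm, Complex.norm_real, Real.norm_of_nonneg]
    exact sub_nonneg.2 (hg (by omega))
  simp only [h1]
  rw [← ENNReal.ofReal_sum_of_nonneg fun k _ => sub_nonneg.2 (hg (by omega))]
  refine ENNReal.ofReal_le_ofReal ?_
  have h2 := sum_Ico_sub (fun k => (g k : ℂ)) (a := -(K : ℤ)) (b := K + 1) (by omega)
  have h3 : ∑ k ∈ Finset.Ico (-(K : ℤ)) (K + 1), (g (k + 1) - g k) = g (K + 1) - g (-K) := by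
    exact_mod_cast h2
  rw [h3]
  linarith [h0 (-K), hM (K + 1)]

theorem multBdd_of_monotone {q : ℕ} {C : ℝ≥0} (hq : RieszExponent q C) {g : ℤ → ℝ} {M : ℝ≥0}
    (hg : Monotone g ∨ Antitone g) (h0 : ∀ k, 0 ≤ g k) (hM : ∀ k, g k ≤ M) :
    MultBdd q (M * (1 + 4 * C)) (fun k => (g k : ℂ)) := by
  have hB : ∀ k, ‖(g k : ℂ)‖ₑ ≤ M := by
    intro k
    rw [← ofReal_norm, Complex.norm_real, Real.norm_of_nonneg (h0 k), ← ENNReal.ofReal_coe_nnreal]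
    exact ENNReal.ofReal_le_ofReal (hM k)
  have hV : ∑' k, ‖((g (k + 1) : ℝ) : ℂ) - (g k : ℝ)‖ₑ ≤ M := by
    rcases hg with hg | hg
    · have := tsum_enorm_sub_le_of_monotone hg h0 hM
      rwa [ENNReal.ofReal_coe_nnreal] at this
    · have := tsum_enorm_sub_le_of_monotone (g := fun k => M - g k)
        (fun a b hab => sub_le_sub_left (hg hab) _) (fun k => sub_nonneg.2 (hM k))
        (M := M) (fun k => sub_le_self _ (h0 k))
      rw [ENNReal.ofReal_coe_nnreal] at this
      refine le_trans (le_of_eq (tsum_congr fun k => ?_)) this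
      rw [← enorm_neg]
      congr 1
      push_cast
      ring
  exact (multBdd_of_variation hq hB hV).mono (by rw [mul_add, mul_one])

theorem IsBVSymbol.enorm_le {A : ℝ} {m : ℤ → ℂ} (hm : IsBVSymbol A m) (k : ℤ) :
    ‖m k‖ₑ ≤ ENNReal.ofReal A := by
  have h1 : Tendsto (fun l => ‖m k - m l‖ₑ) atBot (𝓝 ‖m k - 0‖ₑ) :=
    (tendsto_const_nhds.sub hm.2).enorm
  rw [sub_zero] at h1
  refine le_of_tendsto h1 ?_
  filter_upwards [eventually_le_atBot k] with l hl
  rw [← sum_Ico_sub m hl]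
  exact (enorm_sum_le _ _).trans ((ENNReal.sum_le_tsum _).trans hm.1)

theorem IsBVSymbol.multBdd {q : ℕ} {C : ℝ≥0} (hq : RieszExponent q C) {A : ℝ} {m : ℤ → ℂ}
    (hm : IsBVSymbol A m) : MultBdd q (A.toNNReal + A.toNNReal * (4 * C)) m :=
  multBdd_of_variation hq hm.enorm_le hm.1

/-! ### Dyadic blocks of frequencies -/

/-- The index `j` of the dyadic block `2^j ≤ |k| < 2^{j+1}` that contains `k`; the block `j = 0`
also contains the frequency `0`. -/
def blk (k : ℤ) : ℕ := Nat.log 2 k.natAbs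

theorem natAbs_lt_of_blk (k : ℤ) : k.natAbs < 2 ^ (blk k + 1) :=
  Nat.lt_pow_succ_log_self (by norm_num) _

theorem le_natAbs_of_blk {k : ℤ} (hk : k ≠ 0) : 2 ^ blk k ≤ k.natAbs :=
  Nat.pow_log_le_self 2 (by simpa using hk)

theorem blk_zero : blk 0 = 0 := by simp [blk]

theorem blk_eq_iff {k : ℤ} (hk : k ≠ 0) {j : ℕ} :
    blk k = j ↔ 2 ^ j ≤ k.natAbs ∧ k.natAbs < 2 ^ (j + 1) := by
  constructor
  · rintro rfl
    exact ⟨le_natAbs_of_blk hk, natAbs_lt_of_blk k⟩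
  · rintro ⟨h1, h2⟩
    exact Nat.log_eq_of_pow_le_of_lt_pow h1 h2

/-- The frequencies in the first `N + 1` dyadic blocks. -/
noncomputable def low (N : ℕ) : Finset ℤ := Finset.Ioo (-(2 ^ (N + 1) : ℤ)) (2 ^ (N + 1))

theorem mem_low {N : ℕ} {k : ℤ} : k ∈ low N ↔ blk k ≤ N := by
  have h1 : k ∈ low N ↔ k.natAbs < 2 ^ (N + 1) := by
    rw [low, Finset.mem_Ioo, ← abs_lt, ← Int.natCast_natAbs]
    exact_mod_cast Iff.rfl
  rw [h1]
  constructor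
  · intro h
    by_cases hk : k = 0
    · simp [hk, blk_zero]
    · have := (le_natAbs_of_blk hk).trans_lt h
      have := (Nat.pow_lt_pow_iff_right (by norm_num : 1 < 2)).1 this
      omega
  · intro h
    exact (natAbs_lt_of_blk k).trans_le (Nat.pow_le_pow_right (by norm_num) (by omega))

/-- The dyadic block with index `j`. -/
noncomputable def block (j : ℕ) : Finset ℤ := (low j).filter fun k => blk k = j

theorem mem_block {j : ℕ} {k : ℤ} : k ∈ block j ↔ blk k = j := by
  rw [block, Finset.mem_filter, mem_low]; omega

theorem sq_bracket_bounds (k : ℤ) :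
    (4 : ℝ) ^ blk k ≤ 1 + (k : ℝ) ^ 2 ∧ 1 + (k : ℝ) ^ 2 ≤ 5 * 4 ^ blk k := by
  have h1 : (k : ℝ) ^ 2 = (k.natAbs : ℝ) ^ 2 := by
    rw [← sq_abs, ← Int.cast_abs, ← Int.natCast_natAbs]; simp
  have h2 : (k.natAbs : ℝ) < 2 ^ (blk k + 1) := by exact_mod_cast natAbs_lt_of_blk k
  have h3 : (1 : ℝ) ≤ 4 ^ blk k := one_le_pow₀ (by norm_num)
  have h4 : ((2 : ℝ) ^ (blk k + 1)) ^ 2 = 4 * 4 ^ blk k := by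
    rw [← pow_mul, mul_comm, pow_mul, pow_succ]; norm_num; ring
  constructor
  · by_cases hk : k = 0
    · simp [hk, blk_zero]
    · have h5 : (2 : ℝ) ^ blk k ≤ k.natAbs := by exact_mod_cast le_natAbs_of_blk hk
      have h6 : ((2 : ℝ) ^ blk k) ^ 2 = 4 ^ blk k := by
        rw [← pow_mul, mul_comm, pow_mul]; norm_num
      have h7 : ((2 : ℝ) ^ blk k) ^ 2 ≤ (k.natAbs : ℝ) ^ 2 := by gcongr
      rw [h1]; linarith
  · have h7 : (k.natAbs : ℝ) ^ 2 ≤ ((2 : ℝ) ^ (blk k + 1)) ^ 2 := by gcongr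
    rw [h1]; linarith

/-- The Japanese bracket is comparable to `2^j` on the `j`-th block. -/
theorem rpow_le_of_blk (β : ℝ) (k : ℤ) :
    (1 + (k : ℝ) ^ 2) ^ β ≤ 5 ^ |β| * 4 ^ (β * blk k) := by
  obtain ⟨h1, h2⟩ := sq_bracket_bounds k
  have h4 : (0 : ℝ) < 4 ^ blk k := by positivity
  have h5 : (4 : ℝ) ^ (β * blk k) = ((4 : ℝ) ^ blk k) ^ β := by
    rw [mul_comm, Real.rpow_mul (by norm_num), Real.rpow_natCast]
  rw [h5]
  rcases le_total 0 β with hβ | hβ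
  · rw [abs_of_nonneg hβ, ← Real.mul_rpow (by norm_num) h4.le]
    exact Real.rpow_le_rpow (by positivity) h2 hβ
  · have h6 : (1 : ℝ) ≤ 5 ^ |β| := Real.one_le_rpow (by norm_num) (abs_nonneg _)
    calc _ ≤ ((4 : ℝ) ^ blk k) ^ β := Real.rpow_le_rpow_of_nonpos h4 h1 hβ
      _ ≤ _ := le_mul_of_one_le_left (by positivity) h6

theorem bracket_rpow (β : ℝ) (k : ℤ) : bracket k ^ β = (1 + (k : ℝ) ^ 2) ^ (β / 2) := by
  rw [bracket, ← Real.rpow_mul (by positivity)]; ring_nf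

theorem four_rpow (x : ℝ) : (4 : ℝ) ^ x = 2 ^ (2 * x) := by
  rw [Real.rpow_mul (by norm_num)]; norm_num

theorem bracket_rpow_le_of_blk (β : ℝ) (k : ℤ) :
    bracket k ^ β ≤ 5 ^ |β| * 2 ^ (β * blk k) := by
  rw [bracket_rpow]
  refine (rpow_le_of_blk _ k).trans ?_
  rw [four_rpow]
  have h1 : 2 * (β / 2 * (blk k : ℝ)) = β * blk k := by ring
  rw [h1]
  refine mul_le_mul_of_nonneg_right (Real.rpow_le_rpow_of_exponent_le (by norm_num) ?_)
    (by positivity)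
  rw [abs_div, abs_two]; linarith [abs_nonneg β]

theorem monotone_or_antitone_bracket (β : ℝ) {h : ℤ → ℤ} (h0 : ∀ k, 0 ≤ h k)
    (hh : Monotone h ∨ Antitone h) :
    Monotone (fun k => bracket (h k) ^ β) ∨ Antitone (fun k => bracket (h k) ^ β) := by
  have hb : ∀ k l : ℤ, 0 ≤ k → k ≤ l → 1 + (k : ℝ) ^ 2 ≤ 1 + (l : ℝ) ^ 2 := by
    intro k l hk hkl
    have h1 : (k : ℝ) ≤ l := by exact_mod_cast hkl
    have h2 : (0 : ℝ) ≤ k := by exact_mod_cast hk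
    gcongr
  simp only [bracket_rpow]
  rcases le_total 0 β with hβ | hβ <;> rcases hh with hh | hh
  · exact Or.inl fun a b hab => Real.rpow_le_rpow (by positivity) (hb _ _ (h0 _) (hh hab))
      (by linarith)
  · exact Or.inr fun a b hab => Real.rpow_le_rpow (by positivity) (hb _ _ (h0 _) (hh hab))
      (by linarith)
  · exact Or.inr fun a b hab => Real.rpow_le_rpow_of_nonpos (by positivity)
      (hb _ _ (h0 _) (hh hab)) (by linarith)
  · exact Or.inl fun a b hab => Real.rpow_le_rpow_of_nonpos (by positivity)
      (hb _ _ (h0 _) (hh hab)) (by linarith)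

/-- The multiplier `⟨k⟩^β` restricted to a block has the size `2^{βj}`. -/
theorem exists_multBdd_block {q : ℕ} {C : ℝ≥0} (hq : RieszExponent q C) (β : ℝ) :
    ∃ D : ℝ≥0, ∀ j : ℕ, MultBdd q (D * (2 : ℝ≥0) ^ (β * j))
      (fun k => if blk k = j then ((bracket k ^ β : ℝ) : ℂ) else 0) := by
  refine ⟨2 * ((5 : ℝ≥0) ^ |β| * (1 + 4 * C) * (4 * C * (1 + 4 * C))), fun j => ?_⟩
  set M : ℝ≥0 := 5 ^ |β| * 2 ^ (β * j) with hM
  -- the non-negative frequencies of the block are `Ioc (a - 1) b`, the negative ones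
  -- `Ioc (-b - 1) (-2^j)`
  set b : ℤ := 2 ^ (j + 1) - 1 with hb
  set a : ℤ := if j = 0 then 0 else 2 ^ j with ha
  have hP : (0 : ℤ) < 2 ^ j := by positivity
  have hb2 : b = 2 * 2 ^ j - 1 := by rw [hb, pow_succ]; ring
  have ha0 : 0 ≤ a := by rw [ha]; split_ifs <;> omega
  have haP : a ≤ 2 ^ j := by rw [ha]; split_ifs <;> omega
  have hblk : ∀ k : ℤ, a ≤ k → k ≤ b → blk k = j := by
    intro k h1 h2
    by_cases hk : k = 0
    · have : j = 0 := by
        by_contra hj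
        rw [ha, if_neg hj] at h1
        omega
      rw [hk, blk_zero, this]
    · rw [blk_eq_iff hk]
      have hk' : (k.natAbs : ℤ) = k := by omega
      zify
      rw [abs_of_nonneg (ha0.trans h1), pow_succ]
      refine ⟨?_, by omega⟩
      rw [ha] at h1
      split_ifs at h1 with hj
      · rw [hj]; simp; omega
      · exact h1
  have hbd : ∀ h : ℤ → ℤ, (∀ k, a ≤ h k ∧ h k ≤ b) → (Monotone h ∨ Antitone h) →
      MultBdd q (M * (1 + 4 * C)) (fun k => ((bracket (h k) ^ β : ℝ) : ℂ)) := by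
    intro h hab hh
    refine multBdd_of_monotone hq
      (monotone_or_antitone_bracket β (fun k => ha0.trans (hab k).1) hh) (fun k => ?_) fun k => ?_
    · rw [bracket_rpow]; positivity
    · refine (bracket_rpow_le_of_blk β (h k)).trans ?_
      rw [hblk _ (hab k).1 (hab k).2, hM]
      simp
  have h1 := (hbd (fun k => max a (min k b)) (fun k => ⟨le_max_left _ _, by omega⟩)
    (Or.inl fun x y hxy => by simp only; omega)).mul (multBdd_Ioc hq (a - 1) b)
  have h2 := (hbd (fun k => max (2 ^ j) (min (-k) b)) (fun k => ⟨by omega, by omega⟩)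
    (Or.inr fun x y hxy => by simp only; omega)).mul (multBdd_Ioc hq (-b - 1) (-2 ^ j))
  refine ((h1.add (one_le_of_rieszExponent hq) h2).mono (le_of_eq (by rw [hM]; ring))).congr
    fun k => ?_
  by_cases hk1 : a ≤ k ∧ k ≤ b
  · rw [if_pos (hblk k hk1.1 hk1.2), if_pos (by omega), if_neg (by omega),
      show max a (min k b) = k by omega]
    simp
  · by_cases hk2 : 2 ^ j ≤ -k ∧ -k ≤ b
    · have : blk k = j := by
        have := hblk (-k) (haP.trans hk2.1) hk2.2
        rwa [blk, Int.natAbs_neg] at this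
      rw [if_pos this, if_neg (by omega), if_pos (by omega),
        show max (2 ^ j) (min (-k) b) = -k by omega]
      have hneg : bracket (-k) = bracket k := by simp [bracket]
      rw [hneg]; simp
    · rw [if_neg, if_neg (by omega), if_neg (by omega)]
      · simp
      · intro h
        by_cases hk : k = 0
        · rw [hk, blk_zero] at h
          rw [ha, if_pos h.symm, hk] at hk1
          omega
        · have h3 := (blk_eq_iff hk).1 h
          zify at h3
          rw [pow_succ] at h3
          rcases le_total 0 k with h0 | h0
          · rw [abs_of_nonneg h0] at h3; omega
          · rw [abs_of_nonpos h0] at h3; omega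

theorem fourierCoeff_trig_of_support {S : Finset ℤ} {c : FourierSeq} (h : ∀ k, k ∉ S → c k = 0)
    (k : ℤ) : fourierCoeff (trig S c) k = c k := by
  rw [fourierCoeff_trig]
  split_ifs with hk
  · rfl
  · rw [h k hk]

theorem torusNorm_trig {p : ℝ≥0∞} (hp : 2 ≤ p) {S : Finset ℤ} {c : FourierSeq}
    (h : ∀ k, k ∉ S → c k = 0) : torusNorm p c = eLpNorm (trig S c) p volume :=
  torusNorm_eq hp (memLp_continuousMap _ p) (fourierCoeff_trig_of_support h)

/-- A finite set that contains the frequencies of the projection `Π_{2^j}`. -/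
noncomputable def fat (j : ℕ) : Finset ℤ := Finset.Icc (-(8 * 2 ^ j)) (8 * 2 ^ j)

theorem dyadic_eq_zero (j : ℕ) (c : FourierSeq) (k : ℤ) (hk : k ∉ fat j) : dyadic j c k = 0 := by
  rw [dyadic, mult, if_neg, zero_mul]
  rintro ⟨_, h⟩
  refine hk ?_
  rw [fat, Finset.mem_Icc]
  have h2 : |k| ≤ 8 * 2 ^ j := by exact_mod_cast h
  exact abs_le.1 h2

theorem dyadic_apply_of_blk {j : ℕ} {k : ℤ} (h1 : j ≤ blk k) (h2 : blk k ≤ j + 2)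
    (c : FourierSeq) : dyadic j c k = c k := by
  have hlt : |(k : ℝ)| < 2 ^ (blk k + 1) := by
    rw [← Int.cast_abs, ← Int.natCast_natAbs]
    exact_mod_cast natAbs_lt_of_blk k
  have hle : (2 : ℝ) ^ (blk k + 1) ≤ 2 ^ (j + 3) := pow_le_pow_right₀ (by norm_num) (by omega)
  have h8 : (2 : ℝ) ^ (j + 3) = 8 * 2 ^ j := by rw [pow_add]; ring
  rw [dyadic, mult, if_pos, one_mul]
  refine ⟨?_, by linarith⟩
  by_cases hj : j = 0
  · exact Or.inl hj
  · right
    have hk : k ≠ 0 := by rintro rfl; rw [blk_zero] at h1; omega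
    have h3 : (2 : ℝ) ^ blk k ≤ |(k : ℝ)| := by
      rw [← Int.cast_abs, ← Int.natCast_natAbs]
      exact_mod_cast le_natAbs_of_blk hk
    have h4 : (2 : ℝ) ^ j ≤ 2 ^ blk k := pow_le_pow_right₀ (by norm_num) h1
    have : (0 : ℝ) ≤ 2 ^ j := by positivity
    linarith

/-- The `ℓ²` norm of the part of `c` in the `j`-th block. -/
noncomputable def blockNorm (j : ℕ) (c : FourierSeq) : ℝ≥0∞ :=
  l2 fun k => if blk k = j then ‖c k‖ₑ else 0

/-- Since `⟨k⟩` is comparable to `2^j` on the block `j`, which lies inside `Π_{2^j}`, its `ℓ²` norm is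
controlled by `H^γ`. -/
theorem blockNorm_le_sobolevNorm (γ : ℝ) (j : ℕ) (c : FourierSeq) :
    blockNorm j c ≤ ENNReal.ofReal (5 ^ |γ| * 2 ^ (-γ * j)) * sobolevNorm γ (dyadic j c) := by
  have hpi : (1 : ℝ≥0∞) ≤ ENNReal.ofReal (2 * π) := by
    rw [← ENNReal.ofReal_one]
    exact ENNReal.ofReal_le_ofReal (by linarith [Real.pi_gt_three])
  rw [blockNorm, l2_le_iff, mul_pow]
  have h1 : sobolevNorm γ (dyadic j c) ^ 2 = ENNReal.ofReal (2 * π) *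
      ∑' k : ℤ, ENNReal.ofReal ((1 + (k : ℝ) ^ 2) ^ γ) * ‖dyadic j c k‖ₑ ^ 2 := by
    rw [sobolevNorm, ← ENNReal.rpow_natCast, ← ENNReal.rpow_mul]; norm_num
  rw [h1, ← ENNReal.ofReal_pow (by positivity)]
  calc ∑' k, (if blk k = j then ‖c k‖ₑ else 0) ^ 2
      ≤ ∑' k : ℤ, ENNReal.ofReal ((5 ^ |γ| * 2 ^ (-γ * j)) ^ 2) *
          (ENNReal.ofReal ((1 + (k : ℝ) ^ 2) ^ γ) * ‖dyadic j c k‖ₑ ^ 2) := by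
        refine ENNReal.tsum_le_tsum fun k => ?_
        split_ifs with hk
        · rw [dyadic_apply_of_blk hk.ge (by omega), ← mul_assoc,
            ← ENNReal.ofReal_mul (by positivity)]
          refine le_mul_of_one_le_left zero_le ?_
          rw [← ENNReal.ofReal_one]
          refine ENNReal.ofReal_le_ofReal ?_
          have h2 := rpow_le_of_blk (-γ) k
          rw [four_rpow, hk, abs_neg] at h2
          have h3 : (0 : ℝ) < 1 + (k : ℝ) ^ 2 := by positivity
          have h4 : (1 + (k : ℝ) ^ 2) ^ (-γ) * (1 + (k : ℝ) ^ 2) ^ γ = 1 := by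
            rw [← Real.rpow_add h3]; simp
          have h5 : (1 : ℝ) ≤ 5 ^ |γ| := Real.one_le_rpow (by norm_num) (abs_nonneg _)
          have h6 : ((2 : ℝ) ^ (-γ * j)) ^ 2 = 2 ^ (2 * (-γ * j)) := by
            rw [← Real.rpow_natCast, ← Real.rpow_mul (by norm_num)]; congr 1; push_cast; ring
          refine h4.symm.le.trans ?_
          rw [mul_pow, h6]
          refine mul_le_mul_of_nonneg_right (h2.trans ?_) (by positivity)
          refine mul_le_mul_of_nonneg_right ?_ (by positivity)
          nlinarith
        · simp
    _ = ENNReal.ofReal ((5 ^ |γ| * 2 ^ (-γ * j)) ^ 2) *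
          ∑' k : ℤ, ENNReal.ofReal ((1 + (k : ℝ) ^ 2) ^ γ) * ‖dyadic j c k‖ₑ ^ 2 :=
        ENNReal.tsum_mul_left
    _ ≤ _ := by
        gcongr
        exact le_mul_of_one_le_left zero_le hpi

/-! ### The trilinear estimate for separated frequencies -/

/-- The part of the nonnegative sequence `x` in the `j`-th block. -/
def cut (j : ℕ) (x : ℤ → ℝ≥0∞) : ℤ → ℝ≥0∞ := fun k => if blk k = j then x k else 0

/-- The trilinear sum over the nonresonant interactions `k + k₁ = k₂ + k₃` of three blocks, with
the weight that one integration by parts in time gains. -/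
noncomputable def nonresonantSum (j₁ j₂ j₃ : ℕ) (a b c : ℤ → ℝ≥0∞) (k : ℤ) : ℝ≥0∞ :=
  ∑ k₁ ∈ block j₁, ∑ k₂ ∈ block j₂, ∑ k₃ ∈ block j₃,
    if k + k₁ = k₂ + k₃ ∧ k₂ ≠ k₁ ∧ k₃ ≠ k₁ then
      ENNReal.ofReal |2 * ((k₃ - k₁ : ℤ) : ℝ) * ((k₂ - k₁ : ℤ) : ℝ)|⁻¹ * (a k₁ * b k₂ * c k₃)
    else 0

theorem nonresonantSum_swap (j₁ j₂ j₃ : ℕ) (a b c : ℤ → ℝ≥0∞) (k : ℤ) :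
    nonresonantSum j₁ j₂ j₃ a b c k = nonresonantSum j₁ j₃ j₂ a c b k := by
  refine Finset.sum_congr rfl fun k₁ _ => ?_
  rw [Finset.sum_comm]
  refine Finset.sum_congr rfl fun k₃ _ => Finset.sum_congr rfl fun k₂ _ => ?_
  have e1 : (k + k₁ = k₂ + k₃ ∧ k₂ ≠ k₁ ∧ k₃ ≠ k₁) ↔ (k + k₁ = k₃ + k₂ ∧ k₃ ≠ k₁ ∧ k₂ ≠ k₁) := by
    rw [add_comm k₂ k₃]; tauto
  simp only [e1]
  rw [mul_right_comm 2, mul_right_comm (a k₁)]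

/-- `|l|^{-1-ε}`, and `0` for `l = 0`. -/
noncomputable def decay (ε : ℝ) (l : ℤ) : ℝ≥0∞ :=
  if l = 0 then 0 else ENNReal.ofReal (|(l : ℝ)| ^ (-1 - ε))

theorem tsum_decay_ne_top {ε : ℝ} (hε : 0 < ε) : ∑' l, decay ε l ≠ ∞ := by
  have h1 : Summable fun l : ℤ => |(l : ℝ)| ^ (-(1 + ε)) :=
    Real.summable_abs_int_rpow (by linarith)
  have h2 : ∀ l, decay ε l ≤ ENNReal.ofReal (|(l : ℝ)| ^ (-(1 + ε))) := by
    intro l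
    unfold decay
    split_ifs
    · exact zero_le
    · rw [show -1 - ε = -(1 + ε) by ring]
  refine ne_top_of_le_ne_top ?_ (ENNReal.tsum_le_tsum h2)
  exact h1.tsum_ofReal_ne_top

/-- Young's inequality for the summable convolution kernel `decay ε`. -/
theorem tsum_tsum_decay_le (ε : ℝ) (a b : ℤ → ℝ≥0∞) :
    ∑' k₁, ∑' k₂, decay ε (k₂ - k₁) * (a k₁ * b k₂) ≤ (∑' l, decay ε l) * (l2 a * l2 b) := by
  calc ∑' k₁, ∑' k₂, decay ε (k₂ - k₁) * (a k₁ * b k₂)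
      = ∑' k₁, ∑' l, decay ε l * (a k₁ * b (l + k₁)) := by
        refine tsum_congr fun k₁ => ?_
        rw [← (Equiv.addRight k₁).tsum_eq]
        simp
    _ = ∑' l, decay ε l * ∑' k₁, a k₁ * b (l + k₁) := by
        rw [ENNReal.tsum_comm]
        simp only [ENNReal.tsum_mul_left]
    _ ≤ ∑' l, decay ε l * (l2 a * l2 b) := by
        refine ENNReal.tsum_le_tsum fun l => ?_
        gcongr
        refine (tsum_mul_le_l2 a fun k => b (l + k)).trans_eq ?_
        exact congrArg (l2 a * ·) (l2_comp_equiv (Equiv.addLeft l) b)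
    _ = _ := ENNReal.tsum_mul_right

theorem sum_block_eq_tsum {M : ℤ → ℝ≥0∞} (j : ℕ) :
    ∑ k ∈ block j, M k = ∑' k, if blk k = j then M k else 0 := by
  rw [tsum_eq_sum (s := block j)]
  · exact Finset.sum_congr rfl fun k hk => by rw [if_pos (mem_block.1 hk)]
  · intro k hk
    rw [if_neg fun h => hk (mem_block.2 h)]

theorem two_pow_le_sub_of_blk {k l : ℤ} (h : blk k + 2 ≤ blk l) :
    (2 : ℝ) ^ blk l ≤ 2 * |((l - k : ℤ) : ℝ)| := by
  have hl : l ≠ 0 := by rintro rfl; rw [blk_zero] at h; omega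
  have h1 := le_natAbs_of_blk hl
  have h2 := natAbs_lt_of_blk k
  have h3 : 2 * 2 ^ (blk k + 1) ≤ 2 ^ blk l := by
    rw [← pow_succ']; exact Nat.pow_le_pow_right (by norm_num) h
  have h4 : 2 ^ blk l ≤ 2 * (l - k).natAbs := by omega
  rw [← Int.cast_abs, ← Int.natCast_natAbs]
  exact_mod_cast h4

/-- The gain of an integration by parts when the blocks `j₁`, `j₃` are separated and one of them is
essentially the largest. -/
theorem weight_le {ε : ℝ} (hε : 0 < ε) {J : ℕ} {k₁ k₂ k₃ : ℤ}
    (hsep : blk k₁ + 2 ≤ blk k₃ ∧ J ≤ blk k₃ + 1 ∨ blk k₃ + 2 ≤ blk k₁ ∧ J ≤ blk k₁ + 1)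
    (h₁ : blk k₁ ≤ J) (h₂ : blk k₂ ≤ J) (hne : k₂ ≠ k₁) :
    ENNReal.ofReal |2 * ((k₃ - k₁ : ℤ) : ℝ) * ((k₂ - k₁ : ℤ) : ℝ)|⁻¹ ≤
      ENNReal.ofReal (2 * 4 ^ ε * 2 ^ ((ε - 1) * J)) * decay ε (k₂ - k₁) := by
  have hl0 : k₂ - k₁ ≠ 0 := sub_ne_zero.2 hne
  rw [decay, if_neg hl0, ← ENNReal.ofReal_mul (by positivity)]
  refine ENNReal.ofReal_le_ofReal ?_
  have hJ : (2 : ℝ) ^ J ≤ 4 * |((k₃ - k₁ : ℤ) : ℝ)| := by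
    rcases hsep with ⟨h, hJ⟩ | ⟨h, hJ⟩
    · have h5 := two_pow_le_sub_of_blk h
      have h6 : (2 : ℝ) ^ J ≤ 2 ^ (blk k₃ + 1) := pow_le_pow_right₀ (by norm_num) hJ
      rw [pow_succ] at h6
      linarith
    · have h5 := two_pow_le_sub_of_blk h
      have h6 : (2 : ℝ) ^ J ≤ 2 ^ (blk k₁ + 1) := pow_le_pow_right₀ (by norm_num) hJ
      rw [pow_succ] at h6
      have h7 : |((k₃ - k₁ : ℤ) : ℝ)| = |((k₁ - k₃ : ℤ) : ℝ)| := by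
        rw [← abs_neg]; congr 1; push_cast; ring
      rw [h7]
      linarith
  set x : ℝ := |((k₃ - k₁ : ℤ) : ℝ)|
  set y : ℝ := |((k₂ - k₁ : ℤ) : ℝ)| with hy
  have hy1 : 1 ≤ y := by
    rw [hy, ← Int.cast_abs]
    exact_mod_cast Int.one_le_abs hl0
  have hy0 : 0 < y := by linarith
  have hyJ : y ≤ 4 * 2 ^ J := by
    have h3 := natAbs_lt_of_blk k₁
    have h4 := natAbs_lt_of_blk k₂
    have h5 : 2 ^ (blk k₁ + 1) ≤ 2 ^ (J + 1) := Nat.pow_le_pow_right (by norm_num) (by omega)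
    have h6 : 2 ^ (blk k₂ + 1) ≤ 2 ^ (J + 1) := Nat.pow_le_pow_right (by norm_num) (by omega)
    have h7 : 2 ^ (J + 1) = 2 * 2 ^ J := by rw [pow_succ']
    have h8 : (k₂ - k₁).natAbs ≤ 4 * 2 ^ J := by omega
    rw [hy, ← Int.cast_abs, ← Int.natCast_natAbs]
    exact_mod_cast h8
  have hP : (0 : ℝ) < 2 ^ J := by positivity
  have hx0 : 0 < x := by linarith
  have e1 : |2 * ((k₃ - k₁ : ℤ) : ℝ) * ((k₂ - k₁ : ℤ) : ℝ)| = 2 * x * y := by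
    rw [abs_mul, abs_mul, abs_two]
  have e2 : y ^ (-1 - ε) = y⁻¹ * y ^ (-ε) := by
    rw [show -1 - ε = -1 + -ε by ring, Real.rpow_add hy0, Real.rpow_neg_one]
  have e3 : (2 : ℝ) ^ ((ε - 1) * J) = (2 ^ J) ^ ε * (2 ^ J)⁻¹ := by
    rw [← Real.rpow_natCast, ← Real.rpow_mul (by norm_num), ← Real.rpow_neg (by norm_num),
      ← Real.rpow_add (by norm_num)]
    congr 1; ring
  -- All frequencies are at most `2 ^ (J + 1)`, so `y ^ ε` costs no more than `(4 * 2 ^ J) ^ ε`.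
  have e4 : 1 ≤ 4 ^ ε * ((2 : ℝ) ^ J) ^ ε * y ^ (-ε) := by
    rw [← Real.mul_rpow (by norm_num) hP.le, Real.rpow_neg hy0.le, ← div_eq_mul_inv,
      one_le_div (by positivity)]
    exact Real.rpow_le_rpow hy0.le hyJ hε.le
  have e5 : (2 * x)⁻¹ ≤ 2 * ((2 : ℝ) ^ J)⁻¹ := by
    rw [inv_le_comm₀ (by positivity) (by positivity), mul_inv, inv_inv]
    linarith
  rw [e1, e2, e3, mul_inv]
  calc (2 * x)⁻¹ * y⁻¹ ≤ 2 * ((2 : ℝ) ^ J)⁻¹ * y⁻¹ * 1 := by rw [mul_one]; gcongr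
    _ ≤ 2 * ((2 : ℝ) ^ J)⁻¹ * y⁻¹ * (4 ^ ε * ((2 : ℝ) ^ J) ^ ε * y ^ (-ε)) := by gcongr
    _ = _ := by ring

/-- The factor `|k₃ - k₁|⁻¹` gains the highest frequency, and `|k₂ - k₁|⁻¹` becomes summable at the
cost of `2^{εJ}`. For fixed `k₁`, `k₂` the sequence in `k` is a translate of the third factor. -/
theorem l2_nonresonantSum_le_of_separated {ε : ℝ} (hε : 0 < ε) {J j₁ j₂ j₃ : ℕ}
    (hsep : j₁ + 2 ≤ j₃ ∧ J ≤ j₃ + 1 ∨ j₃ + 2 ≤ j₁ ∧ J ≤ j₁ + 1) (h₁ : j₁ ≤ J) (h₂ : j₂ ≤ J)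
    (a b c : ℤ → ℝ≥0∞) :
    l2 (nonresonantSum j₁ j₂ j₃ a b c) ≤
      ENNReal.ofReal (2 * 4 ^ ε * 2 ^ ((ε - 1) * J)) * (∑' l, decay ε l) *
        (l2 (cut j₁ a) * l2 (cut j₂ b) * l2 (cut j₃ c)) := by
  set R := ENNReal.ofReal (2 * 4 ^ ε * 2 ^ ((ε - 1) * J)) with hR
  have hle : ∀ k, nonresonantSum j₁ j₂ j₃ a b c k ≤
      ∑ p ∈ block j₁ ×ˢ block j₂, R * decay ε (p.2 - p.1) * (a p.1 * b p.2) *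
        cut j₃ c (k + p.1 - p.2) := by
    intro k
    rw [Finset.sum_product]
    refine Finset.sum_le_sum fun k₁ hk₁ => Finset.sum_le_sum fun k₂ hk₂ => ?_
    rw [mem_block] at hk₁ hk₂
    have hterm : ∀ k₃ ∈ block j₃, (if k + k₁ = k₂ + k₃ ∧ k₂ ≠ k₁ ∧ k₃ ≠ k₁ then
        ENNReal.ofReal |2 * ((k₃ - k₁ : ℤ) : ℝ) * ((k₂ - k₁ : ℤ) : ℝ)|⁻¹ * (a k₁ * b k₂ * c k₃)
        else 0) ≤ if k₃ = k + k₁ - k₂ then R * decay ε (k₂ - k₁) * (a k₁ * b k₂) * c k₃ else 0 := by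
      intro k₃ hk₃
      rw [mem_block] at hk₃
      by_cases hP : k + k₁ = k₂ + k₃ ∧ k₂ ≠ k₁ ∧ k₃ ≠ k₁
      · rw [if_pos hP, if_pos (by omega), mul_assoc (R * _)]
        gcongr
        exact weight_le hε (by omega) (by omega) (by omega) hP.2.1
      · rw [if_neg hP]; exact zero_le
    refine (Finset.sum_le_sum hterm).trans ?_
    rw [Finset.sum_ite_eq']
    split_ifs with hm
    · simp only [cut]
      rw [if_pos (mem_block.1 hm)]
    · exact zero_le
  calc l2 (nonresonantSum j₁ j₂ j₃ a b c)
      ≤ ∑ p ∈ block j₁ ×ˢ block j₂, l2 (fun k => R * decay ε (p.2 - p.1) * (a p.1 * b p.2) *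
        cut j₃ c (k + p.1 - p.2)) := (l2_mono hle).trans (l2_sum_le _ _)
    _ = ∑ p ∈ block j₁ ×ˢ block j₂, R * decay ε (p.2 - p.1) * (a p.1 * b p.2) *
        l2 (cut j₃ c) := by
        refine Finset.sum_congr rfl fun p _ => ?_
        rw [l2_const_mul]
        congr 1
        have := l2_comp_equiv (Equiv.addRight (p.1 - p.2)) (cut j₃ c)
        simpa [add_sub_assoc] using this
    _ = R * (∑' k₁, ∑' k₂, decay ε (k₂ - k₁) * (cut j₁ a k₁ * cut j₂ b k₂)) *
        l2 (cut j₃ c) := by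
        rw [← Finset.sum_mul, Finset.sum_product]
        congr 1
        simp only [mul_assoc R, ← Finset.mul_sum]
        congr 1
        rw [sum_block_eq_tsum]
        refine tsum_congr fun k₁ => ?_
        split_ifs with hk₁
        · rw [sum_block_eq_tsum]
          refine tsum_congr fun k₂ => ?_
          split_ifs with hk₂ <;> simp [cut, hk₁, hk₂]
        · simp [cut, hk₁]
    _ ≤ R * ((∑' l, decay ε l) * (l2 (cut j₁ a) * l2 (cut j₂ b))) * l2 (cut j₃ c) := by
        gcongr
        exact tsum_tsum_decay_le ε _ _
    _ = _ := by ring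

/-- Three blocks are comparable if their indices differ from the first one by at most `1`. -/
def Comparable (j₁ j₂ j₃ : ℕ) : Prop :=
  (j₁ ≤ j₂ + 1 ∧ j₂ ≤ j₁ + 1) ∧ (j₁ ≤ j₃ + 1 ∧ j₃ ≤ j₁ + 1)

instance (j₁ j₂ j₃ : ℕ) : Decidable (Comparable j₁ j₂ j₃) :=
  inferInstanceAs (Decidable (_ ∧ _))

/-- The trilinear estimate for blocks that are not comparable: up to `2^{εJ}`, the gain is that of
one derivative of the highest frequency `2^J`. -/
theorem exists_l2_nonresonantSum_le {ε : ℝ} (hε : 0 < ε) :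
    ∃ D : ℝ≥0, ∀ j₁ j₂ j₃ : ℕ, ¬ Comparable j₁ j₂ j₃ → ∀ a b c : ℤ → ℝ≥0∞,
      l2 (nonresonantSum j₁ j₂ j₃ a b c) ≤
        D * ENNReal.ofReal (2 ^ ((ε - 1) * (max j₁ (max j₂ j₃) : ℕ))) *
          (l2 (cut j₁ a) * l2 (cut j₂ b) * l2 (cut j₃ c)) := by
  refine ⟨(2 * 4 ^ ε) * (∑' l, decay ε l).toNNReal, fun j₁ j₂ j₃ hj a b c => ?_⟩
  set J := max j₁ (max j₂ j₃) with hJ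
  have hD : ((((2 * 4 ^ ε) * (∑' l, decay ε l).toNNReal : ℝ≥0)) : ℝ≥0∞) *
      ENNReal.ofReal (2 ^ ((ε - 1) * (J : ℕ))) =
      ENNReal.ofReal (2 * 4 ^ ε * 2 ^ ((ε - 1) * J)) * (∑' l, decay ε l) := by
    rw [ENNReal.coe_mul, ENNReal.coe_toNNReal (tsum_decay_ne_top hε),
      ENNReal.ofReal_mul (p := 2 * 4 ^ ε) (by positivity), mul_right_comm]
    congr 2
    rw [← ENNReal.ofReal_coe_nnreal]
    simp
  rw [hD]
  by_cases h3 : j₁ + 2 ≤ j₃ ∧ J ≤ j₃ + 1 ∨ j₃ + 2 ≤ j₁ ∧ J ≤ j₁ + 1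
  · exact l2_nonresonantSum_le_of_separated hε h3 (by omega) (by omega) a b c
  · have h2 : j₁ + 2 ≤ j₂ ∧ J ≤ j₂ + 1 ∨ j₂ + 2 ≤ j₁ ∧ J ≤ j₁ + 1 := by
      unfold Comparable at hj
      omega
    have h := l2_nonresonantSum_le_of_separated hε (j₂ := j₃) h2 (by omega) (by omega) a c b
    rw [show nonresonantSum j₁ j₂ j₃ a b c = nonresonantSum j₁ j₃ j₂ a c b from
      funext fun k => nonresonantSum_swap _ _ _ _ _ _ k]
    rwa [mul_right_comm (l2 (cut j₁ a))]

/-! ### Trilinear sums and the nonresonant interactions -/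

/-- The sum over `k + k₁ = k₂ + k₃` with kernel `K`, of the sequence `c` restricted to the
frequency sets `S₁`, `S₂`, `S₃`. -/
noncomputable def triSum (K : ℤ → ℤ → ℤ → ℤ → ℂ) (S₁ S₂ S₃ : Finset ℤ) (c : FourierSeq) (k : ℤ) :
    ℂ :=
  ∑ k₁ ∈ S₁, ∑ k₂ ∈ S₂, ∑ k₃ ∈ S₃,
    if k + k₁ = k₂ + k₃ then K k k₁ k₂ k₃ * ((starRingEnd ℂ) (c k₁) * c k₂ * c k₃) else 0

/-- The product of the four symbols. -/
def symbolProd (m : Fin 4 → ℤ → ℂ) (k k₁ k₂ k₃ : ℤ) : ℂ := m 0 k * m 1 (-k₁) * m 2 k₂ * m 3 k₃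

/-- The phase `k² + k₁² - k₂² - k₃²` of the interaction representation. -/
def phase (k k₁ k₂ k₃ : ℤ) : ℤ := k ^ 2 + k₁ ^ 2 - k₂ ^ 2 - k₃ ^ 2

/-- The kernel of the cubic term at time `s`. -/
noncomputable def cubicKernel (m : Fin 4 → ℤ → ℂ) (s : ℝ) (k k₁ k₂ k₃ : ℤ) : ℂ :=
  symbolProd m k k₁ k₂ k₃ * Complex.exp (Complex.I * (((phase k k₁ k₂ k₃ : ℝ) : ℂ) * s))

/-- The kernel of the first resonant term, in which `k₂ = k₁` and `k₃ = k`. -/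
def resonantKernel₃ (m : Fin 4 → ℤ → ℂ) (k k₁ k₂ k₃ : ℤ) : ℂ :=
  if k₂ = k₁ then symbolProd m k k₁ k₂ k₃ else 0

/-- The kernel of the second resonant term, in which `k₃ = k₁` and `k₂ = k`. -/
def resonantKernel₂ (m : Fin 4 → ℤ → ℂ) (k k₁ k₂ k₃ : ℤ) : ℂ :=
  if k₃ = k₁ then symbolProd m k k₁ k₂ k₃ else 0

/-- The kernel of the trilinear operator, with the resonant terms subtracted. -/
noncomputable def fullKernel (m : Fin 4 → ℤ → ℂ) (s : ℝ) (k k₁ k₂ k₃ : ℤ) : ℂ :=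
  cubicKernel m s k k₁ k₂ k₃ - resonantKernel₃ m k k₁ k₂ k₃ - resonantKernel₂ m k k₁ k₂ k₃

theorem triSum_fullKernel (m : Fin 4 → ℤ → ℂ) (s : ℝ) (S₁ S₂ S₃ : Finset ℤ) (c : FourierSeq)
    (k : ℤ) :
    triSum (fullKernel m s) S₁ S₂ S₃ c k = triSum (cubicKernel m s) S₁ S₂ S₃ c k -
      triSum (resonantKernel₃ m) S₁ S₂ S₃ c k - triSum (resonantKernel₂ m) S₁ S₂ S₃ c k := by
  simp only [triSum, ← Finset.sum_sub_distrib]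
  refine Finset.sum_congr rfl fun k₁ _ => Finset.sum_congr rfl fun k₂ _ =>
    Finset.sum_congr rfl fun k₃ _ => ?_
  split_ifs
  · rw [fullKernel]; ring
  · simp

theorem sum_low_eq {M : Type*} [AddCommMonoid M] (N : ℕ) (f : ℤ → M) :
    ∑ k ∈ low N, f k = ∑ j ∈ Finset.range (N + 1), ∑ k ∈ block j, f k := by
  rw [← Finset.sum_fiberwise_of_maps_to (s := low N) (t := Finset.range (N + 1)) (g := blk)
    fun k hk => by rw [mem_low] at hk; rw [Finset.mem_range]; omega]
  refine Finset.sum_congr rfl fun j hj => Finset.sum_congr ?_ fun _ _ => rfl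
  ext k
  rw [Finset.mem_filter, mem_low, mem_block]
  rw [Finset.mem_range] at hj
  omega

theorem triSum_low (K : ℤ → ℤ → ℤ → ℤ → ℂ) (N : ℕ) (c : FourierSeq) (k : ℤ) :
    triSum K (low N) (low N) (low N) c k =
      ∑ j₁ ∈ Finset.range (N + 1), ∑ j₂ ∈ Finset.range (N + 1), ∑ j₃ ∈ Finset.range (N + 1),
        triSum K (block j₁) (block j₂) (block j₃) c k := by
  simp only [triSum, sum_low_eq]
  refine Finset.sum_congr rfl fun j₁ _ => ?_
  rw [Finset.sum_comm]
  refine Finset.sum_congr rfl fun j₂ _ => ?_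
  rw [Finset.sum_comm (s := Finset.range (N + 1))]
  refine Finset.sum_congr rfl fun k₁ _ => ?_
  rw [Finset.sum_comm]

theorem phase_eq {k k₁ k₂ k₃ : ℤ} (h : k + k₁ = k₂ + k₃) :
    phase k k₁ k₂ k₃ = 2 * (k₃ - k₁) * (k₂ - k₁) := by
  obtain rfl : k = k₂ + k₃ - k₁ := by omega
  rw [phase]; ring

/-- In blocks that are not comparable the resonant interactions cancel. -/
theorem fullKernel_eq_of_not_comparable (m : Fin 4 → ℤ → ℂ) (s : ℝ) {k k₁ k₂ k₃ : ℤ}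
    (hk : k + k₁ = k₂ + k₃) (hj : ¬ Comparable (blk k₁) (blk k₂) (blk k₃)) :
    fullKernel m s k k₁ k₂ k₃ =
      if k₂ ≠ k₁ ∧ k₃ ≠ k₁ then cubicKernel m s k k₁ k₂ k₃ else 0 := by
  have hne : ¬ (k₂ = k₁ ∧ k₃ = k₁) := by
    rintro ⟨rfl, rfl⟩
    exact hj (by unfold Comparable; omega)
  rw [fullKernel, resonantKernel₂, resonantKernel₃, cubicKernel, phase_eq hk]
  by_cases h2 : k₂ = k₁
  · have h3 : k₃ ≠ k₁ := fun h => hne ⟨h2, h⟩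
    simp [h2, h3]
  · by_cases h3 : k₃ = k₁
    · simp [h2, h3]
    · simp [h2, h3]

theorem enorm_symbolProd_le {A : ℝ} {m : Fin 4 → ℤ → ℂ} (hm : ∀ i, IsBVSymbol A (m i))
    (k k₁ k₂ k₃ : ℤ) : ‖symbolProd m k k₁ k₂ k₃‖ₑ ≤ ENNReal.ofReal A ^ 4 := by
  rw [symbolProd, enorm_mul, enorm_mul, enorm_mul]
  calc _ ≤ ENNReal.ofReal A * ENNReal.ofReal A * ENNReal.ofReal A * ENNReal.ofReal A := by
        gcongr <;> exact (hm _).enorm_le _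
    _ = _ := by ring

section Time

variable {t₀ t₁ : ℝ} {v w : ℝ → FourierSeq}

theorem HasTimeDeriv.isPrimitive (h : HasTimeDeriv t₀ t₁ v w) (k : ℤ) :
    IsPrimitive t₀ t₁ (fun s => v s k) (fun s => w s k) := h k

theorem HasTimeDeriv.aemeasurable_enorm_deriv (ht : t₀ ≤ t₁) (h : HasTimeDeriv t₀ t₁ v w) (k : ℤ) :
    AEMeasurable (fun s => ‖w s k‖ₑ) (volume.restrict (Set.Icc t₀ t₁)) := by
  have h1 := (h k).1
  rw [intervalIntegrable_iff_integrableOn_Icc_of_le ht] at h1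
  exact h1.1.enorm

theorem HasTimeDeriv.aestronglyMeasurable (ht : t₀ ≤ t₁) (h : HasTimeDeriv t₀ t₁ v w) (k : ℤ) :
    AEStronglyMeasurable (fun s => v s k) (volume.restrict (Set.Icc t₀ t₁)) :=
  ((h.isPrimitive k).continuousOn ht).aestronglyMeasurable measurableSet_Icc

theorem HasTimeDeriv.aemeasurable_enorm (ht : t₀ ≤ t₁) (h : HasTimeDeriv t₀ t₁ v w) (k : ℤ) :
    AEMeasurable (fun s => ‖v s k‖ₑ) (volume.restrict (Set.Icc t₀ t₁)) :=
  (h.aestronglyMeasurable ht k).enorm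

/-- The frequencies `P` of `v` at every time are controlled by those at one time and by the
derivative. -/
theorem HasTimeDeriv.l2_ite_le (ht : t₀ ≤ t₁) (h : HasTimeDeriv t₀ t₁ v w) (P : ℤ → Prop)
    [DecidablePred P] {s r : ℝ} (hs : s ∈ Set.Icc t₀ t₁) (hr : r ∈ Set.Icc t₀ t₁) :
    l2 (fun k => if P k then ‖v s k‖ₑ else 0) ≤ l2 (fun k => if P k then ‖v r k‖ₑ else 0) +
      ∫⁻ q in Set.Icc t₀ t₁, l2 (fun k => if P k then ‖w q k‖ₑ else 0) := by
  have hm : ∀ k, AEMeasurable (fun q => if P k then ‖w q k‖ₑ else 0)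
      (volume.restrict (Set.Icc t₀ t₁)) := by
    intro k
    split_ifs
    · exact h.aemeasurable_enorm_deriv ht k
    · exact aemeasurable_const
  refine le_trans ?_ (add_le_add_right (l2_lintegral_le hm) _)
  refine le_trans (l2_mono fun k => ?_) (l2_add_le _ _)
  split_ifs
  · have hsub : ∀ x ∈ Set.Icc t₀ t₁, IntervalIntegrable (fun q => w q k) volume t₀ x := by
      intro x hx
      refine (h k).1.mono_set ?_
      rw [Set.uIcc_of_le ht, Set.uIcc_of_le hx.1]
      exact Set.Icc_subset_Icc_right hx.2
    have h1 : v s k = v r k + ∫ q in r..s, w q k := by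
      rw [(h k).2 s hs, (h k).2 r hr,
        ← intervalIntegral.integral_interval_sub_left (hsub s hs) (hsub r hr)]
      ring
    rw [h1]
    refine (enorm_add_le _ _).trans (add_le_add_right ?_ _)
    rw [← ofReal_norm, intervalIntegral.norm_integral_eq_norm_integral_uIoc, ofReal_norm]
    refine (enorm_integral_le_lintegral_enorm _).trans (lintegral_mono_set ?_)
    refine Set.uIoc_subset_uIcc.trans ?_
    exact Set.uIcc_subset_Icc hr hs
  · simp

/-- The blocks of `v` at every time are controlled by those at one time and by the derivative. -/
theorem HasTimeDeriv.blockNorm_le (ht : t₀ ≤ t₁) (h : HasTimeDeriv t₀ t₁ v w) (j : ℕ) {s r : ℝ}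
    (hs : s ∈ Set.Icc t₀ t₁) (hr : r ∈ Set.Icc t₀ t₁) :
    blockNorm j (v s) ≤ blockNorm j (v r) + ∫⁻ q in Set.Icc t₀ t₁, blockNorm j (w q) :=
  h.l2_ite_le ht (fun k => blk k = j) hs hr

/-- The essential supremum in time bounds `v` only at almost every time; the derivative gives every
time. -/
theorem blockNorm_le_xNorm (γ : ℝ) (ht : t₀ < t₁) (h : HasTimeDeriv t₀ t₁ v w) (j : ℕ) {s : ℝ}
    (hs : s ∈ Set.Icc t₀ t₁) :
    blockNorm j (v s) ≤ ENNReal.ofReal (5 ^ |γ| * 2 ^ (-γ * j)) *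
      xNorm γ t₀ t₁ (fun s => dyadic j (v s)) (fun s => dyadic j (w s)) := by
  have hne : (volume.restrict (Set.Icc t₀ t₁)) ≠ 0 := by
    rw [Ne, Measure.restrict_eq_zero, Real.volume_Icc]
    simpa using ht
  have : NeBot (ae (volume.restrict (Set.Icc t₀ t₁))) := ae_neBot.2 hne
  obtain ⟨r, hr1, hr2⟩ := ((ENNReal.ae_le_essSup
    (μ := volume.restrict (Set.Icc t₀ t₁)) fun s => sobolevNorm γ (dyadic j (v s))).and
      (ae_restrict_mem measurableSet_Icc)).exists
  refine (h.blockNorm_le ht.le j hs hr2).trans ?_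
  rw [xNorm, mul_add]
  refine add_le_add ?_ ?_
  · exact (blockNorm_le_sobolevNorm γ j _).trans (by gcongr)
  · rw [← lintegral_const_mul' _ _ ENNReal.ofReal_ne_top]
    exact lintegral_mono fun q => blockNorm_le_sobolevNorm γ j _

theorem lintegral_blockNorm_le_xNorm (γ : ℝ) (t₀ t₁ : ℝ) (v w : ℝ → FourierSeq) (j : ℕ) :
    ∫⁻ s in Set.Icc t₀ t₁, blockNorm j (w s) ≤ ENNReal.ofReal (5 ^ |γ| * 2 ^ (-γ * j)) *
      xNorm γ t₀ t₁ (fun s => dyadic j (v s)) (fun s => dyadic j (w s)) := by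
  rw [xNorm, mul_add, ← lintegral_const_mul' _ _ ENNReal.ofReal_ne_top]
  exact le_add_left (lintegral_mono fun q => blockNorm_le_sobolevNorm γ j _)

theorem HasTimeDeriv.continuousOn_triSum (h : HasTimeDeriv t₀ t₁ v w) (ht : t₀ ≤ t₁)
    {K : ℝ → ℤ → ℤ → ℤ → ℤ → ℂ} (hK : ∀ k k₁ k₂ k₃, Continuous fun s => K s k k₁ k₂ k₃)
    (S₁ S₂ S₃ : Finset ℤ) (k : ℤ) :
    ContinuousOn (fun s => triSum (K s) S₁ S₂ S₃ (v s) k) (Set.Icc t₀ t₁) := by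
  have hv := fun k => (h.isPrimitive k).continuousOn ht
  unfold triSum
  refine continuousOn_finsetSum _ fun k₁ _ => continuousOn_finsetSum _ fun k₂ _ =>
    continuousOn_finsetSum _ fun k₃ _ => ?_
  split_ifs
  · exact (hK k k₁ k₂ k₃).continuousOn.mul
      (((Complex.continuous_conj.comp_continuousOn (hv k₁)).mul (hv k₂)).mul (hv k₃))
  · exact continuousOn_const

theorem continuous_cubicKernel (m : Fin 4 → ℤ → ℂ) (k k₁ k₂ k₃ : ℤ) :
    Continuous fun s => cubicKernel m s k k₁ k₂ k₃ := by
  unfold cubicKernel; fun_prop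

theorem continuous_fullKernel (m : Fin 4 → ℤ → ℂ) (k k₁ k₂ k₃ : ℤ) :
    Continuous fun s => fullKernel m s k k₁ k₂ k₃ := by
  unfold fullKernel
  exact ((continuous_cubicKernel m k k₁ k₂ k₃).sub continuous_const).sub continuous_const

/-- Integration by parts in time for blocks that are not comparable. -/
theorem enorm_integral_triSum_le {A : ℝ} {m : Fin 4 → ℤ → ℂ} (hm : ∀ i, IsBVSymbol A (m i))
    (ht : t₀ ≤ t₁) (h : HasTimeDeriv t₀ t₁ v w) {j₁ j₂ j₃ : ℕ} (hj : ¬ Comparable j₁ j₂ j₃)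
    (k : ℤ) :
    ‖∫ s in t₀..t₁, triSum (fullKernel m s) (block j₁) (block j₂) (block j₃) (v s) k‖ₑ ≤
      ENNReal.ofReal A ^ 4 *
        (nonresonantSum j₁ j₂ j₃ (fun l => ‖v t₁ l‖ₑ) (fun l => ‖v t₁ l‖ₑ) (fun l => ‖v t₁ l‖ₑ) k +
        nonresonantSum j₁ j₂ j₃ (fun l => ‖v t₀ l‖ₑ) (fun l => ‖v t₀ l‖ₑ) (fun l => ‖v t₀ l‖ₑ) k +
        ∫⁻ s in Set.Icc t₀ t₁,
          (nonresonantSum j₁ j₂ j₃ (fun l => ‖w s l‖ₑ) (fun l => ‖v s l‖ₑ) (fun l => ‖v s l‖ₑ) k +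
          nonresonantSum j₁ j₂ j₃ (fun l => ‖v s l‖ₑ) (fun l => ‖w s l‖ₑ) (fun l => ‖v s l‖ₑ) k +
          nonresonantSum j₁ j₂ j₃ (fun l => ‖v s l‖ₑ) (fun l => ‖v s l‖ₑ) (fun l => ‖w s l‖ₑ) k))
        := by
  have hv := fun k => (h.isPrimitive k).continuousOn ht
  set P : ℤ → ℤ → ℤ → Prop := fun k₁ k₂ k₃ => k + k₁ = k₂ + k₃ ∧ k₂ ≠ k₁ ∧ k₃ ≠ k₁ with hP
  set W : ℤ → ℤ → ℤ → ℝ≥0∞ := fun k₁ k₂ k₃ =>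
    ENNReal.ofReal |2 * ((k₃ - k₁ : ℤ) : ℝ) * ((k₂ - k₁ : ℤ) : ℝ)|⁻¹ with hW
  set E : ℤ → ℤ → ℤ → ℝ → ℝ≥0∞ := fun k₁ k₂ k₃ s =>
    (if P k₁ k₂ k₃ then W k₁ k₂ k₃ * (‖w s k₁‖ₑ * ‖v s k₂‖ₑ * ‖v s k₃‖ₑ) else 0) +
    (if P k₁ k₂ k₃ then W k₁ k₂ k₃ * (‖v s k₁‖ₑ * ‖w s k₂‖ₑ * ‖v s k₃‖ₑ) else 0) +
    (if P k₁ k₂ k₃ then W k₁ k₂ k₃ * (‖v s k₁‖ₑ * ‖v s k₂‖ₑ * ‖w s k₃‖ₑ) else 0) with hE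
  have hEm : ∀ k₁ k₂ k₃, AEMeasurable (E k₁ k₂ k₃) (volume.restrict (Set.Icc t₀ t₁)) := by
    intro k₁ k₂ k₃
    have h1 := fun k => h.aemeasurable_enorm_deriv ht k
    have h2 := fun k => h.aemeasurable_enorm ht k
    simp only [hE]
    split_ifs
    · exact (((((h1 k₁).mul (h2 k₂)).mul (h2 k₃)).const_mul _).add
        ((((h2 k₁).mul (h1 k₂)).mul (h2 k₃)).const_mul _)).add
        ((((h2 k₁).mul (h2 k₂)).mul (h1 k₃)).const_mul _)
    · exact aemeasurable_const
  have hEsum : ∫⁻ s in Set.Icc t₀ t₁,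
      (nonresonantSum j₁ j₂ j₃ (fun l => ‖w s l‖ₑ) (fun l => ‖v s l‖ₑ) (fun l => ‖v s l‖ₑ) k +
      nonresonantSum j₁ j₂ j₃ (fun l => ‖v s l‖ₑ) (fun l => ‖w s l‖ₑ) (fun l => ‖v s l‖ₑ) k +
      nonresonantSum j₁ j₂ j₃ (fun l => ‖v s l‖ₑ) (fun l => ‖v s l‖ₑ) (fun l => ‖w s l‖ₑ) k) =
      ∑ k₁ ∈ block j₁, ∑ k₂ ∈ block j₂, ∑ k₃ ∈ block j₃,
        ∫⁻ s in Set.Icc t₀ t₁, E k₁ k₂ k₃ s := by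
    have e1 : ∀ k₁ k₂, ∑ k₃ ∈ block j₃, ∫⁻ s in Set.Icc t₀ t₁, E k₁ k₂ k₃ s =
        ∫⁻ s in Set.Icc t₀ t₁, ∑ k₃ ∈ block j₃, E k₁ k₂ k₃ s := fun k₁ k₂ =>
      (lintegral_finsetSum' _ fun k₃ _ => hEm k₁ k₂ k₃).symm
    have e2 : ∀ k₁, ∑ k₂ ∈ block j₂, ∫⁻ s in Set.Icc t₀ t₁, ∑ k₃ ∈ block j₃, E k₁ k₂ k₃ s =
        ∫⁻ s in Set.Icc t₀ t₁, ∑ k₂ ∈ block j₂, ∑ k₃ ∈ block j₃, E k₁ k₂ k₃ s := fun k₁ =>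
      (lintegral_finsetSum' _ fun k₂ _ =>
        Finset.aemeasurable_fun_sum _ fun k₃ _ => hEm k₁ k₂ k₃).symm
    simp only [e1, e2]
    rw [← lintegral_finsetSum' _ fun k₁ _ => Finset.aemeasurable_fun_sum _ fun k₂ _ =>
      Finset.aemeasurable_fun_sum _ fun k₃ _ => hEm k₁ k₂ k₃]
    simp only [nonresonantSum, hE, Finset.sum_add_distrib, hP, hW]
  rw [hEsum]
  have hterm : ∀ k₁ ∈ block j₁, ∀ k₂ ∈ block j₂, ∀ k₃ ∈ block j₃,
      ‖∫ s in t₀..t₁, (if k + k₁ = k₂ + k₃ then fullKernel m s k k₁ k₂ k₃ *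
        ((starRingEnd ℂ) (v s k₁) * v s k₂ * v s k₃) else 0)‖ₑ ≤ ENNReal.ofReal A ^ 4 *
      ((if P k₁ k₂ k₃ then W k₁ k₂ k₃ * (‖v t₁ k₁‖ₑ * ‖v t₁ k₂‖ₑ * ‖v t₁ k₃‖ₑ) else 0) +
        (if P k₁ k₂ k₃ then W k₁ k₂ k₃ * (‖v t₀ k₁‖ₑ * ‖v t₀ k₂‖ₑ * ‖v t₀ k₃‖ₑ) else 0) +
        ∫⁻ s in Set.Icc t₀ t₁, E k₁ k₂ k₃ s) := by
    intro k₁ hk₁ k₂ hk₂ k₃ hk₃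
    rw [mem_block] at hk₁ hk₂ hk₃
    by_cases hk : k + k₁ = k₂ + k₃
    · have hj' : ¬ Comparable (blk k₁) (blk k₂) (blk k₃) := by rwa [hk₁, hk₂, hk₃]
      simp only [if_pos hk, fullKernel_eq_of_not_comparable m _ hk hj']
      by_cases hne : k₂ ≠ k₁ ∧ k₃ ≠ k₁
      · have hPt : P k₁ k₂ k₃ := ⟨hk, hne⟩
        simp only [hE, if_pos hPt, if_pos hne, cubicKernel, mul_assoc (symbolProd m k k₁ k₂ k₃)]
        rw [intervalIntegral.integral_const_mul, enorm_mul]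
        have hφ : ((phase k k₁ k₂ k₃ : ℤ) : ℝ) ≠ 0 := by
          rw [phase_eq hk]
          have h2 : k₃ - k₁ ≠ 0 := sub_ne_zero.2 hne.2
          have h3 : k₂ - k₁ ≠ 0 := sub_ne_zero.2 hne.1
          exact_mod_cast mul_ne_zero (mul_ne_zero two_ne_zero h2) h3
        have hWφ : W k₁ k₂ k₃ = ENNReal.ofReal |((phase k k₁ k₂ k₃ : ℤ) : ℝ)|⁻¹ := by
          rw [hW, phase_eq hk]; push_cast; rfl
        refine mul_le_mul' (enorm_symbolProd_le hm _ _ _ _) ?_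
        refine (enorm_integral_exp_mul_three_le ht hφ (h.isPrimitive k₁) (h.isPrimitive k₂)
          (h.isPrimitive k₃)).trans_eq ?_
        simp only [← mul_add, hWφ]
        rw [lintegral_const_mul' _ _ ENNReal.ofReal_ne_top, ← mul_add]
      · simp [hne]
    · simp [hk]
  have hcont : ∀ k₁ k₂ k₃, ContinuousOn (fun s => if k + k₁ = k₂ + k₃ then
      fullKernel m s k k₁ k₂ k₃ * ((starRingEnd ℂ) (v s k₁) * v s k₂ * v s k₃) else 0)
      (Set.Icc t₀ t₁) := by
    intro k₁ k₂ k₃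
    split_ifs
    · exact (continuous_fullKernel m k k₁ k₂ k₃).continuousOn.mul
        (((Complex.continuous_conj.comp_continuousOn (hv k₁)).mul (hv k₂)).mul (hv k₃))
    · exact continuousOn_const
  have hsum : ∫ s in t₀..t₁, triSum (fullKernel m s) (block j₁) (block j₂) (block j₃) (v s) k =
      ∑ k₁ ∈ block j₁, ∑ k₂ ∈ block j₂, ∑ k₃ ∈ block j₃,
        ∫ s in t₀..t₁, (if k + k₁ = k₂ + k₃ then fullKernel m s k k₁ k₂ k₃ *
        ((starRingEnd ℂ) (v s k₁) * v s k₂ * v s k₃) else 0) := by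
    unfold triSum
    rw [intervalIntegral.integral_finsetSum fun k₁ _ => (continuousOn_finsetSum _ fun k₂ _ =>
      continuousOn_finsetSum _ fun k₃ _ => hcont k₁ k₂ k₃).intervalIntegrable_of_Icc ht]
    refine Finset.sum_congr rfl fun k₁ _ => ?_
    rw [intervalIntegral.integral_finsetSum fun k₂ _ => (continuousOn_finsetSum _ fun k₃ _ =>
      hcont k₁ k₂ k₃).intervalIntegrable_of_Icc ht]
    refine Finset.sum_congr rfl fun k₂ _ => ?_
    rw [intervalIntegral.integral_finsetSum fun k₃ _ =>
      (hcont k₁ k₂ k₃).intervalIntegrable_of_Icc ht]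
  rw [hsum]
  calc _ ≤ ∑ k₁ ∈ block j₁, ∑ k₂ ∈ block j₂, ∑ k₃ ∈ block j₃,
        ‖∫ s in t₀..t₁, (if k + k₁ = k₂ + k₃ then fullKernel m s k k₁ k₂ k₃ *
        ((starRingEnd ℂ) (v s k₁) * v s k₂ * v s k₃) else 0)‖ₑ :=
        (enorm_sum_le _ _).trans (Finset.sum_le_sum fun k₁ _ => (enorm_sum_le _ _).trans
          (Finset.sum_le_sum fun k₂ _ => enorm_sum_le _ _))
    _ ≤ _ := Finset.sum_le_sum fun k₁ hk₁ => Finset.sum_le_sum fun k₂ hk₂ =>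
        Finset.sum_le_sum fun k₃ hk₃ => hterm k₁ hk₁ k₂ hk₂ k₃ hk₃
    _ = _ := by
        simp only [← Finset.mul_sum, Finset.sum_add_distrib]
        rfl

theorem aemeasurable_nonresonantSum {μ : Measure ℝ} {a b c : ℝ → ℤ → ℝ≥0∞}
    (ha : ∀ k, AEMeasurable (fun s => a s k) μ) (hb : ∀ k, AEMeasurable (fun s => b s k) μ)
    (hc : ∀ k, AEMeasurable (fun s => c s k) μ) (j₁ j₂ j₃ : ℕ) (k : ℤ) :
    AEMeasurable (fun s => nonresonantSum j₁ j₂ j₃ (a s) (b s) (c s) k) μ := by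
  unfold nonresonantSum
  refine Finset.aemeasurable_fun_sum _ fun k₁ _ => Finset.aemeasurable_fun_sum _ fun k₂ _ =>
    Finset.aemeasurable_fun_sum _ fun k₃ _ => ?_
  split_ifs
  · exact (((ha k₁).mul (hb k₂)).mul (hc k₃)).const_mul _
  · exact aemeasurable_const

/-- The contribution of three blocks that are not comparable to the trilinear operator. -/
theorem exists_l2_integral_triSum_le (γ A : ℝ) {ε : ℝ} (hε : 0 < ε) :
    ∃ D : ℝ≥0, ∀ (m : Fin 4 → ℤ → ℂ), (∀ i, IsBVSymbol A (m i)) →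
      ∀ (t₀ t₁ : ℝ), t₀ < t₁ → ∀ (v w : ℝ → FourierSeq), HasTimeDeriv t₀ t₁ v w →
      ∀ j₁ j₂ j₃ : ℕ, ¬ Comparable j₁ j₂ j₃ →
      l2 (fun k => ‖∫ s in t₀..t₁,
        triSum (fullKernel m s) (block j₁) (block j₂) (block j₃) (v s) k‖ₑ) ≤
      D * ENNReal.ofReal
          (2 ^ ((ε - 1) * (max j₁ (max j₂ j₃) : ℕ)) * 2 ^ (-γ * (j₁ + j₂ + j₃))) *
        (xNorm γ t₀ t₁ (fun s => dyadic j₁ (v s)) (fun s => dyadic j₁ (w s)) *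
          xNorm γ t₀ t₁ (fun s => dyadic j₂ (v s)) (fun s => dyadic j₂ (w s)) *
          xNorm γ t₀ t₁ (fun s => dyadic j₃ (v s)) (fun s => dyadic j₃ (w s))) := by
  obtain ⟨D, hD⟩ := exists_l2_nonresonantSum_le hε
  refine ⟨A.toNNReal ^ 4 * D * (5 * (5 ^ |γ|) ^ 3), ?_⟩
  intro m hm t₀ t₁ ht v w h j₁ j₂ j₃ hj
  set J := max j₁ (max j₂ j₃) with hJ
  set X : ℕ → ℝ≥0∞ := fun j => xNorm γ t₀ t₁ (fun s => dyadic j (v s)) (fun s => dyadic j (w s))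
    with hX
  set e : ℕ → ℝ≥0∞ := fun j => ENNReal.ofReal (5 ^ |γ| * 2 ^ (-γ * j)) with he
  set R : ℝ≥0∞ := D * ENNReal.ofReal (2 ^ ((ε - 1) * J)) with hR
  set B : ℝ≥0∞ := (e j₁ * X j₁) * (e j₂ * X j₂) * (e j₃ * X j₃) with hB
  have hv : ∀ j, ∀ s ∈ Set.Icc t₀ t₁, blockNorm j (v s) ≤ e j * X j := fun j s hs =>
    blockNorm_le_xNorm γ ht h j hs
  have hw : ∀ j, ∫⁻ s in Set.Icc t₀ t₁, blockNorm j (w s) ≤ e j * X j := fun j =>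
    lintegral_blockNorm_le_xNorm γ t₀ t₁ v w j
  have hD' := hD j₁ j₂ j₃ hj
  have hpt : ∀ s ∈ Set.Icc t₀ t₁, l2 (nonresonantSum j₁ j₂ j₃ (fun l => ‖v s l‖ₑ)
      (fun l => ‖v s l‖ₑ) (fun l => ‖v s l‖ₑ)) ≤ R * B := by
    intro s hs
    refine (hD' _ _ _).trans (mul_le_mul_right ?_ _)
    exact mul_le_mul' (mul_le_mul' (hv j₁ s hs) (hv j₂ s hs)) (hv j₃ s hs)
  have mv := fun k => h.aemeasurable_enorm ht.le k
  have mw := fun k => h.aemeasurable_enorm_deriv ht.le k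
  have mb : ∀ j, AEMeasurable (fun s => blockNorm j (w s)) (volume.restrict (Set.Icc t₀ t₁)) := by
    intro j
    refine aemeasurable_l2 fun k => ?_
    split_ifs
    · exact mw k
    · exact aemeasurable_const
  have hint : ∀ (f : ℝ → ℝ≥0∞) (j : ℕ) (Y : ℝ≥0∞),
      (∀ s ∈ Set.Icc t₀ t₁, f s ≤ R * (blockNorm j (w s) * Y)) → R * ((e j * X j) * Y) = R * B →
      ∫⁻ s in Set.Icc t₀ t₁, f s ≤ R * B := by
    intro f j Y hf hY
    refine (setLIntegral_mono_ae' measurableSet_Icc (Eventually.of_forall hf)).trans ?_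
    rw [lintegral_const_mul'' _ ((mb j).mul_const _), lintegral_mul_const'' _ (mb j), ← hY]
    gcongr
    exact hw j
  have i1 : ∫⁻ s in Set.Icc t₀ t₁, l2 (nonresonantSum j₁ j₂ j₃ (fun l => ‖w s l‖ₑ)
      (fun l => ‖v s l‖ₑ) (fun l => ‖v s l‖ₑ)) ≤ R * B := by
    refine hint _ j₁ ((e j₂ * X j₂) * (e j₃ * X j₃)) (fun s hs => ?_) (by rw [hB]; ring)
    refine (hD' _ _ _).trans (mul_le_mul_right ?_ _)
    rw [mul_assoc]
    exact mul_le_mul' le_rfl (mul_le_mul' (hv j₂ s hs) (hv j₃ s hs))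
  have i2 : ∫⁻ s in Set.Icc t₀ t₁, l2 (nonresonantSum j₁ j₂ j₃ (fun l => ‖v s l‖ₑ)
      (fun l => ‖w s l‖ₑ) (fun l => ‖v s l‖ₑ)) ≤ R * B := by
    refine hint _ j₂ ((e j₁ * X j₁) * (e j₃ * X j₃)) (fun s hs => ?_) (by rw [hB]; ring)
    refine (hD' _ _ _).trans (mul_le_mul_right ?_ _)
    rw [mul_comm (l2 (cut j₁ _)), mul_assoc]
    exact mul_le_mul' le_rfl (mul_le_mul' (hv j₁ s hs) (hv j₃ s hs))
  have i3 : ∫⁻ s in Set.Icc t₀ t₁, l2 (nonresonantSum j₁ j₂ j₃ (fun l => ‖v s l‖ₑ)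
      (fun l => ‖v s l‖ₑ) (fun l => ‖w s l‖ₑ)) ≤ R * B := by
    refine hint _ j₃ ((e j₁ * X j₁) * (e j₂ * X j₂)) (fun s hs => ?_) (by rw [hB]; ring)
    refine (hD' _ _ _).trans (mul_le_mul_right ?_ _)
    rw [mul_comm]
    exact mul_le_mul' le_rfl (mul_le_mul' (hv j₁ s hs) (hv j₂ s hs))
  have n1 := aemeasurable_nonresonantSum (a := fun s l => ‖w s l‖ₑ) (b := fun s l => ‖v s l‖ₑ)
    (c := fun s l => ‖v s l‖ₑ) mw mv mv j₁ j₂ j₃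
  have n2 := aemeasurable_nonresonantSum (a := fun s l => ‖v s l‖ₑ) (b := fun s l => ‖w s l‖ₑ)
    (c := fun s l => ‖v s l‖ₑ) mv mw mv j₁ j₂ j₃
  have n3 := aemeasurable_nonresonantSum (a := fun s l => ‖v s l‖ₑ) (b := fun s l => ‖v s l‖ₑ)
    (c := fun s l => ‖w s l‖ₑ) mv mv mw j₁ j₂ j₃
  refine (l2_mono fun k => enorm_integral_triSum_le hm ht.le h hj k).trans ?_
  rw [l2_const_mul]
  refine (mul_le_mul_right (((l2_add_le _ _).trans (add_le_add (l2_add_le _ _)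
    (l2_lintegral_le fun k => ((n1 k).add (n2 k)).add (n3 k))))) _).trans ?_
  have hI : ∫⁻ s in Set.Icc t₀ t₁, l2 (fun k =>
      nonresonantSum j₁ j₂ j₃ (fun l => ‖w s l‖ₑ) (fun l => ‖v s l‖ₑ) (fun l => ‖v s l‖ₑ) k +
      nonresonantSum j₁ j₂ j₃ (fun l => ‖v s l‖ₑ) (fun l => ‖w s l‖ₑ) (fun l => ‖v s l‖ₑ) k +
      nonresonantSum j₁ j₂ j₃ (fun l => ‖v s l‖ₑ) (fun l => ‖v s l‖ₑ) (fun l => ‖w s l‖ₑ) k) ≤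
      R * B + R * B + R * B := by
    refine (lintegral_mono fun s => (l2_add_le _ _).trans
      (add_le_add_left (l2_add_le _ _) _)).trans ?_
    have p2 : AEMeasurable (fun s => l2 (nonresonantSum j₁ j₂ j₃ (fun l => ‖v s l‖ₑ)
      (fun l => ‖w s l‖ₑ) (fun l => ‖v s l‖ₑ))) (volume.restrict (Set.Icc t₀ t₁)) :=
      aemeasurable_l2 n2
    have p3 : AEMeasurable (fun s => l2 (nonresonantSum j₁ j₂ j₃ (fun l => ‖v s l‖ₑ)
      (fun l => ‖v s l‖ₑ) (fun l => ‖w s l‖ₑ))) (volume.restrict (Set.Icc t₀ t₁)) :=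
      aemeasurable_l2 n3
    rw [lintegral_add_right' _ p3, lintegral_add_right' _ p2]
    exact add_le_add (add_le_add i1 i2) i3
  refine (mul_le_mul_right (add_le_add (add_le_add (hpt t₁ ⟨ht.le, le_rfl⟩)
    (hpt t₀ ⟨le_rfl, ht.le⟩)) hI) _).trans_eq ?_
  have hee : e j₁ * e j₂ * e j₃ = ((5 ^ |γ|) ^ 3 : ℝ≥0) *
      ENNReal.ofReal (2 ^ (-γ * (j₁ + j₂ + j₃))) := by
    simp only [he]
    rw [← ENNReal.ofReal_mul (by positivity), ← ENNReal.ofReal_mul (by positivity),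
      ← ENNReal.ofReal_coe_nnreal, ← ENNReal.ofReal_mul (by positivity)]
    congr 1
    push_cast
    rw [mul_add, mul_add, Real.rpow_add (by norm_num), Real.rpow_add (by norm_num)]
    ring
  have hBe : B = (e j₁ * e j₂ * e j₃) * (X j₁ * X j₂ * X j₃) := by rw [hB]; ring
  rw [hBe, hee, hR, ENNReal.ofReal_mul (by positivity)]
  push_cast
  rw [show ENNReal.ofReal A = ((A.toNNReal : ℝ≥0) : ℝ≥0∞) from rfl]
  ring

end Time

/-! ### Comparable frequencies -/

theorem haar_le_volume : (AddCircle.haarAddCircle : Measure Torus) ≤ volume := by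
  rw [AddCircle.volume_eq_smul_haarAddCircle]
  intro s
  rw [Measure.smul_apply, smul_eq_mul]
  refine le_mul_of_one_le_left zero_le ?_
  rw [← ENNReal.ofReal_one]
  exact ENNReal.ofReal_le_ofReal (by linarith [Real.pi_gt_three])

theorem l2_fourierCoeff_le {q : ℝ≥0∞} (hq : 2 ≤ q) {f : Torus → ℂ} (hf : MemLp f q volume) :
    l2 (fun k => ‖fourierCoeff f k‖ₑ) ≤ eLpNorm f q volume := by
  have h2 := hf.mono_exponent hq
  calc l2 (fun k => ‖fourierCoeff f k‖ₑ) ≤ eLpNorm f 2 AddCircle.haarAddCircle := by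
        rw [l2_le_iff, eLpNorm_two_haar_sq h2]
    _ ≤ eLpNorm f q AddCircle.haarAddCircle :=
        eLpNorm_le_eLpNorm_of_exponent_le hq (memLp_haarAddCircle_iff.2 hf).1
    _ ≤ _ := eLpNorm_mono_measure _ haar_le_volume

theorem fourierCoeff_trig_mul_three (S₁ S₂ S₃ : Finset ℤ) (d₁ d₂ d₃ : FourierSeq) (k : ℤ) :
    fourierCoeff (fun x => trig S₁ d₁ x * trig S₂ d₂ x * trig S₃ d₃ x) k =
      ∑ k₁ ∈ S₁, ∑ k₂ ∈ S₂, ∑ k₃ ∈ S₃,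
        if k₁ + k₂ + k₃ = k then d₁ k₁ * d₂ k₂ * d₃ k₃ else 0 := by
  have h1 : (fun x => trig S₁ d₁ x * trig S₂ d₂ x * trig S₃ d₃ x) =
      ∑ p ∈ S₁ ×ˢ S₂ ×ˢ S₃, fun x => d₁ p.1 * d₂ p.2.1 * d₃ p.2.2 *
        fourier (p.1 + p.2.1 + p.2.2) x := by
    ext x
    simp only [Finset.sum_apply, Finset.sum_product, trig_apply, fourier_add]
    rw [Finset.sum_mul_sum, Finset.sum_mul]
    refine Finset.sum_congr rfl fun k₁ _ => ?_
    rw [Finset.sum_mul]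
    refine Finset.sum_congr rfl fun k₂ _ => ?_
    rw [Finset.mul_sum]
    exact Finset.sum_congr rfl fun k₃ _ => by ring
  rw [h1, fourierCoeff.sum _ _ fun p _ => (integrable_haar (fourier _)).const_mul _]
  simp only [Finset.sum_apply, fourierCoeff.const_mul, fourierCoeff_fourier, Pi.single_apply,
    Finset.sum_product]
  refine Finset.sum_congr rfl fun k₁ _ => Finset.sum_congr rfl fun k₂ _ =>
    Finset.sum_congr rfl fun k₃ _ => ?_
  by_cases h : k = k₁ + k₂ + k₃
  · simp [h]
  · rw [if_neg h, if_neg fun h' => h h'.symm, mul_zero]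

theorem flow_apply (s : ℝ) (c : FourierSeq) (k : ℤ) :
    flow s c k = Complex.exp (-(Complex.I * (s : ℂ) * (k : ℂ) ^ 2)) * c k := rfl

/-- The cubic interaction of three frequency sets is a pointwise product of functions. -/
theorem triSum_cubicKernel (m : Fin 4 → ℤ → ℂ) (s : ℝ) {S₁ : Finset ℤ} (S₂ S₃ : Finset ℤ)
    (hS₁ : ∀ k, k ∈ S₁ → -k ∈ S₁) (c : FourierSeq) (k : ℤ) :
    triSum (cubicKernel m s) S₁ S₂ S₃ c k = flow (-s) (mult (m 0) (fourierCoeff fun x =>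
      trig S₁ (flow (-s) (mult (m 1) (conjSeq c))) x *
        trig S₂ (flow s (mult (m 2) c)) x * trig S₃ (flow s (mult (m 3) c)) x)) k := by
  rw [flow_apply, mult, fourierCoeff_trig_mul_three]
  simp only [triSum, Finset.mul_sum]
  refine Finset.sum_nbij' (fun k => -k) (fun k => -k) hS₁ hS₁ (by simp) (by simp) fun k₁ _ => ?_
  refine Finset.sum_congr rfl fun k₂ _ => Finset.sum_congr rfl fun k₃ _ => ?_
  by_cases hk : k + k₁ = k₂ + k₃
  · rw [if_pos hk, if_pos (by omega)]
    simp only [flow_apply, mult, conjSeq, cubicKernel, symbolProd, phase, neg_neg]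
    have : Complex.exp (Complex.I * ((((k ^ 2 + k₁ ^ 2 - k₂ ^ 2 - k₃ ^ 2 : ℤ) : ℝ) : ℂ) * s)) =
        Complex.exp (-(Complex.I * ((-s : ℝ) : ℂ) * (k : ℂ) ^ 2)) *
        Complex.exp (-(Complex.I * ((-s : ℝ) : ℂ) * ((-k₁ : ℤ) : ℂ) ^ 2)) *
        Complex.exp (-(Complex.I * (s : ℂ) * (k₂ : ℂ) ^ 2)) *
        Complex.exp (-(Complex.I * (s : ℂ) * (k₃ : ℂ) ^ 2)) := by
      rw [← Complex.exp_add, ← Complex.exp_add, ← Complex.exp_add]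
      congr 1
      push_cast
      ring
    rw [this]; ring
  · rw [if_neg hk, if_neg (by omega), mul_zero, mul_zero]

theorem neg_mem_block {j : ℕ} (k : ℤ) (hk : k ∈ block j) : -k ∈ block j := by
  rw [mem_block] at hk ⊢
  rwa [blk, Int.natAbs_neg]

theorem neg_mem_low {N : ℕ} (k : ℤ) (hk : k ∈ low N) : -k ∈ low N := by
  rw [mem_low] at hk ⊢
  rwa [blk, Int.natAbs_neg]

theorem enorm_flow (s : ℝ) (c : FourierSeq) (k : ℤ) : ‖flow s c k‖ₑ = ‖c k‖ₑ := by
  have : -(Complex.I * (s : ℂ) * (k : ℂ) ^ 2) = Complex.I * ((-(s * k ^ 2) : ℝ) : ℂ) := by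
    push_cast; ring
  rw [flow_apply, enorm_mul, this, enorm_exp_I_mul, one_mul]

/-- Hölder's inequality with the exponents `1/2 = 1/6 + 1/6 + 1/6`. -/
theorem eLpNorm_mul_three_le {f g h : Torus → ℂ} (hf : AEStronglyMeasurable f volume)
    (hg : AEStronglyMeasurable g volume) (hh : AEStronglyMeasurable h volume) :
    eLpNorm (fun x => f x * g x * h x) 2 volume ≤
      eLpNorm f 6 volume * eLpNorm g 6 volume * eLpNorm h 6 volume := by
  have : ENNReal.HolderTriple 6 6 3 := ⟨by
    rw [← ENNReal.toReal_eq_toReal_iff' (by simp) (by simp),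
      ENNReal.toReal_add (by simp) (by simp)]; norm_num⟩
  have : ENNReal.HolderTriple 3 6 2 := ⟨by
    rw [← ENNReal.toReal_eq_toReal_iff' (by simp) (by simp),
      ENNReal.toReal_add (by simp) (by simp)]; norm_num⟩
  have h1 : eLpNorm (fun x => f x * g x) 3 volume ≤ eLpNorm f 6 volume * eLpNorm g 6 volume := by
    have := eLpNorm_smul_le_mul_eLpNorm (p := 6) (q := 6) (r := 3) hg hf
    exact this
  have h2 : eLpNorm (fun x => f x * g x * h x) 2 volume ≤
      eLpNorm (fun x => f x * g x) 3 volume * eLpNorm h 6 volume := by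
    have := eLpNorm_smul_le_mul_eLpNorm (p := 3) (q := 6) (r := 2) hh (hf.mul hg)
    exact this
  exact h2.trans (mul_le_mul_left h1 _)

theorem trig_conjSeq {S : Finset ℤ} (hS : ∀ k, k ∈ S → -k ∈ S) (c : FourierSeq) (x : Torus) :
    trig S (conjSeq c) x = (starRingEnd ℂ) (trig S c x) := by
  rw [trig_apply, trig_apply, map_sum]
  refine Finset.sum_nbij' (fun k => -k) (fun k => -k) hS hS (by simp) (by simp) fun k _ => ?_
  simp [conjSeq]

theorem eLpNorm_trig_conjSeq {S : Finset ℤ} (hS : ∀ k, k ∈ S → -k ∈ S) (c : FourierSeq)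
    (p : ℝ≥0∞) : eLpNorm (trig S (conjSeq c)) p volume = eLpNorm (trig S c) p volume := by
  refine eLpNorm_congr_norm_ae (Eventually.of_forall fun x => ?_)
  rw [trig_conjSeq hS, Complex.norm_conj]

theorem bracket_pos (k : ℤ) : 0 < bracket k := by unfold bracket; positivity

theorem bracket_neg (k : ℤ) : bracket (-k) = bracket k := by simp [bracket]

theorem flow_mult (s : ℝ) (m : ℤ → ℂ) (c : FourierSeq) :
    flow s (mult m c) = mult m (flow s c) := by
  ext k
  rw [mult, flow_apply, flow_apply, mult]; ring

theorem flow_neg_mult_conjSeq (s : ℝ) (m : ℤ → ℂ) (c : FourierSeq) :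
    flow (-s) (mult m (conjSeq c)) = mult m (conjSeq (flow s c)) := by
  ext k
  rw [flow_apply, mult, mult, conjSeq, conjSeq, flow_apply, map_mul, ← Complex.exp_conj]
  simp only [map_neg, map_mul, Complex.conj_I, Complex.conj_ofReal, map_pow, map_intCast]
  push_cast
  ring_nf

theorem rpow_block_le (γ : ℝ) {μ j : ℕ} (h1 : μ ≤ j) (h2 : j ≤ μ + 2) :
    (2 : ℝ≥0) ^ (-γ * j) ≤ 4 ^ |γ| * 2 ^ (-γ * μ) := by
  rw [show (4 : ℝ≥0) = 2 ^ (2 : ℝ) by norm_num, ← NNReal.rpow_mul,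
    ← NNReal.rpow_add (by norm_num)]
  refine NNReal.rpow_le_rpow_of_exponent_le (by norm_num) ?_
  have h3 : (μ : ℝ) ≤ j := by exact_mod_cast h1
  have h4 : (j : ℝ) ≤ μ + 2 := by exact_mod_cast h2
  nlinarith [neg_abs_le γ, le_abs_self γ]

/-- The pieces of a function in one dyadic block, after a multiplier of bounded variation, in terms
of the projection `Π_{2^μ}` with a nearby index `μ`. -/
theorem exists_eLpNorm_block_le (γ A : ℝ) :
    ∃ D : ℝ≥0, ∀ (m : ℤ → ℂ), (MultBdd 6 (A.toNNReal + A.toNNReal * (4 * 40000)) m) →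
      ∀ (s : ℝ) (c : FourierSeq) (μ j : ℕ), μ ≤ j → j ≤ μ + 2 →
      eLpNorm (trig (block j) (flow s (mult m c))) 6 volume ≤
        ((D * 2 ^ (-γ * μ) : ℝ≥0) : ℝ≥0∞) * torusNorm 6 (dyadic μ (flow s (bessel γ c))) ∧
      eLpNorm (trig (block j) (flow (-s) (mult m (conjSeq c)))) 6 volume ≤
        ((D * 2 ^ (-γ * μ) : ℝ≥0) : ℝ≥0∞) * torusNorm 6 (dyadic μ (flow s (bessel γ c))) := by
  obtain ⟨D, hD⟩ := exists_multBdd_block rieszExponent_six (-γ)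
  refine ⟨(A.toNNReal + A.toNNReal * (4 * 40000)) * D * 4 ^ |γ|, ?_⟩
  intro m hm s c μ j h1 h2
  set u := dyadic μ (flow s (bessel γ c)) with hu
  have hu0 : ∀ k, k ∉ fat μ → u k = 0 := dyadic_eq_zero μ _
  have hfat : ∀ k, k ∈ fat μ → -k ∈ fat μ := by
    intro k hk
    rw [fat, Finset.mem_Icc] at hk ⊢
    omega
  have huk : ∀ k, blk k = j → ((bracket k ^ (-γ) : ℝ) : ℂ) * u k = flow s c k := by
    intro k hk
    rw [hu, dyadic_apply_of_blk (by omega) (by omega), flow_apply, flow_apply, bessel, mult,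
      mul_left_comm, ← mul_assoc ((bracket k ^ (-γ) : ℝ) : ℂ), ← Complex.ofReal_mul,
      ← Real.rpow_add (bracket_pos k)]
    simp
  have hsub : block j ⊆ fat μ := by
    intro k hk
    by_contra hkf
    rw [mem_block] at hk
    have hlt := natAbs_lt_of_blk k
    have hle : 2 ^ (blk k + 1) ≤ 2 ^ (μ + 3) := Nat.pow_le_pow_right (by norm_num) (by omega)
    rw [pow_add 2 μ 3] at hle
    refine hkf ?_
    rw [fat, Finset.mem_Icc]
    have h5 : k.natAbs < 8 * 2 ^ μ := by omega
    zify at h5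
    exact ⟨by linarith [neg_abs_le k], by linarith [le_abs_self k]⟩
  have hB := hm.mul (hD j)
  have key : ∀ (c' u' : FourierSeq), (∀ k, blk k = j → ((bracket k ^ (-γ) : ℝ) : ℂ) * u' k = c' k) →
      eLpNorm (trig (fat μ) u') 6 volume = torusNorm 6 u →
      eLpNorm (trig (block j) (mult m c')) 6 volume ≤
        (((A.toNNReal + A.toNNReal * (4 * 40000)) * D * 4 ^ |γ| * 2 ^ (-γ * μ) : ℝ≥0) : ℝ≥0∞) *
          torusNorm 6 u := by
    intro c' u' hc' hu'
    have e1 : trig (block j) (mult m c') = trig (fat μ) (mult (fun k => m k *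
        (if blk k = j then ((bracket k ^ (-γ) : ℝ) : ℂ) else 0)) u') := by
      rw [trig_congr (d := mult (fun k => m k *
        (if blk k = j then ((bracket k ^ (-γ) : ℝ) : ℂ) else 0)) u')]
      · refine trig_subset hsub fun k _ hk => ?_
        rw [mult, if_neg fun h => hk (mem_block.2 h), mul_zero, zero_mul]
      · intro k hk
        rw [mem_block] at hk
        rw [mult, mult, if_pos hk, ← hc' k hk, mul_assoc]
    rw [e1, ← hu']
    refine (hB (fat μ) u').trans (mul_le_mul' (ENNReal.coe_le_coe.2 ?_) (le_of_eq (by norm_num)))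
    calc _ = (A.toNNReal + A.toNNReal * (4 * 40000)) * D * 2 ^ (-γ * j) := by ring
      _ ≤ (A.toNNReal + A.toNNReal * (4 * 40000)) * D * (4 ^ |γ| * 2 ^ (-γ * μ)) := by
          gcongr; exact rpow_block_le γ h1 h2
      _ = _ := by ring
  have hT := torusNorm_trig (p := 6) (by norm_num) hu0
  refine ⟨?_, ?_⟩
  · rw [flow_mult]
    exact key _ u huk hT.symm
  · rw [flow_neg_mult_conjSeq]
    refine key _ (conjSeq u) (fun k hk => ?_) ?_
    · have hk' : blk (-k) = j := by rwa [blk, Int.natAbs_neg]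
      rw [conjSeq, conjSeq, ← huk _ hk', map_mul, Complex.conj_ofReal, bracket_neg]
    · rw [eLpNorm_trig_conjSeq hfat, hT]

theorem cut_enorm_eq (j : ℕ) (c : FourierSeq) :
    cut j (fun k => ‖c k‖ₑ) = fun k => ‖fourierCoeff (trig (block j) c) k‖ₑ := by
  ext k
  rw [cut, fourierCoeff_trig]
  simp only [mem_block]
  split_ifs <;> simp

theorem blockNorm_le_eLpNorm (j : ℕ) (c : FourierSeq) (s : ℝ) :
    blockNorm j c ≤ eLpNorm (trig (block j) (flow s c)) 6 volume := by
  refine le_trans (le_of_eq ?_)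
    (l2_fourierCoeff_le (q := 6) (by norm_num) (memLp_continuousMap _ _))
  rw [← cut_enorm_eq]
  simp only [enorm_flow]
  rfl

/-- In the resonant term the sum over `k₂ = k₁` is bounded by the Cauchy–Schwarz inequality, and
`k₃ = k` leaves one factor free. -/
theorem l2_triSum_resonantKernel₃_le {A : ℝ} {m : Fin 4 → ℤ → ℂ} (hm : ∀ i, IsBVSymbol A (m i))
    (j₁ j₂ j₃ : ℕ) (c : FourierSeq) :
    l2 (fun k => ‖triSum (resonantKernel₃ m) (block j₁) (block j₂) (block j₃) c k‖ₑ) ≤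
      ENNReal.ofReal A ^ 4 * (blockNorm j₁ c * blockNorm j₂ c * blockNorm j₃ c) := by
  have hc : ∀ z : ℂ, ‖(starRingEnd ℂ) z‖ₑ = ‖z‖ₑ := fun z => by
    rw [← ofReal_norm, Complex.norm_conj, ofReal_norm]
  set x : ℤ → ℝ≥0∞ := fun k => ‖c k‖ₑ with hx
  have hpt : ∀ k, ‖triSum (resonantKernel₃ m) (block j₁) (block j₂) (block j₃) c k‖ₑ ≤
      ENNReal.ofReal A ^ 4 * (blockNorm j₁ c * blockNorm j₂ c) * cut j₃ x k := by
    intro k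
    calc _ ≤ ∑ k₁ ∈ block j₁, ∑ k₂ ∈ block j₂, ∑ k₃ ∈ block j₃,
          (if k₃ = k then if k₂ = k₁ then
            ENNReal.ofReal A ^ 4 * (x k₁ * x k₂ * x k₃) else 0 else 0) := by
          refine (enorm_sum_le _ _).trans (Finset.sum_le_sum fun k₁ _ => (enorm_sum_le _ _).trans
            (Finset.sum_le_sum fun k₂ _ => (enorm_sum_le _ _).trans
              (Finset.sum_le_sum fun k₃ _ => ?_)))
          by_cases hk : k + k₁ = k₂ + k₃
          · by_cases h2 : k₂ = k₁
            · rw [if_pos hk, if_pos (by omega), if_pos h2, resonantKernel₃, if_pos h2, enorm_mul,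
                enorm_mul, enorm_mul, hc]
              gcongr
              exact enorm_symbolProd_le hm _ _ _ _
            · simp [resonantKernel₃, h2]
          · simp [hk]
      _ = ENNReal.ofReal A ^ 4 * (∑ k₁ ∈ block j₁, ∑ k₂ ∈ block j₂,
            if k₂ = k₁ then x k₁ * x k₂ else 0) * cut j₃ x k := by
          simp only [Finset.mul_sum, Finset.sum_mul]
          refine Finset.sum_congr rfl fun k₁ _ => Finset.sum_congr rfl fun k₂ _ => ?_
          rw [Finset.sum_ite_eq']
          simp only [mem_block, cut]
          split_ifs
          · ring
          all_goals simp
      _ ≤ ENNReal.ofReal A ^ 4 * (∑' k₁, cut j₁ x k₁ * cut j₂ x k₁) * cut j₃ x k := by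
          gcongr
          rw [sum_block_eq_tsum]
          refine ENNReal.tsum_le_tsum fun k₁ => ?_
          simp only [Finset.sum_ite_eq', mem_block, cut]
          split_ifs <;> simp
      _ ≤ _ := by
          gcongr
          exact tsum_mul_le_l2 _ _
  refine (l2_mono hpt).trans_eq ?_
  rw [l2_const_mul]
  simp only [mul_assoc]
  rfl

/-- The two resonant terms are exchanged with the symbols `m 2` and `m 3`. -/
theorem triSum_resonantKernel₂ (m : Fin 4 → ℤ → ℂ) (S₁ S₂ S₃ : Finset ℤ) (c : FourierSeq) (k : ℤ) :
    triSum (resonantKernel₂ m) S₁ S₂ S₃ c k =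
      triSum (resonantKernel₃ ![m 0, m 1, m 3, m 2]) S₁ S₃ S₂ c k := by
  refine Finset.sum_congr rfl fun k₁ _ => ?_
  rw [Finset.sum_comm]
  refine Finset.sum_congr rfl fun k₃ _ => Finset.sum_congr rfl fun k₂ _ => ?_
  rw [add_comm k₂ k₃]
  have : resonantKernel₂ m k k₁ k₂ k₃ = resonantKernel₃ ![m 0, m 1, m 3, m 2] k k₁ k₃ k₂ := by
    simp only [resonantKernel₂, resonantKernel₃, symbolProd]
    refine if_congr Iff.rfl ?_ rfl
    simp
    ring
  rw [this, mul_right_comm ((starRingEnd ℂ) (c k₁))]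

theorem l2_triSum_resonantKernel₂_le {A : ℝ} {m : Fin 4 → ℤ → ℂ} (hm : ∀ i, IsBVSymbol A (m i))
    (j₁ j₂ j₃ : ℕ) (c : FourierSeq) :
    l2 (fun k => ‖triSum (resonantKernel₂ m) (block j₁) (block j₂) (block j₃) c k‖ₑ) ≤
      ENNReal.ofReal A ^ 4 * (blockNorm j₁ c * blockNorm j₂ c * blockNorm j₃ c) := by
  simp only [triSum_resonantKernel₂]
  refine (l2_triSum_resonantKernel₃_le (A := A) (fun i => ?_) j₁ j₃ j₂ c).trans_eq (by ring)
  fin_cases i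
  exacts [hm 0, hm 1, hm 3, hm 2]

theorem l2_triSum_cubicKernel_le {A : ℝ} {m : Fin 4 → ℤ → ℂ} (hm : ∀ i, IsBVSymbol A (m i))
    (s : ℝ) (j₁ j₂ j₃ : ℕ) (c : FourierSeq) :
    l2 (fun k => ‖triSum (cubicKernel m s) (block j₁) (block j₂) (block j₃) c k‖ₑ) ≤
      ENNReal.ofReal A * (eLpNorm (trig (block j₁) (flow (-s) (mult (m 1) (conjSeq c)))) 6 volume *
        eLpNorm (trig (block j₂) (flow s (mult (m 2) c))) 6 volume *
        eLpNorm (trig (block j₃) (flow s (mult (m 3) c))) 6 volume) := by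
  set g₁ := trig (block j₁) (flow (-s) (mult (m 1) (conjSeq c)))
  set g₂ := trig (block j₂) (flow s (mult (m 2) c))
  set g₃ := trig (block j₃) (flow s (mult (m 3) c))
  have h1 : ∀ k, ‖triSum (cubicKernel m s) (block j₁) (block j₂) (block j₃) c k‖ₑ ≤
      ENNReal.ofReal A * ‖fourierCoeff (fun x => g₁ x * g₂ x * g₃ x) k‖ₑ := by
    intro k
    rw [triSum_cubicKernel m s _ _ neg_mem_block, enorm_flow, mult, enorm_mul]
    gcongr
    exact (hm 0).enorm_le k
  refine (l2_mono h1).trans ?_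
  rw [l2_const_mul]
  gcongr
  refine (l2_fourierCoeff_le le_rfl (memLp_continuousMap (g₁ * g₂ * g₃) 2)).trans ?_
  exact eLpNorm_mul_three_le g₁.continuous.aestronglyMeasurable g₂.continuous.aestronglyMeasurable
    g₃.continuous.aestronglyMeasurable

/-- The contribution of three comparable blocks to the trilinear operator. -/
theorem exists_l2_integral_triSum_le_of_comparable (γ A : ℝ) :
    ∃ D : ℝ≥0, ∀ (m : Fin 4 → ℤ → ℂ), (∀ i, IsBVSymbol A (m i)) →
      ∀ (t₀ t₁ : ℝ), t₀ ≤ t₁ → ∀ (v w : ℝ → FourierSeq), HasTimeDeriv t₀ t₁ v w →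
      ∀ j₁ j₂ j₃ : ℕ, Comparable j₁ j₂ j₃ →
      l2 (fun k => ‖∫ s in t₀..t₁,
        triSum (fullKernel m s) (block j₁) (block j₂) (block j₃) (v s) k‖ₑ) ≤
      D * (ENNReal.ofReal (2 ^ (-3 * γ * (min j₁ (min j₂ j₃) : ℕ))) *
        mixedNorm 3 6 t₀ t₁
          (fun s => dyadic (min j₁ (min j₂ j₃)) (flow s (bessel γ (v s)))) ^ 3) := by
  obtain ⟨D, hD⟩ := exists_eLpNorm_block_le γ A
  obtain ⟨D', hD'⟩ := exists_eLpNorm_block_le γ 1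
  refine ⟨A.toNNReal * D ^ 3 + 2 * (A.toNNReal ^ 4 * D' ^ 3), ?_⟩
  intro m hm t₀ t₁ ht v w h j₁ j₂ j₃ hj
  set μ := min j₁ (min j₂ j₃) with hμ
  set Y : ℝ → ℝ≥0∞ := fun s => torusNorm 6 (dyadic μ (flow s (bessel γ (v s)))) with hY
  have hmB := fun i => (hm i).multBdd rieszExponent_six
  have hone : MultBdd 6 ((1 : ℝ).toNNReal + (1 : ℝ).toNNReal * (4 * 40000)) (fun _ => 1) :=
    multBdd_const 6 (by simp)
  have hb : ∀ (s : ℝ) j, μ ≤ j → j ≤ μ + 2 →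
      blockNorm j (v s) ≤ ((D' * 2 ^ (-γ * μ) : ℝ≥0) : ℝ≥0∞) * Y s := by
    intro s j h1 h2
    refine (blockNorm_le_eLpNorm j (v s) s).trans ?_
    have := (hD' _ hone s (v s) μ j h1 h2).1
    rwa [show mult (fun _ => 1) (v s) = v s by ext k; simp [mult]] at this
  have h₁ : μ ≤ j₁ ∧ j₁ ≤ μ + 2 := by unfold Comparable at hj; omega
  have h₂ : μ ≤ j₂ ∧ j₂ ≤ μ + 2 := by unfold Comparable at hj; omega
  have h₃ : μ ≤ j₃ ∧ j₃ ≤ μ + 2 := by unfold Comparable at hj; omega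
  set E : ℝ≥0 := (A.toNNReal * D ^ 3 + 2 * (A.toNNReal ^ 4 * D' ^ 3)) with hE
  set p : ℝ≥0 := 2 ^ (-γ * μ) with hp
  have hp3 : ENNReal.ofReal (2 ^ (-3 * γ * (μ : ℕ))) = ((p ^ 3 : ℝ≥0) : ℝ≥0∞) := by
    rw [← ENNReal.ofReal_coe_nnreal]
    congr 1
    rw [hp]
    push_cast
    rw [← Real.rpow_natCast, ← Real.rpow_mul (by norm_num)]
    congr 1
    push_cast
    ring
  have hres : ENNReal.ofReal A ^ 4 *
      (((D' * p : ℝ≥0) : ℝ≥0∞) ^ 3) = ((A.toNNReal ^ 4 * D' ^ 3 * p ^ 3 : ℝ≥0) : ℝ≥0∞) := by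
    rw [show ENNReal.ofReal A = ((A.toNNReal : ℝ≥0) : ℝ≥0∞) from rfl]
    push_cast
    ring
  have hpt : ∀ s, l2 (fun k => ‖triSum (fullKernel m s) (block j₁) (block j₂) (block j₃) (v s) k‖ₑ)
      ≤ ((E * p ^ 3 : ℝ≥0) : ℝ≥0∞) * Y s ^ 3 := by
    intro s
    have hbbb : blockNorm j₁ (v s) * blockNorm j₂ (v s) * blockNorm j₃ (v s) ≤
        (((D' * p : ℝ≥0) : ℝ≥0∞) * Y s) * (((D' * p : ℝ≥0) : ℝ≥0∞) * Y s) *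
          (((D' * p : ℝ≥0) : ℝ≥0∞) * Y s) :=
      mul_le_mul' (mul_le_mul' (hb s j₁ h₁.1 h₁.2) (hb s j₂ h₂.1 h₂.2)) (hb s j₃ h₃.1 h₃.2)
    have e1 := (l2_triSum_cubicKernel_le hm s j₁ j₂ j₃ (v s)).trans (mul_le_mul_right
      (mul_le_mul' (mul_le_mul' (hD _ (hmB 1) s (v s) μ j₁ h₁.1 h₁.2).2
        (hD _ (hmB 2) s (v s) μ j₂ h₂.1 h₂.2).1) (hD _ (hmB 3) s (v s) μ j₃ h₃.1 h₃.2).1) _)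
    have e2 := (l2_triSum_resonantKernel₃_le hm j₁ j₂ j₃ (v s)).trans (mul_le_mul_right hbbb _)
    have e3 := (l2_triSum_resonantKernel₂_le hm j₁ j₂ j₃ (v s)).trans (mul_le_mul_right hbbb _)
    have e4 : ∀ k, ‖triSum (fullKernel m s) (block j₁) (block j₂) (block j₃) (v s) k‖ₑ ≤
        ‖triSum (cubicKernel m s) (block j₁) (block j₂) (block j₃) (v s) k‖ₑ +
        ‖triSum (resonantKernel₃ m) (block j₁) (block j₂) (block j₃) (v s) k‖ₑ +
        ‖triSum (resonantKernel₂ m) (block j₁) (block j₂) (block j₃) (v s) k‖ₑ := by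
      intro k
      rw [triSum_fullKernel]
      exact enorm_sub_le.trans (add_le_add_left enorm_sub_le _)
    refine (l2_mono e4).trans (((l2_add_le _ _).trans (add_le_add_left (l2_add_le _ _) _)).trans ?_)
    refine (add_le_add (add_le_add e1 e2) e3).trans_eq ?_
    rw [show ENNReal.ofReal A = ((A.toNNReal : ℝ≥0) : ℝ≥0∞) from rfl, hE]
    push_cast
    ring
  have hcont := fun k => (h.continuousOn_triSum ht (K := fullKernel m) (continuous_fullKernel m)
    (block j₁) (block j₂) (block j₃) k)
  have hmeas : ∀ k, AEMeasurable (fun s => ‖triSum (fullKernel m s) (block j₁) (block j₂)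
      (block j₃) (v s) k‖ₑ) (volume.restrict (Set.Icc t₀ t₁)) := fun k =>
    ((hcont k).aestronglyMeasurable measurableSet_Icc).enorm
  have hint : ∀ k, ‖∫ s in t₀..t₁,
      triSum (fullKernel m s) (block j₁) (block j₂) (block j₃) (v s) k‖ₑ ≤ ∫⁻ s in Set.Icc t₀ t₁,
      ‖triSum (fullKernel m s) (block j₁) (block j₂) (block j₃) (v s) k‖ₑ := by
    intro k
    rw [intervalIntegral.integral_of_le ht]
    exact (enorm_integral_le_lintegral_enorm _).trans (lintegral_mono_set Set.Ioc_subset_Icc_self)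
  refine (l2_mono hint).trans ((l2_lintegral_le hmeas).trans ((lintegral_mono hpt).trans_eq ?_))
  rw [lintegral_const_mul' _ _ ENNReal.coe_ne_top, hp3, mixedNorm, ← ENNReal.rpow_natCast,
    ← ENNReal.rpow_mul]
  simp only [← ENNReal.rpow_natCast, hY]
  norm_num
  ring

/-! ### Sharp truncations in `L^q` -/

theorem tendsto_low : Tendsto low atTop atTop := by
  refine tendsto_atTop_finset_of_monotone (fun a b hab k hk => ?_) fun k => ⟨blk k, ?_⟩
  · rw [mem_low] at hk ⊢; exact hk.trans hab
  · rw [mem_low]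

theorem memLp_sub_trig {q : ℝ≥0∞} {f : Torus → ℂ} (hf : MemLp f q volume) (S : Finset ℤ)
    (c : FourierSeq) : MemLp (fun x => f x - trig S c x) q volume :=
  hf.sub (memLp_continuousMap _ q)

theorem integrable_haar_of_memLp {q : ℝ≥0∞} (hq : 1 ≤ q) {f : Torus → ℂ} (hf : MemLp f q volume) :
    Integrable f (AddCircle.haarAddCircle : Measure Torus) :=
  (memLp_haarAddCircle_iff.2 hf).integrable hq

theorem fourierCoeff_sub {f g : Torus → ℂ} (hf : Integrable f AddCircle.haarAddCircle)
    (hg : Integrable g AddCircle.haarAddCircle) (k : ℤ) :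
    fourierCoeff (fun x => f x - g x) k = fourierCoeff f k - fourierCoeff g k := by
  have h1 : (fun x => f x - g x) = f + (-1 : ℂ) • g := by ext x; simp [sub_eq_add_neg]
  rw [h1, fourierCoeff.add hf (hg.smul _), Pi.add_apply, fourierCoeff.const_smul]
  simp [sub_eq_add_neg]

/-- Trigonometric polynomials are dense in `L^q`. -/
theorem exists_trig_eLpNorm_sub_le {q : ℝ≥0∞} [Fact (1 ≤ q)] (hq : q ≠ ∞) {f : Torus → ℂ}
    (hf : MemLp f q volume) {δ : ℝ≥0∞} (hδ : δ ≠ 0) :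
    ∃ (S : Finset ℤ) (d : FourierSeq), eLpNorm (fun x => f x - trig S d x) q volume ≤ δ := by
  have hf' := memLp_haarAddCircle_iff.2 hf
  set K : ℝ≥0∞ := ENNReal.ofReal (2 * π) ^ (1 / q).toReal with hK
  have hKtop : K ≠ ∞ := ENNReal.rpow_ne_top_of_nonneg (by positivity) ENNReal.ofReal_ne_top
  have hδK : δ / K ≠ 0 := ENNReal.div_ne_zero.2 ⟨hδ, hKtop⟩
  have hmem : hf'.toLp f ∈ closure ((Submodule.span ℂ (Set.range (@fourierLp (2 * π) _ q _)) :
      Submodule ℂ _) : Set (Lp ℂ q (AddCircle.haarAddCircle : Measure Torus))) := by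
    rw [← Submodule.topologicalClosure_coe, span_fourierLp_closure_eq_top hq]; trivial
  obtain ⟨g, hg, hgd⟩ := EMetric.mem_closure_iff.1 hmem (δ / K) (pos_iff_ne_zero.2 hδK)
  obtain ⟨d, rfl⟩ := (Finsupp.mem_span_range_iff_exists_finsupp).1 hg
  refine ⟨d.support, d, ?_⟩
  have hae : (d.sum fun i a => a • fourierLp q i : Lp ℂ q (AddCircle.haarAddCircle : Measure Torus))
      =ᵐ[AddCircle.haarAddCircle] trig d.support d := by
    have : (d.sum fun i a => a • fourierLp q i :
        Lp ℂ q (AddCircle.haarAddCircle : Measure Torus)) =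
        ContinuousMap.toLp q AddCircle.haarAddCircle ℂ (trig d.support d) := by
      rw [trig, map_sum]
      simp [Finsupp.sum]
    rw [this]
    exact ContinuousMap.coeFn_toLp _ _
  rw [Lp.edist_def] at hgd
  rw [AddCircle.volume_eq_smul_haarAddCircle, eLpNorm_smul_measure_of_ne_top hq, smul_eq_mul, ← hK]
  refine (mul_le_mul_right ?_ K).trans (ENNReal.mul_div_le (a := K) (b := δ))
  refine le_trans (le_of_eq (eLpNorm_congr_ae ?_)) hgd.le
  filter_upwards [hf'.coeFn_toLp, hae] with x h1 h2
  rw [Pi.sub_apply, h1, h2]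

theorem multBdd_low {q : ℕ} {C : ℝ≥0} (hq : RieszExponent q C) (N : ℕ) :
    MultBdd q (4 * C * (1 + 4 * C)) (fun k => if k ∈ low N then 1 else 0) := by
  refine (multBdd_Ioc hq (-(2 ^ (N + 1))) (2 ^ (N + 1) - 1)).congr fun k => ?_
  refine if_congr ?_ rfl rfl
  rw [low, Finset.mem_Ioo]
  omega

/-- Sharp truncations are bounded on `L^q`. -/
theorem eLpNorm_trig_low_le {q : ℕ} {C : ℝ≥0} (hq : RieszExponent q C) {f : Torus → ℂ}
    (hf : MemLp f q volume) {c : FourierSeq} (hc : ∀ k, fourierCoeff f k = c k) (N : ℕ) :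
    eLpNorm (trig (low N) c) q volume ≤
      ((4 * C * (1 + 4 * C) : ℝ≥0) : ℝ≥0∞) * eLpNorm f q volume := by
  have hq1 := one_le_of_rieszExponent hq
  have : Fact ((1 : ℝ≥0∞) ≤ q) := ⟨hq1⟩
  set B : ℝ≥0∞ := ((4 * C * (1 + 4 * C) : ℝ≥0) : ℝ≥0∞) with hB
  set V : ℝ≥0∞ := eLpNorm (fun _ : Torus => (1 : ℂ)) q volume with hV
  have hVtop : V ≠ ∞ := (memLp_const (1 : ℂ)).eLpNorm_ne_top
  -- The truncation is bounded on trigonometric polynomials that approximate `f`; the error is a sum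
  -- over the fixed finite set `low N` of coefficients of size at most `δ`.
  have key : ∀ δ : ℝ≥0∞, δ ≠ 0 → eLpNorm (trig (low N) c) q volume ≤
      B * (eLpNorm f q volume + δ) + (low N).card * (δ * V) := by
    intro δ hδ
    obtain ⟨S, d, hd⟩ := exists_trig_eLpNorm_sub_le (by simp) hf hδ
    set d' : FourierSeq := fun k => if k ∈ S then d k else 0 with hd'
    have hcoef : ∀ k, ‖c k - d' k‖ₑ ≤ δ := by
      intro k
      have h1 := enorm_fourierCoeff_le_haar hq1
        (memLp_haarAddCircle_iff.2 (memLp_sub_trig hf S d)).1 k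
      rw [fourierCoeff_sub (integrable_haar_of_memLp hq1 hf) (integrable_haar _), hc,
        fourierCoeff_trig] at h1
      exact h1.trans ((eLpNorm_mono_measure _ haar_le_volume).trans hd)
    have e1 : (trig (low N) c : Torus → ℂ) = (trig S (mult (fun k => if k ∈ low N then 1 else 0) d)
        : Torus → ℂ) + ∑ k ∈ low N, fun x => (c k - d' k) * fourier k x := by
      ext x
      rw [Pi.add_apply, Finset.sum_apply, trig_apply, ← trig_filter, trig_apply]
      have : ∑ k ∈ S.filter (fun k => k ∈ low N), d k * fourier k x =
          ∑ k ∈ low N, d' k * fourier k x := by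
        rw [Finset.filter_mem_eq_inter, Finset.inter_comm, ← Finset.filter_mem_eq_inter,
          Finset.sum_filter]
        exact Finset.sum_congr rfl fun k _ => by by_cases h : k ∈ S <;> simp [hd', h]
      rw [this, ← Finset.sum_add_distrib]
      exact Finset.sum_congr rfl fun k _ => by ring
    have e2 : eLpNorm (∑ k ∈ low N, fun x : Torus => (c k - d' k) * fourier k x) q volume ≤
        (low N).card * (δ * V) := by
      refine (eLpNorm_sum_le (fun k _ => Continuous.aestronglyMeasurable (by fun_prop)) hq1).trans ?_
      rw [← nsmul_eq_mul, ← Finset.sum_const]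
      refine Finset.sum_le_sum fun k _ => ?_
      have : (fun x : Torus => (c k - d' k) * fourier k x) =
          (c k - d' k) • fun x : Torus => (fourier k x : ℂ) := rfl
      rw [this, eLpNorm_const_smul]
      refine mul_le_mul' (hcoef k) (le_of_eq (eLpNorm_congr_enorm_ae
        (Eventually.of_forall fun x => ?_)))
      rw [enorm_fourier]; simp
    have e3 : eLpNorm (trig S d) q volume ≤ eLpNorm f q volume + δ := by
      have : (trig S d : Torus → ℂ) = f - fun x => f x - trig S d x := by ext x; simp
      rw [this]
      refine (eLpNorm_sub_le hf.1 (memLp_sub_trig hf S d).1 hq1).trans ?_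
      gcongr
    rw [e1]
    refine (eLpNorm_add_le (ContinuousMap.continuous _).aestronglyMeasurable
      (Finset.aestronglyMeasurable_sum _ fun k _ =>
        Continuous.aestronglyMeasurable (by fun_prop)) hq1).trans ?_
    refine add_le_add ((multBdd_low hq N S d).trans ?_) e2
    gcongr
  have hlim : Tendsto (fun δ : ℝ≥0∞ => B * (eLpNorm f q volume + δ) + (low N).card * (δ * V))
      (𝓝[>] 0) (𝓝 (B * (eLpNorm f q volume + 0) + (low N).card * (0 * V))) := by
    refine Tendsto.mono_left ?_ nhdsWithin_le_nhds
    refine Tendsto.add ?_ ?_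
    · exact ENNReal.Tendsto.const_mul (tendsto_const_nhds.add tendsto_id)
        (Or.inr ENNReal.coe_ne_top)
    · refine ENNReal.Tendsto.const_mul ?_ (Or.inr (by simp))
      exact ENNReal.Tendsto.mul_const tendsto_id (Or.inr hVtop)
  rw [add_zero, zero_mul, mul_zero, add_zero] at hlim
  refine ge_of_tendsto hlim ?_
  filter_upwards [self_mem_nhdsWithin] with δ hδ
  exact key δ (ne_of_gt hδ)

/-- Fourier series converge in `L²`. -/
theorem tendsto_eLpNorm_sub_trig_low {f : Torus → ℂ} (hf : MemLp f 2 volume) {c : FourierSeq}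
    (hc : ∀ k, fourierCoeff f k = c k) :
    Tendsto (fun N => eLpNorm (fun x => f x - trig (low N) c x) 2 volume) atTop (𝓝 0) := by
  have hfin : ∑' k, ‖c k‖ₑ ^ 2 ≠ ∞ := by
    have h1 := eLpNorm_two_haar_sq hf
    simp only [hc] at h1
    rw [← h1]
    exact ENNReal.pow_ne_top (memLp_haarAddCircle_iff.2 hf).eLpNorm_ne_top
  have h1 : ∀ N, eLpNorm (fun x => f x - trig (low N) c x) 2 volume =
      (ENNReal.ofReal (2 * π) * ∑' k : {k // k ∉ low N}, ‖c k‖ₑ ^ 2) ^ (1 / 2 : ℝ) := by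
    intro N
    have h2 := eLpNorm_two_sq (memLp_sub_trig hf (low N) c)
    have h3 : ∀ k, fourierCoeff (fun x => f x - trig (low N) c x) k =
        if k ∈ low N then 0 else c k := by
      intro k
      rw [fourierCoeff_sub (integrable_haar_of_memLp (by norm_num) hf) (integrable_haar _), hc,
        fourierCoeff_trig]
      split_ifs <;> simp
    simp only [h3] at h2
    have h4 : ∑' k, ‖(if k ∈ low N then 0 else c k : ℂ)‖ₑ ^ 2 =
        ∑' k : {k // k ∉ low N}, ‖c k‖ₑ ^ 2 := by
      have := tsum_subtype {k | k ∉ low N} fun k => ‖c k‖ₑ ^ 2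
      refine Eq.trans (tsum_congr fun k => ?_) this.symm
      by_cases hk : k ∈ low N <;> simp [Set.indicator, hk]
    rw [← h4, ← h2, ← ENNReal.rpow_natCast, ← ENNReal.rpow_mul]
    norm_num
  simp only [h1]
  have h5 := (ENNReal.tendsto_tsum_compl_atTop_zero hfin).comp tendsto_low
  have h6 := ENNReal.Tendsto.const_mul (a := ENNReal.ofReal (2 * π)) h5
    (Or.inr ENNReal.ofReal_ne_top)
  have h7 := h6.ennrpow_const (1 / 2 : ℝ)
  simpa using h7

/-- If the truncations of `c` are bounded in `L^q` along a subsequence, then `c` is the sequence of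
Fourier coefficients of a function in `L^q`. -/
theorem exists_memLp_of_frequently {q : ℝ≥0∞} (hq : 2 ≤ q) {c : FourierSeq} {B : ℝ≥0∞}
    (hB : B ≠ ∞) (h : ∃ᶠ N in atTop, eLpNorm (trig (low N) c) q volume ≤ B) :
    ∃ f : Torus → ℂ, MemLp f q volume ∧ (∀ k, fourierCoeff f k = c k) ∧ eLpNorm f q volume ≤ B := by
  have hsum : ∑' k, ‖c k‖ₑ ^ 2 ≤ B ^ 2 := by
    rw [ENNReal.tsum_eq_iSup_sum]
    refine iSup_le fun T => ?_
    obtain ⟨N, hN1, hN2⟩ := (h.and_eventually (tendsto_low.eventually_ge_atTop T)).exists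
    have h1 := (l2_fourierCoeff_le hq (memLp_continuousMap (trig (low N) c) q)).trans hN1
    rw [l2_le_iff] at h1
    refine le_trans ?_ h1
    refine le_trans (Finset.sum_le_sum fun k hk => ?_) (ENNReal.sum_le_tsum T)
    rw [fourierCoeff_trig, if_pos (hN2 hk)]
  obtain ⟨f, hf, hfc⟩ := exists_memLp_of_summable (summable_of_tsum_enorm_sq
    (ne_top_of_le_ne_top (ENNReal.pow_ne_top hB) hsum))
  obtain ⟨φ, hφ, hφB⟩ := extraction_of_frequently_atTop h
  have hlim := (tendsto_eLpNorm_sub_trig_low hf hfc).comp hφ.tendsto_atTop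
  have hmeas : TendstoInMeasure volume (fun n => (trig (low (φ n)) c : Torus → ℂ)) atTop f := by
    refine tendstoInMeasure_of_tendsto_eLpNorm (p := 2) (by norm_num)
      (fun n => (ContinuousMap.continuous _).aestronglyMeasurable) hf.1 ?_
    refine hlim.congr fun n => ?_
    exact eLpNorm_sub_comm (f := f) (g := trig (low (φ n)) c) 2 volume
  obtain ⟨ns, _, hns⟩ := hmeas.exists_seq_tendsto_ae
  have hle : eLpNorm f q volume ≤ B :=
    Lp.eLpNorm_le_of_ae_tendsto (u := atTop) (f := fun n => (trig (low (φ (ns n))) c : Torus → ℂ))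
      (Eventually.of_forall fun n => hφB (ns n))
      (fun n => (ContinuousMap.continuous _).aestronglyMeasurable) hns
  exact ⟨f, ⟨hf.1, hle.trans_lt hB.lt_top⟩, hfc, hle⟩

/-- The Fatou property of the `L^q` norm along the sharp truncations. -/
theorem torusNorm_le_liminf {q : ℝ≥0∞} (hq : 2 ≤ q) (c : FourierSeq) :
    torusNorm q c ≤ liminf (fun N => eLpNorm (trig (low N) c) q volume) atTop := by
  refine le_of_forall_gt fun B hB => ?_
  obtain ⟨B', hB1, hB2⟩ := exists_between hB
  obtain ⟨f, hf, hfc, hfB⟩ := exists_memLp_of_frequently hq hB2.ne_top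
    ((frequently_lt_of_liminf_lt (by isBoundedDefault) hB1).mono fun _ h => h.le)
  rw [torusNorm_eq hq hf hfc]
  exact hfB.trans_lt hB2

/-! ### Zygmund's space-time estimate -/

theorem integral_fourier (n : ℤ) :
    ∫ x : Torus, (fourier n x : ℂ) ∂AddCircle.haarAddCircle = if n = 0 then 1 else 0 := by
  have h := congrFun (fourierCoeff_fourier (T := 2 * π) n) 0
  rw [fourierCoeff] at h
  simpa [Pi.single_apply, eq_comm] using h

/-- The quadrilateral `k₁ + k₂ = k₃ + k₄`, `k₁² + k₂² = k₃² + k₄²` is degenerate. -/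
theorem eq_or_eq_of_add_eq_of_sq_add_sq_eq {k₁ k₂ k₃ k₄ : ℤ} (h1 : k₁ + k₂ = k₃ + k₄)
    (h2 : k₁ ^ 2 + k₂ ^ 2 = k₃ ^ 2 + k₄ ^ 2) : k₃ = k₁ ∧ k₄ = k₂ ∨ k₃ = k₂ ∧ k₄ = k₁ := by
  have h3 : (k₃ - k₁) * (k₃ - k₂) = 0 := by
    obtain rfl : k₄ = k₁ + k₂ - k₃ := by omega
    linarith
  rcases mul_eq_zero.1 h3 with h | h
  · left; omega
  · right; omega

/-- Zygmund's inequality on the torus in space and time. -/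
theorem lintegral_fourier_sq_pow_four_le (S : Finset ℤ) (c : FourierSeq) :
    ∫⁻ σ : Torus, ∫⁻ x : Torus, ‖∑ k ∈ S, c k * fourier (-k ^ 2) σ * fourier k x‖ₑ ^ 4
      ∂AddCircle.haarAddCircle ∂AddCircle.haarAddCircle ≤ 2 * (∑ k ∈ S, ‖c k‖ₑ ^ 2) ^ 2 := by
  set F : Torus → Torus → ℂ := fun σ x => ∑ k ∈ S, c k * fourier (-k ^ 2) σ * fourier k x with hF
  set Q := S ×ˢ S ×ˢ S ×ˢ S
  set a : ℤ × ℤ × ℤ × ℤ → ℂ := fun p =>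
    c p.1 * c p.2.1 * (starRingEnd ℂ) (c p.2.2.1) * (starRingEnd ℂ) (c p.2.2.2) with ha
  set n₁ : ℤ × ℤ × ℤ × ℤ → ℤ := fun p => p.1 + p.2.1 - p.2.2.1 - p.2.2.2
  set n₂ : ℤ × ℤ × ℤ × ℤ → ℤ := fun p => -p.1 ^ 2 - p.2.1 ^ 2 + p.2.2.1 ^ 2 + p.2.2.2 ^ 2
  -- `|F|⁴` is a sum over quadruples; integration keeps those with `n₁ = n₂ = 0`, which are the
  -- degenerate ones.
  have hexp : ∀ σ x, ((‖F σ x‖ ^ 4 : ℝ) : ℂ) =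
      ∑ p ∈ Q, a p * fourier (n₂ p) σ * fourier (n₁ p) x := by
    intro σ x
    have h1 : ((‖F σ x‖ ^ 4 : ℝ) : ℂ) =
        (starRingEnd ℂ) (F σ x) * (starRingEnd ℂ) (F σ x) * F σ x * F σ x := by
      have := Complex.mul_conj' (F σ x)
      push_cast
      calc _ = ((‖F σ x‖ : ℂ) ^ 2) ^ 2 := by ring
        _ = _ := by rw [← this]; ring
    rw [h1]
    simp only [hF, map_sum, Q, Finset.sum_product, Finset.sum_mul, Finset.mul_sum]
    refine Finset.sum_congr rfl fun k₁ _ => ?_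
    refine Finset.sum_congr rfl fun k₂ _ => ?_
    refine Finset.sum_congr rfl fun k₃ _ => ?_
    refine Finset.sum_congr rfl fun k₄ _ => ?_
    simp only [a, n₁, n₂, sub_eq_add_neg, fourier_add, fourier_neg, map_mul,
      RingHomCompTriple.comp_apply, RingHom.id_apply]
    ring
  have hint : ∀ σ, ((∫ x, ‖F σ x‖ ^ 4 ∂AddCircle.haarAddCircle : ℝ) : ℂ) =
      ∑ p ∈ Q, a p * fourier (n₂ p) σ * (if n₁ p = 0 then 1 else 0) := by
    intro σ
    rw [← integral_complex_ofReal]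
    simp only [hexp]
    rw [integral_finsetSum _ fun p _ => (integrable_haar (fourier (n₁ p))).const_mul _]
    refine Finset.sum_congr rfl fun p _ => ?_
    rw [integral_const_mul, integral_fourier]
  have hint2 : ((∫ σ, ∫ x, ‖F σ x‖ ^ 4 ∂AddCircle.haarAddCircle ∂AddCircle.haarAddCircle : ℝ) : ℂ) =
      ∑ p ∈ Q, a p * (if n₂ p = 0 then 1 else 0) * (if n₁ p = 0 then 1 else 0) := by
    rw [← integral_complex_ofReal]
    simp only [hint]
    rw [integral_finsetSum _ fun p _ =>
      ((integrable_haar (fourier (n₂ p))).const_mul _).mul_const _]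
    refine Finset.sum_congr rfl fun p _ => ?_
    rw [integral_mul_const, integral_const_mul, integral_fourier]
  have hx : ∀ σ, ∫⁻ x, ‖F σ x‖ₑ ^ 4 ∂AddCircle.haarAddCircle =
      ENNReal.ofReal (∫ x, ‖F σ x‖ ^ 4 ∂AddCircle.haarAddCircle) := by
    intro σ
    have hc : Continuous fun x => ‖F σ x‖ ^ 4 := by fun_prop
    have hi : Integrable (fun x => ‖F σ x‖ ^ 4) AddCircle.haarAddCircle :=
      integrable_haar_real ⟨_, hc⟩
    rw [ofReal_integral_eq_lintegral_ofReal hi (Eventually.of_forall fun x => by positivity)]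
    refine lintegral_congr fun x => ?_
    rw [ENNReal.ofReal_pow (norm_nonneg _), ofReal_norm]
  have hc2 : Continuous fun σ => ∫ x, ‖F σ x‖ ^ 4 ∂AddCircle.haarAddCircle := by
    have : Continuous fun σ : Torus =>
        Complex.re (∑ p ∈ Q, a p * fourier (n₂ p) σ * (if n₁ p = 0 then 1 else 0)) := by
      fun_prop
    refine this.congr fun σ => ?_
    rw [← hint, Complex.ofReal_re]
  rw [lintegral_congr hx]
  have hi2 : Integrable (fun σ => ∫ x, ‖F σ x‖ ^ 4 ∂AddCircle.haarAddCircle)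
      AddCircle.haarAddCircle := integrable_haar_real ⟨_, hc2⟩
  rw [← ofReal_integral_eq_lintegral_ofReal hi2 (Eventually.of_forall fun σ => by positivity)]
  have h0 : 0 ≤ ∫ σ, ∫ x, ‖F σ x‖ ^ 4 ∂AddCircle.haarAddCircle ∂AddCircle.haarAddCircle := by
    positivity
  have hreal : ∀ r : ℝ, ‖r‖ₑ = ‖(r : ℂ)‖ₑ := fun r => by
    rw [← ofReal_norm, ← Complex.norm_real, ofReal_norm]
  rw [← Real.enorm_of_nonneg h0, hreal, hint2]
  have hconj : ∀ z : ℂ, ‖(starRingEnd ℂ) z‖ₑ = ‖z‖ₑ := fun z => by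
    rw [← ofReal_norm, Complex.norm_conj, ofReal_norm]
  calc _ ≤ ∑ k₁ ∈ S, ∑ k₂ ∈ S, ∑ k₃ ∈ S, ∑ k₄ ∈ S,
        ((if k₃ = k₁ then if k₄ = k₂ then ‖c k₁‖ₑ ^ 2 * ‖c k₂‖ₑ ^ 2 else 0 else 0) +
        (if k₃ = k₂ then if k₄ = k₁ then ‖c k₁‖ₑ ^ 2 * ‖c k₂‖ₑ ^ 2 else 0 else 0)) := by
        refine (enorm_sum_le _ _).trans ?_
        simp only [Q, Finset.sum_product]
        refine Finset.sum_le_sum fun k₁ _ => Finset.sum_le_sum fun k₂ _ =>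
          Finset.sum_le_sum fun k₃ _ => Finset.sum_le_sum fun k₄ _ => ?_
        by_cases h1 : n₁ (k₁, k₂, k₃, k₄) = 0
        · by_cases h2 : n₂ (k₁, k₂, k₃, k₄) = 0
          · rw [if_pos h1, if_pos h2, mul_one, mul_one, ha, enorm_mul, enorm_mul, enorm_mul, hconj,
              hconj]
            simp only [n₁] at h1
            simp only [n₂] at h2
            rcases eq_or_eq_of_add_eq_of_sq_add_sq_eq (k₁ := k₁) (k₂ := k₂) (k₃ := k₃) (k₄ := k₄)
              (by omega) (by linarith) with ⟨rfl, rfl⟩ | ⟨rfl, rfl⟩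
            · refine le_add_right (le_of_eq ?_)
              rw [if_pos rfl, if_pos rfl]; ring
            · refine le_add_left (le_of_eq ?_)
              rw [if_pos rfl, if_pos rfl]; ring
          · simp [h2]
        · simp [h1]
    _ = 2 * (∑ k ∈ S, ‖c k‖ₑ ^ 2) ^ 2 := by
        rw [sq (∑ k ∈ S, _), Finset.sum_mul_sum, Finset.mul_sum]
        refine Finset.sum_congr rfl fun k₁ hk₁ => ?_
        rw [Finset.mul_sum]
        refine Finset.sum_congr rfl fun k₂ hk₂ => ?_
        simp only [Finset.sum_add_distrib, Finset.sum_ite_irrel, Finset.sum_const_zero,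
          Finset.sum_ite_eq', hk₁, hk₂, if_true]
        ring

theorem eLpNorm_four_pow (f : Torus → ℂ) : eLpNorm f 4 volume ^ 4 = ∫⁻ x, ‖f x‖ₑ ^ 4 := by
  have := eLpNorm_nnreal_pow_eq_lintegral (μ := (volume : Measure Torus)) (f := f) (p := 4)
    (by norm_num)
  simpa using this

/-- A bounded time interval is covered by finitely many periods. -/
theorem lintegral_Icc_torus_le (t₀ t₁ : ℝ) :
    ∃ n : ℕ, ∀ G : Torus → ℝ≥0∞, ∫⁻ s in Set.Icc t₀ t₁, G (s : Torus) ≤ n * ∫⁻ σ, G σ := by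
  obtain ⟨n, hn⟩ := Archimedean.arch (t₁ - (t₀ - 1)) Real.two_pi_pos
  rw [nsmul_eq_mul] at hn
  refine ⟨n, fun G => ?_⟩
  have key : ∀ n : ℕ, ∫⁻ s in Set.Ioc (t₀ - 1) (t₀ - 1 + n * (2 * π)), G (s : Torus) ≤
      n * ∫⁻ σ, G σ := by
    intro n
    induction n with
    | zero => simp
    | succ n ih =>
      have h1 : Set.Ioc (t₀ - 1) (t₀ - 1 + (n + 1 : ℕ) * (2 * π)) ⊆
          Set.Ioc (t₀ - 1) (t₀ - 1 + n * (2 * π)) ∪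
          Set.Ioc (t₀ - 1 + n * (2 * π)) (t₀ - 1 + n * (2 * π) + 2 * π) := by
        intro x hx
        rcases le_or_gt x (t₀ - 1 + n * (2 * π)) with h | h
        · exact Or.inl ⟨hx.1, h⟩
        · refine Or.inr ⟨h, hx.2.trans_eq ?_⟩
          push_cast; ring
      refine (lintegral_mono_set h1).trans ((lintegral_union_le _ _ _).trans ?_)
      rw [AddCircle.lintegral_preimage]
      push_cast
      rw [add_mul, one_mul]
      exact add_le_add_left ih _
  have hsub : Set.Icc t₀ t₁ ⊆ Set.Ioc (t₀ - 1) (t₀ - 1 + n * (2 * π)) :=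
    fun x hx => ⟨by linarith [hx.1], by linarith [hx.2]⟩
  exact (lintegral_mono_set hsub).trans (key n)

theorem trig_flow_apply (S : Finset ℤ) (s : ℝ) (c : FourierSeq) (x : Torus) :
    trig S (flow s c) x = ∑ k ∈ S, c k * fourier (-k ^ 2) (s : Torus) * fourier k x := by
  rw [trig_apply]
  refine Finset.sum_congr rfl fun k _ => ?_
  rw [flow_apply, fourier_coe_apply, mul_comm (c k)]
  congr 3
  push_cast
  have : (π : ℂ) ≠ 0 := by exact_mod_cast Real.pi_ne_zero
  field_simp

/-- The periodic `L⁴` Strichartz estimate. -/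
theorem exists_lintegral_trig_flow_pow_four_le (t₀ t₁ : ℝ) :
    ∃ K : ℝ≥0, ∀ (S : Finset ℤ) (c : FourierSeq),
      ∫⁻ s in Set.Icc t₀ t₁, ∫⁻ x, ‖trig S (flow s c) x‖ₑ ^ 4 ≤ K * (∑ k ∈ S, ‖c k‖ₑ ^ 2) ^ 2 := by
  obtain ⟨n, hn⟩ := lintegral_Icc_torus_le t₀ t₁
  set P : ℝ≥0 := Real.toNNReal (2 * π) with hP
  have hvol : (volume : Measure Torus) = (P : ℝ≥0∞) • AddCircle.haarAddCircle :=
    AddCircle.volume_eq_smul_haarAddCircle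
  refine ⟨n * P * P * 2, fun S c => ?_⟩
  have h1 := hn fun σ => ∫⁻ x : Torus, ‖∑ k ∈ S, c k * fourier (-k ^ 2) σ * fourier k x‖ₑ ^ 4
  simp only [trig_flow_apply]
  refine h1.trans ?_
  rw [hvol]
  simp only [lintegral_smul_measure, smul_eq_mul]
  rw [lintegral_const_mul' _ _ ENNReal.coe_ne_top]
  refine (mul_le_mul_right (mul_le_mul_right (mul_le_mul_right
    (lintegral_fourier_sq_pow_four_le S c) _) _) _).trans_eq ?_
  push_cast
  ring

section Time

variable {t₀ t₁ : ℝ} {v w : ℝ → FourierSeq}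

theorem add_pow_four_le (a b : ℝ≥0∞) : (a + b) ^ 4 ≤ 8 * (a ^ 4 + b ^ 4) := by
  have := ENNReal.rpow_add_le_mul_rpow_add_rpow a b (p := 4) (by norm_num)
  norm_num at this
  exact_mod_cast this

/-- The Strichartz estimate for `v` with `∂_t v` in `L¹_t L²_x`, by Duhamel's formula. -/
theorem exists_lintegral_trig_pow_four_le (t₀ t₁ : ℝ) (ht : t₀ ≤ t₁) :
    ∃ K : ℝ≥0, ∀ (v w : ℝ → FourierSeq), HasTimeDeriv t₀ t₁ v w → ∀ S : Finset ℤ,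
      ∫⁻ s in Set.Icc t₀ t₁, ∫⁻ x, ‖trig S (flow s (v s)) x‖ₑ ^ 4 ≤
        K * (l2 (fun k => ‖v t₀ k‖ₑ) ^ 4 + (∫⁻ s in Set.Icc t₀ t₁, l2 fun k => ‖w s k‖ₑ) ^ 4) := by
  obtain ⟨K, hK⟩ := exists_lintegral_trig_flow_pow_four_le t₀ t₁
  refine ⟨8 * K, fun v w h S => ?_⟩
  have hsq : ∀ c : FourierSeq, (∑ k ∈ S, ‖c k‖ₑ ^ 2) ^ 2 ≤ l2 (fun k => ‖c k‖ₑ) ^ 4 := by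
    intro c
    rw [show (4 : ℕ) = 2 * 2 from rfl, pow_mul, l2_sq]
    gcongr
    exact ENNReal.sum_le_tsum S
  set ν := volume.restrict (Set.Icc t₀ t₁) with hν
  have hwm : ∀ k, AEStronglyMeasurable (fun r => w r k) ν := by
    intro k
    have h1 := (h k).1
    rw [intervalIntegrable_iff_integrableOn_Icc_of_le ht] at h1
    exact h1.1
  -- Minkowski's inequality needs joint measurability, so `w` is modified on a null set of times.
  set w' : ℝ → FourierSeq := fun r k => (hwm k).mk _ r with hw'
  have hw'm : ∀ k, Measurable fun r => w' r k := fun k => (hwm k).stronglyMeasurable_mk.measurable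
  have hww : ∀ᵐ r ∂ν, w r = w' r := by
    filter_upwards [ae_all_iff.2 fun k => (hwm k).ae_eq_mk] with r hr
    ext k
    exact hr k
  set f : ℝ × Torus → ℝ → ℝ≥0∞ := fun p r => ‖trig S (flow p.1 (w' r)) p.2‖ₑ with hf
  have hfm : Measurable (Function.uncurry f) := by
    have : Measurable fun q : (ℝ × Torus) × ℝ => trig S (flow q.1.1 (w' q.2)) q.1.2 := by
      simp only [trig_apply, flow_apply]
      refine Finset.measurable_sum _ fun k _ => Measurable.mul (Measurable.mul ?_ ?_) ?_
      · exact Continuous.measurable (by fun_prop)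
      · exact (hw'm k).comp measurable_snd
      · exact Continuous.measurable (by fun_prop)
    exact this.enorm
  set g : ℝ × Torus → ℝ≥0∞ := fun p => ‖trig S (flow p.1 (v t₀)) p.2‖ₑ with hg
  have hgm : Measurable g := by
    refine Measurable.enorm ?_
    simp only [trig_apply, flow_apply]
    exact Continuous.measurable (by fun_prop)
  have hpt : ∀ s ∈ Set.Icc t₀ t₁, ∀ x, ‖trig S (flow s (v s)) x‖ₑ ≤
      g (s, x) + ∫⁻ r, f (s, x) r ∂ν := by
    intro s hs x
    have hsub : ∀ k, IntervalIntegrable (fun q => w q k) volume t₀ s := by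
      intro k
      refine (h k).1.mono_set ?_
      rw [Set.uIcc_of_le ht, Set.uIcc_of_le hs.1]
      exact Set.Icc_subset_Icc_right hs.2
    have e1 : trig S (flow s (v s)) x =
        trig S (flow s (v t₀)) x + ∫ r in t₀..s, trig S (flow s (w r)) x := by
      simp only [trig_apply, flow_apply]
      rw [intervalIntegral.integral_finsetSum fun k _ => ((hsub k).const_mul _).mul_const _,
        ← Finset.sum_add_distrib]
      refine Finset.sum_congr rfl fun k _ => ?_
      rw [intervalIntegral.integral_mul_const, intervalIntegral.integral_const_mul,
        (h k).2 s hs]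
      ring
    rw [e1]
    refine (enorm_add_le _ _).trans (add_le_add_right ?_ _)
    rw [intervalIntegral.integral_of_le hs.1]
    refine (enorm_integral_le_lintegral_enorm _).trans ((lintegral_mono_set
      (Set.Ioc_subset_Icc_self.trans (Set.Icc_subset_Icc_right hs.2))).trans_eq ?_)
    refine lintegral_congr_ae ?_
    filter_upwards [hww] with r hr
    rw [hr]
  have hm4 : Measurable fun p => (∫⁻ r, f p r ∂ν) ^ 4 := (hfm.lintegral_prod_right').pow_const 4
  calc ∫⁻ s in Set.Icc t₀ t₁, ∫⁻ x, ‖trig S (flow s (v s)) x‖ₑ ^ 4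
      ≤ ∫⁻ s in Set.Icc t₀ t₁, ∫⁻ x, 8 * (g (s, x) ^ 4 + (∫⁻ r, f (s, x) r ∂ν) ^ 4) := by
        refine setLIntegral_mono' measurableSet_Icc fun s hs => lintegral_mono fun x => ?_
        refine le_trans ?_ (add_pow_four_le _ _)
        gcongr
        exact hpt s hs x
    _ = 8 * (∫⁻ s in Set.Icc t₀ t₁, ∫⁻ x, g (s, x) ^ 4) +
          8 * ∫⁻ p, (∫⁻ r, f p r ∂ν) ^ 4 ∂(ν.prod volume) := by
        have e1 : ∀ s, ∫⁻ x, 8 * (g (s, x) ^ 4 + (∫⁻ r, f (s, x) r ∂ν) ^ 4) =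
            8 * (∫⁻ x, g (s, x) ^ 4) + 8 * ∫⁻ x, (∫⁻ r, f (s, x) r ∂ν) ^ 4 := by
          intro s
          have hgs : Measurable fun x => g (s, x) ^ 4 :=
            (hgm.pow_const 4).comp measurable_prodMk_left
          rw [lintegral_const_mul' _ _ (by simp), lintegral_add_left hgs, mul_add]
        simp only [e1]
        have h2 : Measurable fun s => ∫⁻ x, g (s, x) ^ 4 := (hgm.pow_const 4).lintegral_prod_right'
        rw [lintegral_add_left (h2.const_mul 8), lintegral_const_mul' _ _ (by simp),
          lintegral_const_mul' _ _ (by simp), lintegral_prod _ hm4.aemeasurable]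
    _ ≤ 8 * (K * l2 (fun k => ‖v t₀ k‖ₑ) ^ 4) +
          8 * (K * (∫⁻ s in Set.Icc t₀ t₁, l2 fun k => ‖w s k‖ₑ) ^ 4) := by
        refine add_le_add (mul_le_mul_right ((hK S (v t₀)).trans
          (mul_le_mul_right (hsq _) _)) _) (mul_le_mul_right ?_ _)
        refine (minkowski_four hfm).trans ?_
        have e2 : ∀ r, (∫⁻ p, f p r ^ 4 ∂(ν.prod volume)) ^ (1 / 4 : ℝ) ≤
            ((K : ℝ≥0∞) ^ (1 / 4 : ℝ)) * l2 (fun k => ‖w' r k‖ₑ) := by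
          intro r
          have hm : Measurable fun p => f p r ^ 4 :=
            (hfm.comp measurable_prodMk_right).pow_const 4
          rw [lintegral_prod _ hm.aemeasurable]
          refine (ENNReal.rpow_le_rpow ((hK S (w' r)).trans (mul_le_mul_right (hsq _) _))
            (by norm_num)).trans_eq ?_
          rw [ENNReal.mul_rpow_of_nonneg _ _ (by norm_num), ← ENNReal.rpow_natCast (l2 _),
            ← ENNReal.rpow_mul]
          norm_num
        have e3 : ∫⁻ r, (∫⁻ p, f p r ^ 4 ∂(ν.prod volume)) ^ (1 / 4 : ℝ) ∂ν ≤
            ((K : ℝ≥0∞) ^ (1 / 4 : ℝ)) * ∫⁻ r, l2 (fun k => ‖w r k‖ₑ) ∂ν := by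
          refine (lintegral_mono e2).trans_eq ?_
          rw [lintegral_const_mul' _ _ (ENNReal.rpow_ne_top_of_nonneg (by norm_num)
            ENNReal.coe_ne_top)]
          congr 1
          refine lintegral_congr_ae ?_
          filter_upwards [hww] with r hr
          rw [hr]
        refine (pow_le_pow_left' e3 4).trans_eq ?_
        rw [mul_pow, ← ENNReal.rpow_natCast ((K : ℝ≥0∞) ^ (1 / 4 : ℝ)), ← ENNReal.rpow_mul]
        norm_num
        rfl
    _ = _ := by push_cast; ring

end Time

/-! ### The space-time `L³_t L⁴_x` norm is finite -/

theorem eLpNorm_trig_low_four_le {f : Torus → ℂ} (hf : MemLp f 4 volume) {c : FourierSeq}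
    (hc : ∀ k, fourierCoeff f k = c k) (N : ℕ) :
    eLpNorm (trig (low N) c) 4 volume ≤ 37056 * eLpNorm f 4 volume := by
  have := eLpNorm_trig_low_le rieszExponent_four (by exact_mod_cast hf) hc N
  norm_num at this
  exact this

theorem eLpNorm_trig_low_four_le_torusNorm {c : FourierSeq} (h : torusNorm 4 c < ∞) (N : ℕ) :
    eLpNorm (trig (low N) c) 4 volume ≤ 37056 * torusNorm 4 c := by
  obtain ⟨f, hf, hfc⟩ := exists_of_torusNorm_lt_top h
  rw [torusNorm_eq (by norm_num) hf hfc]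
  exact eLpNorm_trig_low_four_le hf hfc N

theorem l2_le_torusNorm {c : FourierSeq} {p : ℝ≥0∞} (hp : 2 ≤ p) :
    l2 (fun k => ‖c k‖ₑ) ≤ torusNorm p c := by
  refine le_iInf fun f => le_iInf fun hf => le_iInf fun hc => ?_
  simp only [← hc]
  exact l2_fourierCoeff_le hp hf

theorem l2_le_sobolevNorm {γ : ℝ} (hγ : 0 ≤ γ) (c : FourierSeq) :
    l2 (fun k => ‖c k‖ₑ) ≤ sobolevNorm γ c := by
  have hpi : (1 : ℝ≥0∞) ≤ ENNReal.ofReal (2 * π) := by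
    rw [← ENNReal.ofReal_one]
    exact ENNReal.ofReal_le_ofReal (by linarith [Real.pi_gt_three])
  refine ENNReal.rpow_le_rpow ?_ (by norm_num)
  refine le_trans (ENNReal.tsum_le_tsum fun k => ?_) (le_mul_of_one_le_left zero_le hpi)
  refine le_mul_of_one_le_left zero_le ?_
  rw [← ENNReal.ofReal_one]
  exact ENNReal.ofReal_le_ofReal (Real.one_le_rpow (by nlinarith [sq_nonneg (k : ℝ)]) hγ)

section Time

variable {t₀ t₁ : ℝ} {v w : ℝ → FourierSeq}

theorem HasTimeDeriv.aemeasurable_eLpNorm_trig (ht : t₀ ≤ t₁) (h : HasTimeDeriv t₀ t₁ v w)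
    (S : Finset ℤ) :
    AEMeasurable (fun s => eLpNorm (trig S (flow s (v s))) 4 volume)
      (volume.restrict (Set.Icc t₀ t₁)) := by
  have hvm := fun k => h.aestronglyMeasurable ht k
  set v' : ℝ → FourierSeq := fun r k => (hvm k).mk _ r with hv'
  have hv'm : ∀ k, Measurable fun r => v' r k := fun k => (hvm k).stronglyMeasurable_mk.measurable
  have hm : Measurable fun q : ℝ × Torus => trig S (flow q.1 (v' q.1)) q.2 := by
    simp only [trig_apply, flow_apply]
    refine Finset.measurable_sum _ fun k _ => Measurable.mul (Measurable.mul ?_ ?_) ?_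
    · exact Continuous.measurable (by fun_prop)
    · exact (hv'm k).comp measurable_fst
    · exact Continuous.measurable (by fun_prop)
  have hm' : Measurable fun s => (∫⁻ x, ‖trig S (flow s (v' s)) x‖ₑ ^ 4) ^ (1 / 4 : ℝ) :=
    ((hm.enorm.pow_const 4).lintegral_prod_right').pow_const _
  refine ⟨_, hm', ?_⟩
  filter_upwards [ae_all_iff.2 fun k => (hvm k).ae_eq_mk] with r hr
  have hvv : v r = v' r := funext hr
  rw [hvv, ← eLpNorm_four_pow, ← ENNReal.rpow_natCast, ← ENNReal.rpow_mul]
  norm_num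

/-- The `L²` norm of `v` is finite at every time when `v` is in `X^γ` with `γ ≥ 0`. -/
theorem HasTimeDeriv.l2_lt_top {γ : ℝ} (hγ : 0 ≤ γ) (ht : t₀ < t₁) (h : HasTimeDeriv t₀ t₁ v w)
    (hX : xNorm γ t₀ t₁ v w < ∞) :
    l2 (fun k => ‖v t₀ k‖ₑ) < ∞ ∧ ∫⁻ s in Set.Icc t₀ t₁, l2 (fun k => ‖w s k‖ₑ) < ∞ := by
  rw [xNorm, ENNReal.add_lt_top] at hX
  have hw : ∫⁻ s in Set.Icc t₀ t₁, l2 (fun k => ‖w s k‖ₑ) < ∞ :=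
    (lintegral_mono fun s => l2_le_sobolevNorm hγ (w s)).trans_lt hX.2
  refine ⟨?_, hw⟩
  have hne : (volume.restrict (Set.Icc t₀ t₁)) ≠ 0 := by
    rw [Ne, Measure.restrict_eq_zero, Real.volume_Icc]
    simpa using ht
  have : NeBot (ae (volume.restrict (Set.Icc t₀ t₁))) := ae_neBot.2 hne
  -- At some time `r` the norm is at most its essential supremum; the derivative carries the bound
  -- from `r` to `t₀`.
  obtain ⟨r, hr1, hr2⟩ := ((ENNReal.ae_le_essSup
    (μ := volume.restrict (Set.Icc t₀ t₁)) fun s => sobolevNorm γ (v s)).and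
      (ae_restrict_mem measurableSet_Icc)).exists
  have h1 := h.l2_ite_le ht.le (fun _ => True) (Set.left_mem_Icc.2 ht.le) hr2
  simp only [if_true] at h1
  refine h1.trans_lt (ENNReal.add_lt_top.2 ⟨?_, hw⟩)
  exact ((l2_le_sobolevNorm hγ (v r)).trans hr1).trans_lt hX.1

/-- A measurable majorant of the spatial `L⁴` norm. For `γ < 0` its integrability is an assumption
on `v`, for `γ ≥ 0` it is a consequence of the Strichartz estimate. -/
theorem HasTimeDeriv.exists_majorant {γ : ℝ} (ht : t₀ < t₁) (h : HasTimeDeriv t₀ t₁ v w)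
    (hX : xNorm γ t₀ t₁ v w < ∞)
    (h4 : γ < 0 → mixedNorm 3 4 t₀ t₁ (fun s => flow s (v s)) < ∞) :
    ∃ M : ℝ → ℝ≥0∞, AEMeasurable M (volume.restrict (Set.Icc t₀ t₁)) ∧
      ∫⁻ s in Set.Icc t₀ t₁, M s ^ 3 ≠ ∞ ∧ ∀ s, torusNorm 4 (flow s (v s)) ≤ M s := by
  set e : ℕ → ℝ → ℝ≥0∞ := fun N s => eLpNorm (trig (low N) (flow s (v s))) 4 volume with he
  have hem : ∀ N, AEMeasurable (e N) (volume.restrict (Set.Icc t₀ t₁)) := fun N =>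
    h.aemeasurable_eLpNorm_trig ht.le (low N)
  have hlim : AEMeasurable (fun s => liminf (fun N => e N s) atTop)
      (volume.restrict (Set.Icc t₀ t₁)) := by
    refine ⟨_, Measurable.liminf fun N => (hem N).measurable_mk, ?_⟩
    filter_upwards [ae_all_iff.2 fun N => (hem N).ae_eq_mk] with s hs
    exact congrArg (fun u => liminf u atTop) (funext hs)
  refine ⟨fun s => liminf (fun N => e N s) atTop, hlim, ?_,
    fun s => torusNorm_le_liminf (by norm_num) _⟩
  rcases lt_or_ge γ 0 with hγ | hγ
  · have h1 := h4 hγ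
    rw [mixedNorm, ENNReal.rpow_lt_top_iff_of_pos (by norm_num)] at h1
    have h2 : ∀ s, liminf (fun N => e N s) atTop ≤ 37056 * torusNorm 4 (flow s (v s)) := by
      intro s
      rcases eq_or_ne (torusNorm 4 (flow s (v s))) ∞ with htop | htop
      · rw [htop, ENNReal.mul_top (by norm_num)]; exact le_top
      · exact liminf_le_of_le (by isBoundedDefault) fun b hb => by
          obtain ⟨N, hN⟩ := hb.exists
          exact hN.trans (eLpNorm_trig_low_four_le_torusNorm htop.lt_top N)
    refine ne_top_of_le_ne_top ?_ (lintegral_mono fun s => pow_le_pow_left' (h2 s) 3)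
    simp only [mul_pow]
    rw [lintegral_const_mul' _ _ (by norm_num)]
    refine ENNReal.mul_ne_top (by norm_num) ?_
    refine ne_of_eq_of_ne (lintegral_congr fun s => ?_) h1.ne
    rw [← ENNReal.rpow_natCast]
    norm_num
  · obtain ⟨K, hK⟩ := exists_lintegral_trig_pow_four_le t₀ t₁ ht.le
    obtain ⟨hl, hw⟩ := h.l2_lt_top hγ ht hX
    -- On a bounded time interval `L⁴_t` controls `L³_t`.
    have h1 : ∀ x : ℝ≥0∞, x ^ 3 ≤ 1 + x ^ 4 := by
      intro x
      rcases le_total x 1 with hx | hx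
      · exact le_add_right (pow_le_one' hx 3)
      · exact le_add_left (pow_le_pow_right₀ hx (by norm_num))
    have h2 : ∀ s, (liminf (fun N => e N s) atTop) ^ 4 = liminf (fun N => e N s ^ 4) atTop := by
      intro s
      exact Monotone.map_liminf_of_continuousAt (f := fun x : ℝ≥0∞ => x ^ 4)
        (fun a b hab => pow_le_pow_left' hab 4) _ (ENNReal.continuous_pow 4).continuousAt
        (by isBoundedDefault) (by isBoundedDefault)
    refine ne_top_of_le_ne_top ?_ (lintegral_mono fun s => h1 _)
    rw [lintegral_add_left measurable_const]
    refine ENNReal.add_ne_top.2 ⟨by simp, ?_⟩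
    simp only [h2]
    refine ne_top_of_le_ne_top ?_ (lintegral_liminf_le' fun N => (hem N).pow_const 4)
    refine ne_top_of_le_ne_top (b := K * (l2 (fun k => ‖v t₀ k‖ₑ) ^ 4 +
      (∫⁻ s in Set.Icc t₀ t₁, l2 fun k => ‖w s k‖ₑ) ^ 4)) ?_ ?_
    · exact ENNReal.mul_ne_top ENNReal.coe_ne_top (ENNReal.add_ne_top.2
        ⟨ENNReal.pow_ne_top hl.ne, ENNReal.pow_ne_top hw.ne⟩)
    · refine liminf_le_of_le (by isBoundedDefault) fun b hb => ?_
      obtain ⟨N, hN⟩ := hb.exists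
      refine hN.trans ?_
      simp only [he, eLpNorm_four_pow]
      exact hK v w h (low N)

end Time

/-! ### Convergence of the truncated trilinear operator -/

theorem eLpNorm_mul_le {f g : Torus → ℂ} {p q r : ℝ≥0∞} [ENNReal.HolderTriple p q r]
    (hf : AEStronglyMeasurable f volume) (hg : AEStronglyMeasurable g volume) :
    eLpNorm (fun x => f x * g x) r volume ≤ eLpNorm f p volume * eLpNorm g q volume := by
  have := eLpNorm_smul_le_mul_eLpNorm (p := p) (q := q) (r := r) hg hf
  exact this

/-- Hölder's inequality with the exponents `1 = 1/2 + 1/4 + 1/4`. -/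
theorem eLpNorm_one_mul_three_le {f g h : Torus → ℂ} (hf : AEStronglyMeasurable f volume)
    (hg : AEStronglyMeasurable g volume) (hh : AEStronglyMeasurable h volume) :
    eLpNorm (fun x => f x * g x * h x) 1 volume ≤
      eLpNorm f 2 volume * eLpNorm g 4 volume * eLpNorm h 4 volume := by
  have h442 : ENNReal.HolderTriple 4 4 2 := ⟨by
    rw [← ENNReal.toReal_eq_toReal_iff' (by simp) (by simp),
      ENNReal.toReal_add (by simp) (by simp)]; norm_num⟩
  simp only [mul_assoc]
  refine (eLpNorm_mul_le (p := 2) (q := 2) hf (hg.mul hh)).trans ?_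
  exact mul_le_mul_right (eLpNorm_mul_le (p := 4) (q := 4) hg hh) _

theorem memLp_one_mul_three {f g h : Torus → ℂ} (hf : MemLp f 4 volume) (hg : MemLp g 4 volume)
    (hh : MemLp h 4 volume) : MemLp (fun x => f x * g x * h x) 1 volume :=
  ⟨(hf.1.mul hg.1).mul hh.1, (eLpNorm_one_mul_three_le hf.1 hg.1 hh.1).trans_lt
    (ENNReal.mul_lt_top (ENNReal.mul_lt_top (hf.mono_exponent (by norm_num)).2 hg.2) hh.2)⟩

theorem enorm_fourierCoeff_sub_le {f g : Torus → ℂ} (hf : MemLp f 1 volume)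
    (hg : MemLp g 1 volume) (k : ℤ) :
    ‖fourierCoeff f k - fourierCoeff g k‖ₑ ≤ eLpNorm (fun x => f x - g x) 1 volume := by
  rw [← fourierCoeff_sub (integrable_haar_of_memLp le_rfl hf) (integrable_haar_of_memLp le_rfl hg)]
  exact (enorm_fourierCoeff_le_haar le_rfl (memLp_haarAddCircle_iff.2 (hf.sub hg)).1 k).trans
    (eLpNorm_mono_measure _ haar_le_volume)

/-- The Fourier coefficients of a product of three functions are the limits of those of the product
of the truncations: one factor converges in `L²`, the other two are bounded in `L⁴`. -/
theorem tendsto_fourierCoeff_trig_low_mul_three {f₁ f₂ f₃ : Torus → ℂ} (hf₁ : MemLp f₁ 4 volume)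
    (hf₂ : MemLp f₂ 4 volume) (hf₃ : MemLp f₃ 4 volume) {c₁ c₂ c₃ : FourierSeq}
    (hc₁ : ∀ k, fourierCoeff f₁ k = c₁ k) (hc₂ : ∀ k, fourierCoeff f₂ k = c₂ k)
    (hc₃ : ∀ k, fourierCoeff f₃ k = c₃ k) (k : ℤ) :
    Tendsto (fun N => fourierCoeff
      (fun x => trig (low N) c₁ x * trig (low N) c₂ x * trig (low N) c₃ x) k) atTop
      (𝓝 (fourierCoeff (fun x => f₁ x * f₂ x * f₃ x) k)) := by
  rw [tendsto_iff_edist_tendsto_0]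
  have h24 : (2 : ℝ≥0∞) ≤ 4 := by norm_num
  have hd : ∀ {f : Torus → ℂ} (hf : MemLp f 4 volume) {c : FourierSeq}
      (_ : ∀ k, fourierCoeff f k = c k),
      Tendsto (fun N => eLpNorm (fun x => trig (low N) c x - f x) 2 volume) atTop (𝓝 0) := by
    intro f hf c hc
    refine (tendsto_eLpNorm_sub_trig_low (hf.mono_exponent h24) hc).congr fun N => ?_
    exact eLpNorm_sub_comm (f := f) (g := trig (low N) c) 2 volume
  set E : ℝ≥0∞ := 37056 * eLpNorm f₁ 4 volume + 37056 * eLpNorm f₂ 4 volume +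
    37056 * eLpNorm f₃ 4 volume + eLpNorm f₁ 4 volume + eLpNorm f₂ 4 volume with hE
  have hEtop : E ≠ ∞ := by
    have := hf₁.eLpNorm_ne_top
    have := hf₂.eLpNorm_ne_top
    have := hf₃.eLpNorm_ne_top
    simp only [hE, ENNReal.add_ne_top]
    refine ⟨⟨⟨⟨?_, ?_⟩, ?_⟩, ?_⟩, ?_⟩
    all_goals first | assumption | exact ENNReal.mul_ne_top (by norm_num) (by assumption)
  have hb₂ : ∀ N, eLpNorm (trig (low N) c₂) 4 volume ≤ E := fun N =>
    (eLpNorm_trig_low_four_le hf₂ hc₂ N).trans (by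
      rw [hE]; exact le_add_right (le_add_right (le_add_right (le_add_left le_rfl))))
  have hb₃ : ∀ N, eLpNorm (trig (low N) c₃) 4 volume ≤ E := fun N =>
    (eLpNorm_trig_low_four_le hf₃ hc₃ N).trans (by
      rw [hE]; exact le_add_right (le_add_right (le_add_left le_rfl)))
  have hbf₁ : eLpNorm f₁ 4 volume ≤ E := by rw [hE]; exact le_add_right (le_add_left le_rfl)
  have hbf₂ : eLpNorm f₂ 4 volume ≤ E := by rw [hE]; exact le_add_left le_rfl
  refine tendsto_of_tendsto_of_tendsto_of_le_of_le tendsto_const_nhds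
    (h := fun N => eLpNorm (fun x => trig (low N) c₁ x - f₁ x) 2 volume * (E * E) +
      eLpNorm (fun x => trig (low N) c₂ x - f₂ x) 2 volume * (E * E) +
      eLpNorm (fun x => trig (low N) c₃ x - f₃ x) 2 volume * (E * E)) ?_ (fun N => zero_le) ?_
  · have hEE : E * E ≠ ∞ := ENNReal.mul_ne_top hEtop hEtop
    have := ((ENNReal.Tendsto.mul_const (hd hf₁ hc₁) (Or.inr hEE)).add
      (ENNReal.Tendsto.mul_const (hd hf₂ hc₂) (Or.inr hEE))).add
      (ENNReal.Tendsto.mul_const (hd hf₃ hc₃) (Or.inr hEE))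
    simpa using this
  · intro N
    have hg : ∀ c, MemLp (trig (low N) c : Torus → ℂ) 4 volume := fun c => memLp_continuousMap _ 4
    have hgm : ∀ c, AEStronglyMeasurable (trig (low N) c : Torus → ℂ) volume := fun c => (hg c).1
    show edist _ _ ≤ _
    rw [edist_eq_enorm_sub]
    refine (enorm_fourierCoeff_sub_le (memLp_one_mul_three (hg c₁) (hg c₂) (hg c₃))
      (memLp_one_mul_three hf₁ hf₂ hf₃) k).trans ?_
    -- Telescoping: in each term one factor is a difference, measured in `L²`.
    have e : (fun x => trig (low N) c₁ x * trig (low N) c₂ x * trig (low N) c₃ x -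
        f₁ x * f₂ x * f₃ x) =
        ((fun x => (trig (low N) c₁ x - f₁ x) * trig (low N) c₂ x * trig (low N) c₃ x) +
        (fun x => (trig (low N) c₂ x - f₂ x) * f₁ x * trig (low N) c₃ x)) +
        (fun x => (trig (low N) c₃ x - f₃ x) * f₁ x * f₂ x) := by
      ext x; simp only [Pi.add_apply]; ring
    have m₁ := (hgm c₁).sub hf₁.1
    have m₂ := (hgm c₂).sub hf₂.1
    have m₃ := (hgm c₃).sub hf₃.1
    rw [e]
    refine (eLpNorm_add_le (((m₁.mul (hgm c₂)).mul (hgm c₃)).add ((m₂.mul hf₁.1).mul (hgm c₃)))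
      ((m₃.mul hf₁.1).mul hf₂.1) le_rfl).trans (add_le_add ((eLpNorm_add_le
      ((m₁.mul (hgm c₂)).mul (hgm c₃)) ((m₂.mul hf₁.1).mul (hgm c₃)) le_rfl).trans
        (add_le_add ?_ ?_)) ?_)
    · refine (eLpNorm_one_mul_three_le m₁ (hgm c₂) (hgm c₃)).trans ?_
      rw [mul_assoc]
      exact mul_le_mul_right (mul_le_mul' (hb₂ N) (hb₃ N)) _
    · refine (eLpNorm_one_mul_three_le m₂ hf₁.1 (hgm c₃)).trans ?_
      rw [mul_assoc]
      exact mul_le_mul_right (mul_le_mul' hbf₁ (hb₃ N)) _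
    · refine (eLpNorm_one_mul_three_le m₃ hf₁.1 hf₂.1).trans ?_
      rw [mul_assoc]
      exact mul_le_mul_right (mul_le_mul' hbf₁ hbf₂) _

theorem memLp_one_mul {f g : Torus → ℂ} (hf : MemLp f 2 volume) (hg : MemLp g 2 volume) :
    MemLp (fun x => f x * g x) 1 volume :=
  ⟨hf.1.mul hg.1, (eLpNorm_mul_le (p := 2) (q := 2) hf.1 hg.1).trans_lt
    (ENNReal.mul_lt_top hf.2 hg.2)⟩

theorem tendsto_fourierCoeff_trig_low_mul {f g : Torus → ℂ} (hf : MemLp f 2 volume)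
    (hg : MemLp g 2 volume) {c d : FourierSeq} (hc : ∀ k, fourierCoeff f k = c k)
    (hd : ∀ k, fourierCoeff g k = d k) (k : ℤ) :
    Tendsto (fun N => fourierCoeff (fun x => trig (low N) c x * trig (low N) d x) k) atTop
      (𝓝 (fourierCoeff (fun x => f x * g x) k)) := by
  rw [tendsto_iff_edist_tendsto_0]
  have h1 : Tendsto (fun N => eLpNorm (fun x => trig (low N) c x - f x) 2 volume) atTop (𝓝 0) := by
    refine (tendsto_eLpNorm_sub_trig_low hf hc).congr fun N => ?_
    exact eLpNorm_sub_comm (f := f) (g := trig (low N) c) 2 volume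
  have h2 : Tendsto (fun N => eLpNorm (fun x => trig (low N) d x - g x) 2 volume) atTop (𝓝 0) := by
    refine (tendsto_eLpNorm_sub_trig_low hg hd).congr fun N => ?_
    exact eLpNorm_sub_comm (f := g) (g := trig (low N) d) 2 volume
  refine tendsto_of_tendsto_of_tendsto_of_le_of_le tendsto_const_nhds
    (h := fun N => eLpNorm (fun x => trig (low N) c x - f x) 2 volume *
        eLpNorm (fun x => trig (low N) d x - g x) 2 volume +
      eLpNorm (fun x => trig (low N) c x - f x) 2 volume * eLpNorm g 2 volume +
      eLpNorm (fun x => trig (low N) d x - g x) 2 volume * eLpNorm f 2 volume) ?_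
      (fun N => zero_le) ?_
  · have := ((ENNReal.Tendsto.mul h1 (Or.inr ENNReal.zero_ne_top) h2
      (Or.inr ENNReal.zero_ne_top)).add
      (ENNReal.Tendsto.mul_const h1 (Or.inr hg.eLpNorm_ne_top))).add
      (ENNReal.Tendsto.mul_const h2 (Or.inr hf.eLpNorm_ne_top))
    simpa using this
  · intro N
    have hl : ∀ c, MemLp (trig (low N) c : Torus → ℂ) 2 volume := fun c => memLp_continuousMap _ 2
    show edist _ _ ≤ _
    rw [edist_eq_enorm_sub]
    refine (enorm_fourierCoeff_sub_le (memLp_one_mul (hl c) (hl d)) (memLp_one_mul hf hg) k).trans ?_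
    have e : (fun x => trig (low N) c x * trig (low N) d x - f x * g x) =
        ((fun x => (trig (low N) c x - f x) * (trig (low N) d x - g x)) +
        (fun x => (trig (low N) c x - f x) * g x)) +
        (fun x => (trig (low N) d x - g x) * f x) := by
      ext x; simp only [Pi.add_apply]; ring
    have m₁ := (hl c).1.sub hf.1
    have m₂ := (hl d).1.sub hg.1
    rw [e]
    exact (eLpNorm_add_le ((m₁.mul m₂).add (m₁.mul hg.1)) (m₂.mul hf.1) le_rfl).trans
      (add_le_add ((eLpNorm_add_le (m₁.mul m₂) (m₁.mul hg.1) le_rfl).trans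
        (add_le_add (eLpNorm_mul_le m₁ m₂) (eLpNorm_mul_le m₁ hg.1)))
        (eLpNorm_mul_le m₂ hf.1))

theorem eLpNorm_trig_low_flow_mult_le {A : ℝ} {μ : ℤ → ℂ} (hμ : IsBVSymbol A μ) {s : ℝ}
    {c : FourierSeq} (hc : torusNorm 4 (flow s c) < ∞) (N : ℕ) :
    eLpNorm (trig (low N) (flow s (mult μ c))) 4 volume ≤
      ((A.toNNReal + A.toNNReal * (4 * 48) : ℝ≥0) : ℝ≥0∞) * 37056 * torusNorm 4 (flow s c) := by
  have h := hμ.multBdd rieszExponent_four (low N) (flow s c)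
  rw [flow_mult, mul_assoc]
  exact (by exact_mod_cast h : _ ≤ _).trans
    (mul_le_mul_right (eLpNorm_trig_low_four_le_torusNorm hc N) _)

theorem eLpNorm_trig_low_flow_mult_conjSeq_le {A : ℝ} {μ : ℤ → ℂ} (hμ : IsBVSymbol A μ) {s : ℝ}
    {c : FourierSeq} (hc : torusNorm 4 (flow s c) < ∞) (N : ℕ) :
    eLpNorm (trig (low N) (flow (-s) (mult μ (conjSeq c)))) 4 volume ≤
      ((A.toNNReal + A.toNNReal * (4 * 48) : ℝ≥0) : ℝ≥0∞) * 37056 * torusNorm 4 (flow s c) := by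
  have h := hμ.multBdd rieszExponent_four (low N) (conjSeq (flow s c))
  rw [flow_neg_mult_conjSeq, mul_assoc]
  refine (by exact_mod_cast h : _ ≤ _).trans (mul_le_mul_right ?_ _)
  rw [eLpNorm_trig_conjSeq neg_mem_low]
  exact eLpNorm_trig_low_four_le_torusNorm hc N

/-- At a time at which the linear evolution of `v` is in `L⁴`, the multipliers `T_j` stay in `L⁴`, so
that the cubic term is the limit of its truncations. -/
theorem tendsto_triSum_cubicKernel {A : ℝ} {m : Fin 4 → ℤ → ℂ} (hm : ∀ i, IsBVSymbol A (m i))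
    {s : ℝ} {c : FourierSeq} (hc : torusNorm 4 (flow s c) < ∞) (k : ℤ) :
    Tendsto (fun N => triSum (cubicKernel m s) (low N) (low N) (low N) c k) atTop
      (𝓝 (cubicTerm m s c k)) := by
  have hfin : ((A.toNNReal + A.toNNReal * (4 * 48) : ℝ≥0) : ℝ≥0∞) * 37056 * torusNorm 4 (flow s c)
      ≠ ∞ := ENNReal.mul_ne_top (ENNReal.mul_ne_top ENNReal.coe_ne_top (by norm_num)) hc.ne
  obtain ⟨f₁, hf₁, hc₁, -⟩ := exists_memLp_of_frequently (q := 4) (by norm_num) hfin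
    (Frequently.of_forall fun N => eLpNorm_trig_low_flow_mult_conjSeq_le (hm 1) hc N)
  obtain ⟨f₂, hf₂, hc₂, -⟩ := exists_memLp_of_frequently (q := 4) (by norm_num) hfin
    (Frequently.of_forall fun N => eLpNorm_trig_low_flow_mult_le (hm 2) hc N)
  obtain ⟨f₃, hf₃, hc₃, -⟩ := exists_memLp_of_frequently (q := 4) (by norm_num) hfin
    (Frequently.of_forall fun N => eLpNorm_trig_low_flow_mult_le (hm 3) hc N)
  have hlim := tendsto_fourierCoeff_trig_low_mul_three hf₁ hf₂ hf₃ hc₁ hc₂ hc₃ k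
  have h24 : (2 : ℝ≥0∞) ≤ 4 := by norm_num
  have hae : (fun x : Torus => toFun (flow (-s) (mult (m 1) (conjSeq c))) x *
      toFun (flow s (mult (m 2) c)) x * toFun (flow s (mult (m 3) c)) x) =ᵐ[volume]
      fun x => f₁ x * f₂ x * f₃ x := by
    filter_upwards [toFun_ae_eq (hf₁.mono_exponent h24) hc₁,
      toFun_ae_eq (hf₂.mono_exponent h24) hc₂, toFun_ae_eq (hf₃.mono_exponent h24) hc₃]
      with x h1 h2 h3
    rw [h1, h2, h3]
  have hae' := (Measure.absolutelyContinuous_of_le haar_le_volume).ae_le hae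
  simp only [triSum_cubicKernel m s _ _ neg_mem_low]
  rw [cubicTerm, fourierCoeff_congr_ae hae']
  simp only [flow_apply, mult]
  exact (hlim.const_mul _).const_mul _

theorem fourierCoeff_trig_mul (S₁ S₂ : Finset ℤ) (d₁ d₂ : FourierSeq) (k : ℤ) :
    fourierCoeff (fun x => trig S₁ d₁ x * trig S₂ d₂ x) k =
      ∑ k₁ ∈ S₁, ∑ k₂ ∈ S₂, if k₁ + k₂ = k then d₁ k₁ * d₂ k₂ else 0 := by
  have h := fourierCoeff_trig_mul_three S₁ S₂ {0} d₁ d₂ (fun _ => 1) k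
  simpa [trig_apply] using h

/-- The truncated resonant sum, with the mean of a product written as its zeroth Fourier
coefficient. -/
theorem triSum_resonantKernel₃_low (m : Fin 4 → ℤ → ℂ) (N : ℕ) (c : FourierSeq) {k : ℤ}
    (hk : k ∈ low N) :
    triSum (resonantKernel₃ m) (low N) (low N) (low N) c k =
      mult (m 0) (mult (m 3) c) k * fourierCoeff (fun x =>
        trig (low N) (mult (m 1) (conjSeq c)) x * trig (low N) (mult (m 2) c) x) 0 := by
  rw [fourierCoeff_trig_mul, triSum, Finset.mul_sum]
  refine Finset.sum_nbij' (fun k => -k) (fun k => -k) neg_mem_low neg_mem_low (by simp) (by simp)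
    fun k₁ _ => ?_
  rw [Finset.mul_sum]
  refine Finset.sum_congr rfl fun k₂ _ => ?_
  by_cases h : k₂ = k₁
  · subst h
    have h1 : ∀ k₃, (if k + k₂ = k₂ + k₃ then resonantKernel₃ m k k₂ k₂ k₃ *
        ((starRingEnd ℂ) (c k₂) * c k₂ * c k₃) else 0) =
        if k = k₃ then symbolProd m k k₂ k₂ k₃ * ((starRingEnd ℂ) (c k₂) * c k₂ * c k₃) else 0 := by
      intro k₃
      rw [resonantKernel₃, if_pos rfl]
      exact if_congr (by omega) rfl rfl
    simp only [h1, Finset.sum_ite_eq, hk, if_true, neg_add_cancel, mult, conjSeq, symbolProd,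
      neg_neg]
    ring
  · rw [if_neg (by omega), mul_zero]
    refine Finset.sum_eq_zero fun k₃ _ => ?_
    rw [resonantKernel₃, if_neg h, zero_mul, ite_self]

theorem triSum_resonantKernel₃_low_of_notMem (m : Fin 4 → ℤ → ℂ) (N : ℕ) (c : FourierSeq) {k : ℤ}
    (hk : k ∉ low N) : triSum (resonantKernel₃ m) (low N) (low N) (low N) c k = 0 := by
  refine Finset.sum_eq_zero fun k₁ _ => Finset.sum_eq_zero fun k₂ _ =>
    Finset.sum_eq_zero fun k₃ hk₃ => ?_
  by_cases h : k + k₁ = k₂ + k₃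
  · have hne : k₂ ≠ k₁ := by
      rintro rfl
      exact hk (by rwa [show k = k₃ by omega])
    rw [resonantKernel₃, if_neg hne, zero_mul, ite_self]
  · rw [if_neg h]

/-- The mean of a product is its zeroth Fourier coefficient. -/
theorem pairMean_eq (f g : FourierSeq) :
    pairMean f g = fourierCoeff (fun x : Torus => toFun f x * toFun g x) 0 := by
  rw [pairMean, fourierCoeff, AddCircle.volume_eq_smul_haarAddCircle, integral_smul_measure,
    ENNReal.toReal_ofReal Real.two_pi_pos.le, Complex.real_smul, ← mul_assoc, inv_mul_cancel₀, one_mul]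
  · simp
  · exact_mod_cast Real.two_pi_pos.ne'

theorem exists_memLp_mult {A : ℝ} {μ : ℤ → ℂ} (hμ : IsBVSymbol A μ) {c : FourierSeq}
    (hc : l2 (fun k => ‖c k‖ₑ) ≠ ∞) :
    ∃ f : Torus → ℂ, MemLp f 2 volume ∧ ∀ k, fourierCoeff f k = mult μ c k := by
  refine exists_memLp_of_summable (summable_of_tsum_enorm_sq ?_)
  rw [← l2_sq fun k => ‖mult μ c k‖ₑ]
  refine ENNReal.pow_ne_top (ne_top_of_le_ne_top (b := ENNReal.ofReal A * l2 fun k => ‖c k‖ₑ)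
    (ENNReal.mul_ne_top ENNReal.ofReal_ne_top hc) ?_)
  rw [← l2_const_mul]
  refine l2_mono fun k => ?_
  rw [mult, enorm_mul]
  gcongr
  exact hμ.enorm_le k

theorem l2_conjSeq (c : FourierSeq) : l2 (fun k => ‖conjSeq c k‖ₑ) = l2 fun k => ‖c k‖ₑ := by
  rw [← l2_comp_equiv (Equiv.neg ℤ) fun k => ‖c k‖ₑ]
  congr 1
  ext k
  rw [conjSeq, ← ofReal_norm, Complex.norm_conj, ofReal_norm]
  rfl

theorem tendsto_triSum_resonantKernel₃ {A : ℝ} {m : Fin 4 → ℤ → ℂ} (hm : ∀ i, IsBVSymbol A (m i))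
    {c : FourierSeq} (hc : l2 (fun k => ‖c k‖ₑ) ≠ ∞) (k : ℤ) :
    Tendsto (fun N => triSum (resonantKernel₃ m) (low N) (low N) (low N) c k) atTop
      (𝓝 (mult (m 0) (mult (m 3) c) k * pairMean (mult (m 1) (conjSeq c)) (mult (m 2) c))) := by
  obtain ⟨f, hf, hfc⟩ := exists_memLp_mult (hm 1) (c := conjSeq c) (by rwa [l2_conjSeq])
  obtain ⟨g, hg, hgc⟩ := exists_memLp_mult (hm 2) hc
  have hae : (fun x : Torus => toFun (mult (m 1) (conjSeq c)) x * toFun (mult (m 2) c) x)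
      =ᵐ[volume] fun x => f x * g x := by
    filter_upwards [toFun_ae_eq hf hfc, toFun_ae_eq hg hgc] with x h1 h2
    rw [h1, h2]
  rw [pairMean_eq, fourierCoeff_congr_ae
    ((Measure.absolutelyContinuous_of_le haar_le_volume).ae_le hae)]
  refine ((tendsto_fourierCoeff_trig_low_mul hf hg hfc hgc 0).const_mul _).congr' ?_
  filter_upwards [tendsto_low.eventually_ge_atTop {k}] with N hN
  exact (triSum_resonantKernel₃_low m N c (hN (Finset.mem_singleton_self k))).symm

theorem enorm_triSum_resonantKernel₃_low_le {A : ℝ} {m : Fin 4 → ℤ → ℂ}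
    (hm : ∀ i, IsBVSymbol A (m i)) (N : ℕ) (c : FourierSeq) (k : ℤ) :
    ‖triSum (resonantKernel₃ m) (low N) (low N) (low N) c k‖ₑ ≤
      ENNReal.ofReal A ^ 4 * l2 (fun k => ‖c k‖ₑ) ^ 3 := by
  by_cases hk : k ∈ low N
  · set x : ℤ → ℝ≥0∞ := fun k => ‖c k‖ₑ with hx
    have h1 : ‖fourierCoeff (fun x => trig (low N) (mult (m 1) (conjSeq c)) x *
        trig (low N) (mult (m 2) c) x) 0‖ₑ ≤ ENNReal.ofReal A ^ 2 * l2 x ^ 2 := by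
      rw [fourierCoeff_trig_mul]
      calc _ ≤ ∑ k₁ ∈ low N, ∑ k₂ ∈ low N, if k₂ = -k₁ then ENNReal.ofReal A ^ 2 * x k₂ ^ 2 else 0 := by
            refine (enorm_sum_le _ _).trans (Finset.sum_le_sum fun k₁ _ =>
              (enorm_sum_le _ _).trans (Finset.sum_le_sum fun k₂ _ => ?_))
            by_cases h : k₁ + k₂ = 0
            · obtain rfl : k₂ = -k₁ := by omega
              rw [if_pos h, if_pos rfl, mult, mult, conjSeq, enorm_mul, enorm_mul, enorm_mul,
                ← ofReal_norm ((starRingEnd ℂ) _), Complex.norm_conj, ofReal_norm]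
              calc _ ≤ ENNReal.ofReal A * ‖c (-k₁)‖ₑ * (ENNReal.ofReal A * ‖c (-k₁)‖ₑ) := by
                    gcongr <;> exact (hm _).enorm_le _
                _ = _ := by ring
            · rw [if_neg h, if_neg (by omega), enorm_zero]
        _ = ∑ k₁ ∈ low N, ENNReal.ofReal A ^ 2 * x (-k₁) ^ 2 := by
            refine Finset.sum_congr rfl fun k₁ hk₁ => ?_
            rw [Finset.sum_ite_eq', if_pos (neg_mem_low k₁ hk₁)]
        _ = ENNReal.ofReal A ^ 2 * ∑ k₁ ∈ low N, x (-k₁) ^ 2 := by rw [Finset.mul_sum]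
        _ ≤ ENNReal.ofReal A ^ 2 * ∑' k₁, x (-k₁) ^ 2 := by
            gcongr; exact ENNReal.sum_le_tsum _
        _ = _ := by
            rw [l2_sq]
            exact congrArg _ ((Equiv.neg ℤ).tsum_eq fun k => x k ^ 2)
    rw [triSum_resonantKernel₃_low m N c hk, enorm_mul, mult, mult, enorm_mul, enorm_mul]
    calc _ ≤ ENNReal.ofReal A * (ENNReal.ofReal A * l2 x) * (ENNReal.ofReal A ^ 2 * l2 x ^ 2) := by
          gcongr
          · exact (hm 0).enorm_le k
          · exact (hm 3).enorm_le k
          · exact le_l2 x k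
      _ = _ := by ring
  · rw [triSum_resonantKernel₃_low_of_notMem m N c hk, enorm_zero]
    exact zero_le

/-- A bound for the truncated cubic term that does not depend on the truncation. -/
theorem exists_enorm_triSum_cubicKernel_low_le {A : ℝ} {m : Fin 4 → ℤ → ℂ}
    (hm : ∀ i, IsBVSymbol A (m i)) :
    ∃ D : ℝ≥0∞, D ≠ ∞ ∧ ∀ (s : ℝ) (c : FourierSeq), torusNorm 4 (flow s c) < ∞ → ∀ (N : ℕ) (k : ℤ),
      ‖triSum (cubicKernel m s) (low N) (low N) (low N) c k‖ₑ ≤ D * torusNorm 4 (flow s c) ^ 3 := by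
  set B : ℝ≥0∞ := ((A.toNNReal + A.toNNReal * (4 * 48) : ℝ≥0) : ℝ≥0∞) * 37056 with hB
  have hBtop : B ≠ ∞ := ENNReal.mul_ne_top ENNReal.coe_ne_top (by norm_num)
  set V : ℝ≥0∞ := volume (Set.univ : Set Torus) ^
    (1 / (2 : ℝ≥0∞).toReal - 1 / (4 : ℝ≥0∞).toReal) with hV
  have hVtop : V ≠ ∞ := ENNReal.rpow_ne_top_of_nonneg (by norm_num) (measure_ne_top _ _)
  refine ⟨ENNReal.ofReal A * (V * B ^ 3), ENNReal.mul_ne_top ENNReal.ofReal_ne_top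
    (ENNReal.mul_ne_top hVtop (ENNReal.pow_ne_top hBtop)), fun s c hc N k => ?_⟩
  set g₁ := trig (low N) (flow (-s) (mult (m 1) (conjSeq c)))
  set g₂ := trig (low N) (flow s (mult (m 2) c))
  set g₃ := trig (low N) (flow s (mult (m 3) c))
  set T := torusNorm 4 (flow s c)
  have h1 : eLpNorm g₁ 2 volume ≤ B * T * V :=
    (eLpNorm_le_eLpNorm_mul_rpow_measure_univ (by norm_num)
      g₁.continuous.aestronglyMeasurable).trans
      (mul_le_mul_left (eLpNorm_trig_low_flow_mult_conjSeq_le (hm 1) hc N) _)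
  have h2 : eLpNorm g₂ 4 volume ≤ B * T := eLpNorm_trig_low_flow_mult_le (hm 2) hc N
  have h3 : eLpNorm g₃ 4 volume ≤ B * T := eLpNorm_trig_low_flow_mult_le (hm 3) hc N
  rw [triSum_cubicKernel m s _ _ neg_mem_low, enorm_flow, mult, enorm_mul]
  have h4 : ‖fourierCoeff (fun x => g₁ x * g₂ x * g₃ x) k‖ₑ ≤ B * T * V * (B * T) * (B * T) :=
    (enorm_fourierCoeff_le_haar le_rfl (memLp_haarAddCircle_iff.2
      (memLp_continuousMap (g₁ * g₂ * g₃) 1)).1 k).trans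
      ((eLpNorm_mono_measure _ haar_le_volume).trans ((eLpNorm_one_mul_three_le
        g₁.continuous.aestronglyMeasurable g₂.continuous.aestronglyMeasurable
        g₃.continuous.aestronglyMeasurable).trans (mul_le_mul' (mul_le_mul' h1 h2) h3)))
  exact (mul_le_mul' ((hm 0).enorm_le k) h4).trans_eq (by ring)

section Time

variable {t₀ t₁ : ℝ} {v w : ℝ → FourierSeq}

/-- Dominated convergence with a majorant `G` that may be infinite on a null set, where nothing is
assumed. -/
theorem tendsto_intervalIntegral_of_enorm_le (ht : t₀ ≤ t₁) {F : ℕ → ℝ → ℂ} {f : ℝ → ℂ}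
    {G : ℝ → ℝ≥0∞} (hF : ∀ N, AEStronglyMeasurable (F N) (volume.restrict (Set.Icc t₀ t₁)))
    (hG : AEMeasurable G (volume.restrict (Set.Icc t₀ t₁)))
    (hGint : ∫⁻ s in Set.Icc t₀ t₁, G s ≠ ∞) (hFG : ∀ N s, G s < ∞ → ‖F N s‖ₑ ≤ G s)
    (hlim : ∀ s, G s < ∞ → Tendsto (fun N => F N s) atTop (𝓝 (f s))) :
    Tendsto (fun N => ∫ s in t₀..t₁, F N s) atTop (𝓝 (∫ s in t₀..t₁, f s)) := by
  simp only [intervalIntegral.integral_of_le ht, ← integral_Icc_eq_integral_Ioc]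
  have hfin := ae_lt_top' hG hGint
  refine tendsto_integral_of_dominated_convergence (fun s => (G s).toReal) hF
    (integrable_toReal_of_lintegral_ne_top hG hGint) (fun N => ?_) ?_
  · filter_upwards [hfin] with s hs
    rw [← toReal_enorm]
    exact ENNReal.toReal_mono hs.ne (hFG N s hs)
  · filter_upwards [hfin] with s hs
    exact hlim s hs

/-- The trilinear operator is the limit of its frequency truncations. -/
theorem tendsto_integral_triSum_low {γ A : ℝ} {m : Fin 4 → ℤ → ℂ} (hm : ∀ i, IsBVSymbol A (m i))
    (ht : t₀ < t₁) (h : HasTimeDeriv t₀ t₁ v w) (hX : xNorm γ t₀ t₁ v w < ∞)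
    (h4 : γ < 0 → mixedNorm 3 4 t₀ t₁ (fun s => flow s (v s)) < ∞) (k : ℤ) :
    Tendsto (fun N => Complex.I * ∫ s in t₀..t₁,
      triSum (fullKernel m s) (low N) (low N) (low N) (v s) k) atTop
      (𝓝 (trilinearT m t₀ t₁ v k)) := by
  obtain ⟨M, hM, hMint, hMv⟩ := h.exists_majorant ht hX h4
  have main : ∀ (K : ℝ → ℤ → ℤ → ℤ → ℤ → ℂ) (f : ℝ → ℂ) (D : ℝ≥0∞), D ≠ ∞ →
      (∀ k k₁ k₂ k₃, Continuous fun s => K s k k₁ k₂ k₃) →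
      (∀ s, torusNorm 4 (flow s (v s)) < ∞ → ∀ N, ‖triSum (K s) (low N) (low N) (low N) (v s) k‖ₑ ≤
        D * torusNorm 4 (flow s (v s)) ^ 3) →
      (∀ s, torusNorm 4 (flow s (v s)) < ∞ →
        Tendsto (fun N => triSum (K s) (low N) (low N) (low N) (v s) k) atTop (𝓝 (f s))) →
      Tendsto (fun N => ∫ s in t₀..t₁, triSum (K s) (low N) (low N) (low N) (v s) k) atTop
        (𝓝 (∫ s in t₀..t₁, f s)) := by
    intro K f D hD hK hb hl
    have hfin : ∀ s, (D + 1) * M s ^ 3 < ∞ → torusNorm 4 (flow s (v s)) < ∞ := by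
      intro s hs
      refine (hMv s).trans_lt (lt_top_iff_ne_top.2 fun htop => ?_)
      rw [htop, ENNReal.top_pow (by norm_num), ENNReal.mul_top (by simp)] at hs
      exact lt_irrefl _ hs
    refine tendsto_intervalIntegral_of_enorm_le (G := fun s => (D + 1) * M s ^ 3) ht.le
      (fun N => (h.continuousOn_triSum ht.le hK _ _ _ k).aestronglyMeasurable measurableSet_Icc)
      ((hM.pow_const 3).const_mul _) ?_ (fun N s hs => ?_) fun s hs => hl s (hfin s hs)
    · have hD1 : D + 1 ≠ ∞ := ENNReal.add_ne_top.2 ⟨hD, by simp⟩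
      rw [lintegral_const_mul' _ _ hD1]
      exact ENNReal.mul_ne_top hD1 hMint
    · refine (hb s (hfin s hs) N).trans (mul_le_mul' le_self_add (pow_le_pow_left' (hMv s) 3))
  have hl2 : ∀ s, l2 (fun k => ‖v s k‖ₑ) ≤ torusNorm 4 (flow s (v s)) := by
    intro s
    have := l2_le_torusNorm (c := flow s (v s)) (p := 4) (by norm_num)
    simpa only [enorm_flow] using this
  obtain ⟨D, hD, hDb⟩ := exists_enorm_triSum_cubicKernel_low_le hm
  have hA : ENNReal.ofReal A ^ 4 ≠ ∞ := ENNReal.pow_ne_top ENNReal.ofReal_ne_top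
  have hm' : ∀ i, IsBVSymbol A ((![m 0, m 1, m 3, m 2] : Fin 4 → ℤ → ℂ) i) := by
    intro i
    fin_cases i
    exacts [hm 0, hm 1, hm 3, hm 2]
  have t1 := main (cubicKernel m) (fun s => cubicTerm m s (v s) k) D hD (continuous_cubicKernel m)
    (fun s hs N => hDb s (v s) hs N k) (fun s hs => tendsto_triSum_cubicKernel hm hs k)
  have t2 := main (fun _ => resonantKernel₃ m) (fun s => mult (m 0) (mult (m 3) (v s)) k *
      pairMean (mult (m 1) (conjSeq (v s))) (mult (m 2) (v s))) _ hA (fun _ _ _ _ => continuous_const)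
    (fun s hs N => (enorm_triSum_resonantKernel₃_low_le hm N (v s) k).trans
      (mul_le_mul_right (pow_le_pow_left' (hl2 s) 3) _))
    (fun s hs => tendsto_triSum_resonantKernel₃ hm ((hl2 s).trans_lt hs).ne k)
  have t3 := main (fun _ => resonantKernel₂ m) (fun s => mult (m 0) (mult (m 2) (v s)) k *
      pairMean (mult (m 1) (conjSeq (v s))) (mult (m 3) (v s))) _ hA (fun _ _ _ _ => continuous_const)
    (fun s hs N => by
      rw [triSum_resonantKernel₂]
      exact (enorm_triSum_resonantKernel₃_low_le hm' N (v s) k).trans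
        (mul_le_mul_right (pow_le_pow_left' (hl2 s) 3) _))
    (fun s hs => by
      simp only [triSum_resonantKernel₂]
      exact tendsto_triSum_resonantKernel₃ hm' ((hl2 s).trans_lt hs).ne k)
  have hI : ∀ (K : ℝ → ℤ → ℤ → ℤ → ℤ → ℂ), (∀ k k₁ k₂ k₃, Continuous fun s => K s k k₁ k₂ k₃) →
      ∀ N, IntervalIntegrable (fun s => triSum (K s) (low N) (low N) (low N) (v s) k)
        volume t₀ t₁ := fun K hK N =>
    (h.continuousOn_triSum ht.le hK _ _ _ k).intervalIntegrable_of_Icc ht.le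
  have i1 := hI (cubicKernel m) (continuous_cubicKernel m)
  have i2 := hI (fun _ => resonantKernel₃ m) fun _ _ _ _ => continuous_const
  have i3 := hI (fun _ => resonantKernel₂ m) fun _ _ _ _ => continuous_const
  have t4 := ((t1.const_mul Complex.I).sub (t2.const_mul Complex.I)).sub (t3.const_mul Complex.I)
  refine t4.congr fun N => ?_
  simp only [triSum_fullKernel]
  rw [intervalIntegral.integral_sub ((i1 N).sub (i2 N)) (i3 N),
    intervalIntegral.integral_sub (i1 N) (i2 N)]
  ring

end Time

/-! ### Summation over the dyadic blocks -/

/-- The sum over comparable triples of a function of the least index is a bounded multiple of a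
simple sum. -/
theorem sum_comparable_le (N : ℕ) (y : ℕ → ℝ≥0∞) :
    ∑ j₁ ∈ Finset.range N, ∑ j₂ ∈ Finset.range N, ∑ j₃ ∈ Finset.range N,
      (if Comparable j₁ j₂ j₃ then y (min j₁ (min j₂ j₃)) else 0) ≤ 27 * ∑' j, y j := by
  -- For comparable blocks the minimum is `j₁` or `j₁ - 1`, and `j₂`, `j₃` take three values each.
  have h1 : ∀ j₁ j₂ j₃, (if Comparable j₁ j₂ j₃ then y (min j₁ (min j₂ j₃)) else 0) ≤
      if j₂ ∈ Finset.Icc (j₁ - 1) (j₁ + 1) then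
        (if j₃ ∈ Finset.Icc (j₁ - 1) (j₁ + 1) then y j₁ + y (j₁ - 1) else 0) else 0 := by
    intro j₁ j₂ j₃
    by_cases hj : Comparable j₁ j₂ j₃
    · unfold Comparable at hj
      rw [if_pos (by unfold Comparable; exact hj), if_pos (by rw [Finset.mem_Icc]; omega),
        if_pos (by rw [Finset.mem_Icc]; omega)]
      rcases (by omega : min j₁ (min j₂ j₃) = j₁ ∨ min j₁ (min j₂ j₃) = j₁ - 1) with h | h
      · rw [h]; exact le_self_add
      · rw [h]; exact le_add_self
    · rw [if_neg hj]; exact zero_le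
  have h2 : ∀ (a : ℕ) (z : ℝ≥0∞), ∑ j ∈ Finset.range N,
      (if j ∈ Finset.Icc (a - 1) (a + 1) then z else 0) ≤ 3 * z := by
    intro a z
    rw [← Finset.sum_filter, Finset.sum_const, nsmul_eq_mul]
    gcongr
    have h3 : ((Finset.range N).filter fun j => j ∈ Finset.Icc (a - 1) (a + 1)).card ≤ 3 := by
      refine (Finset.card_le_card (t := Finset.Icc (a - 1) (a + 1)) fun j hj =>
        (Finset.mem_filter.1 hj).2).trans ?_
      rw [Nat.card_Icc]
      omega
    exact_mod_cast h3
  have h4 : ∀ M, ∑ j ∈ Finset.range M, y (j - 1) ≤ 2 * ∑' j, y j := by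
    intro M
    rcases M with _ | M
    · simp
    · rw [Finset.sum_range_succ', two_mul]
      exact add_le_add (ENNReal.sum_le_tsum _) (ENNReal.le_tsum _)
  calc _ ≤ ∑ j₁ ∈ Finset.range N, 3 * (3 * (y j₁ + y (j₁ - 1))) := by
        refine Finset.sum_le_sum fun j₁ _ => le_trans (Finset.sum_le_sum fun j₂ _ => ?_)
          (h2 j₁ (3 * (y j₁ + y (j₁ - 1))))
        refine (Finset.sum_le_sum fun j₃ _ => h1 j₁ j₂ j₃).trans ?_
        split_ifs
        · exact h2 j₁ _
        · simp
    _ = 9 * (∑ j ∈ Finset.range N, y j + ∑ j ∈ Finset.range N, y (j - 1)) := by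
        rw [← Finset.mul_sum, ← Finset.mul_sum, Finset.sum_add_distrib, ← mul_assoc]
        norm_num
    _ ≤ 9 * (∑' j, y j + 2 * ∑' j, y j) := by
        gcongr
        · exact ENNReal.sum_le_tsum _
        · exact h4 N
    _ = _ := by ring

/-- A symmetric function summed over all triples is at most six times its sum over ordered
triples. -/
theorem sum_le_six_mul_ordered (N : ℕ) (Z : ℕ → ℕ → ℕ → ℝ≥0∞) (h12 : ∀ a b c, Z a b c = Z b a c)
    (h23 : ∀ a b c, Z a b c = Z a c b) :
    ∑ j₁ ∈ Finset.range N, ∑ j₂ ∈ Finset.range N, ∑ j₃ ∈ Finset.range N, Z j₁ j₂ j₃ ≤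
      6 * ∑' j₁, ∑ j₂ ∈ Finset.range (j₁ + 1), ∑ j₃ ∈ Finset.range (j₂ + 1), Z j₁ j₂ j₃ := by
  set O : ℕ → ℕ → ℕ → ℝ≥0∞ := fun a b c => if b ≤ a then (if c ≤ b then Z a b c else 0) else 0
    with hO
  set R := ∑ j₁ ∈ Finset.range N, ∑ j₂ ∈ Finset.range N, ∑ j₃ ∈ Finset.range N, O j₁ j₂ j₃ with hS
  have hle : ∀ a b c, Z a b c ≤ O a b c + O a c b + O b a c + O b c a + O c a b + O c b a := by
    intro a b c
    have hOo : ∀ {x y z}, y ≤ x → z ≤ y → O x y z = Z x y z := fun h1 h2 => by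
      simp only [hO]; rw [if_pos h1, if_pos h2]
    have e1 := h23 a b c
    have e2 := h12 a b c
    have e3 : Z a b c = Z b c a := by rw [h12, h23]
    have e4 : Z a b c = Z c a b := by rw [h23, h12]
    have e5 : Z a b c = Z c b a := by rw [h12, h23, h12]
    rcases le_total b a with h1 | h1 <;> rcases le_total c b with h2 | h2 <;>
      rcases le_total c a with h3 | h3
    · rw [hOo h1 h2]; simp only [add_assoc]; exact le_self_add
    · rw [hOo h1 h2]; simp only [add_assoc]; exact le_self_add
    · rw [hOo h3 h2, ← e1]
      exact le_add_right (le_add_right (le_add_right (le_add_right le_add_self)))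
    · rw [hOo h3 h1, ← e4]; exact le_add_right le_add_self
    · rw [hOo h1 h3, ← e2]; exact le_add_right (le_add_right (le_add_right le_add_self))
    · rw [hOo h2 h3, ← e3]; exact le_add_right (le_add_right le_add_self)
    · rw [hOo h2 h1, ← e5]; exact le_add_self
    · rw [hOo h2 h1, ← e5]; exact le_add_self
  have s2 : ∑ a ∈ Finset.range N, ∑ b ∈ Finset.range N, ∑ c ∈ Finset.range N, O a c b = R :=
    Finset.sum_congr rfl fun a _ => Finset.sum_comm
  have s3 : ∑ a ∈ Finset.range N, ∑ b ∈ Finset.range N, ∑ c ∈ Finset.range N, O b a c = R :=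
    Finset.sum_comm
  have s4 : ∑ a ∈ Finset.range N, ∑ b ∈ Finset.range N, ∑ c ∈ Finset.range N, O b c a = R := by
    rw [Finset.sum_comm]
    exact Finset.sum_congr rfl fun a _ => Finset.sum_comm
  have s5 : ∑ a ∈ Finset.range N, ∑ b ∈ Finset.range N, ∑ c ∈ Finset.range N, O c a b = R := by
    rw [← s3]
    exact Finset.sum_congr rfl fun a _ => Finset.sum_comm
  have s6 : ∑ a ∈ Finset.range N, ∑ b ∈ Finset.range N, ∑ c ∈ Finset.range N, O c b a = R := by
    rw [← s4]
    exact Finset.sum_congr rfl fun a _ => Finset.sum_comm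
  have hfin : R ≤
      ∑' j₁, ∑ j₂ ∈ Finset.range (j₁ + 1), ∑ j₃ ∈ Finset.range (j₂ + 1), Z j₁ j₂ j₃ := by
    refine le_trans (Finset.sum_le_sum fun a _ => ?_) (ENNReal.sum_le_tsum (Finset.range N))
    calc _ ≤ ∑ b ∈ Finset.range N, if b ≤ a then ∑ c ∈ Finset.range (b + 1), Z a b c else 0 := by
          refine Finset.sum_le_sum fun b _ => ?_
          simp only [hO]
          split_ifs
          · rw [← Finset.sum_filter]
            refine Finset.sum_le_sum_of_subset fun c hc => ?_
            have := (Finset.mem_filter.1 hc).2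
            rw [Finset.mem_range]; omega
          · simp
      _ ≤ _ := by
          rw [← Finset.sum_filter]
          refine Finset.sum_le_sum_of_subset fun b hb => ?_
          have := (Finset.mem_filter.1 hb).2
          rw [Finset.mem_range]; omega
  calc _ ≤ ∑ a ∈ Finset.range N, ∑ b ∈ Finset.range N, ∑ c ∈ Finset.range N,
        (O a b c + O a c b + O b a c + O b c a + O c a b + O c b a) :=
        Finset.sum_le_sum fun a _ => Finset.sum_le_sum fun b _ => Finset.sum_le_sum fun c _ =>
          hle a b c
    _ = 6 * R := by
        simp only [Finset.sum_add_distrib, s2, s3, s4, s5, s6, ← hS]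
        ring
    _ ≤ _ := by gcongr

/-- The exponent of the block bound. For `γ < 0` the inequality `d² / (1 + d) ≥ d - 1 = -2γ`
compensates the loss of `-3γ` derivatives. -/
theorem alpha_mul_le (γ ε : ℝ) {x y z J : ℝ} (hx : 0 ≤ x) (hxJ : x ≤ J)
    (hyJ : y ≤ J) (hzJ : z ≤ J) (hJ : J ≤ x + y + z) :
    (ε - 1) * J + -γ * (x + y + z) ≤ -alpha γ ε * J := by
  have hJ0 : 0 ≤ J := hx.trans hxJ
  rw [alpha]
  set d := max (1 - 2 * γ) 0 with hd
  have hd0 : 0 ≤ d := le_max_right _ _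
  suffices h : (γ - d ^ 2 / (1 + d)) * J ≤ γ * (x + y + z) by linarith
  rcases le_or_gt 0 γ with hγ | hγ
  · have h1 : 0 ≤ d ^ 2 / (1 + d) := by positivity
    nlinarith [mul_nonneg h1 hJ0, mul_le_mul_of_nonneg_left hJ hγ]
  · have hd1 : d = 1 - 2 * γ := max_eq_left (by linarith)
    have h1 : d - 1 ≤ d ^ 2 / (1 + d) := by
      rw [le_div_iff₀ (by linarith)]; nlinarith
    have h2 : x + y + z ≤ 3 * J := by linarith
    nlinarith [mul_le_mul_of_nonneg_right h1 hJ0, mul_le_mul_of_nonpos_left h2 hγ.le]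

/-- The bound for one triple of blocks. -/
theorem exists_l2_integral_triSum_block_le (γ A : ℝ) {ε : ℝ} (hε : 0 < ε) :
    ∃ D : ℝ≥0, ∀ (m : Fin 4 → ℤ → ℂ), (∀ i, IsBVSymbol A (m i)) →
      ∀ (t₀ t₁ : ℝ), t₀ < t₁ → ∀ (v w : ℝ → FourierSeq), HasTimeDeriv t₀ t₁ v w →
      ∀ j₁ j₂ j₃ : ℕ, l2 (fun k => ‖∫ s in t₀..t₁,
        triSum (fullKernel m s) (block j₁) (block j₂) (block j₃) (v s) k‖ₑ) ≤
      D * ((if Comparable j₁ j₂ j₃ then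
          ENNReal.ofReal ((2 : ℝ) ^ (-3 * γ * ((min j₁ (min j₂ j₃) : ℕ) : ℝ))) *
            mixedNorm 3 6 t₀ t₁
              (fun s => dyadic (min j₁ (min j₂ j₃)) (flow s (bessel γ (v s)))) ^ 3 else 0) +
        ENNReal.ofReal ((2 : ℝ) ^ (-alpha γ ε * ((max j₁ (max j₂ j₃) : ℕ) : ℝ))) *
          xNorm γ t₀ t₁ (fun s => dyadic j₁ (v s)) (fun s => dyadic j₁ (w s)) *
          xNorm γ t₀ t₁ (fun s => dyadic j₂ (v s)) (fun s => dyadic j₂ (w s)) *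
          xNorm γ t₀ t₁ (fun s => dyadic j₃ (v s)) (fun s => dyadic j₃ (w s))) := by
  obtain ⟨D₁, hD₁⟩ := exists_l2_integral_triSum_le_of_comparable γ A
  obtain ⟨D₂, hD₂⟩ := exists_l2_integral_triSum_le γ A hε
  refine ⟨D₁ + D₂, fun m hm t₀ t₁ ht v w h j₁ j₂ j₃ => ?_⟩
  by_cases hj : Comparable j₁ j₂ j₃
  · rw [if_pos hj]
    exact (hD₁ m hm t₀ t₁ ht.le v w h j₁ j₂ j₃ hj).trans
      (mul_le_mul' (by push_cast; exact le_self_add) le_self_add)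
  · rw [if_neg hj, zero_add]
    refine (hD₂ m hm t₀ t₁ ht v w h j₁ j₂ j₃ hj).trans ?_
    rw [mul_assoc]
    refine mul_le_mul' (by push_cast; exact le_add_self) ?_
    simp only [mul_assoc]
    refine mul_le_mul_left (ENNReal.ofReal_le_ofReal ?_) _
    rw [← Real.rpow_add (by norm_num)]
    refine Real.rpow_le_rpow_of_exponent_le (by norm_num) ?_
    refine alpha_mul_le γ ε (Nat.cast_nonneg _) ?_ ?_ ?_ ?_
    · exact_mod_cast le_max_left _ _
    · exact_mod_cast (le_max_left _ _).trans (le_max_right j₁ _)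
    · exact_mod_cast (le_max_right _ _).trans (le_max_right j₁ _)
    · exact_mod_cast (by omega : max j₁ (max j₂ j₃) ≤ j₁ + j₂ + j₃)

section Time

variable {t₀ t₁ : ℝ} {v w : ℝ → FourierSeq}

/-- The triangle inequality for the decomposition of a truncation into blocks. -/
theorem HasTimeDeriv.l2_integral_triSum_low_le (ht : t₀ ≤ t₁) (h : HasTimeDeriv t₀ t₁ v w)
    (m : Fin 4 → ℤ → ℂ) (N : ℕ) :
    l2 (fun k => ‖Complex.I * ∫ s in t₀..t₁,
      triSum (fullKernel m s) (low N) (low N) (low N) (v s) k‖ₑ) ≤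
      ∑ j₁ ∈ Finset.range (N + 1), ∑ j₂ ∈ Finset.range (N + 1), ∑ j₃ ∈ Finset.range (N + 1),
        l2 (fun k => ‖∫ s in t₀..t₁,
          triSum (fullKernel m s) (block j₁) (block j₂) (block j₃) (v s) k‖ₑ) := by
  have hi : ∀ j₁ j₂ j₃ k, ContinuousOn (fun s =>
      triSum (fullKernel m s) (block j₁) (block j₂) (block j₃) (v s) k) (Set.Icc t₀ t₁) :=
    fun j₁ j₂ j₃ k => h.continuousOn_triSum ht (continuous_fullKernel m) _ _ _ k
  have h1 : ∀ k, ‖Complex.I * ∫ s in t₀..t₁,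
      triSum (fullKernel m s) (low N) (low N) (low N) (v s) k‖ₑ ≤
      ∑ j₁ ∈ Finset.range (N + 1), ∑ j₂ ∈ Finset.range (N + 1), ∑ j₃ ∈ Finset.range (N + 1),
        ‖∫ s in t₀..t₁, triSum (fullKernel m s) (block j₁) (block j₂) (block j₃) (v s) k‖ₑ := by
    intro k
    have hI : ‖Complex.I‖ₑ = 1 := by rw [← ofReal_norm]; simp
    rw [enorm_mul, hI, one_mul]
    simp only [triSum_low]
    rw [intervalIntegral.integral_finsetSum fun j₁ _ => (continuousOn_finsetSum _ fun j₂ _ =>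
      continuousOn_finsetSum _ fun j₃ _ => hi j₁ j₂ j₃ k).intervalIntegrable_of_Icc ht]
    refine (enorm_sum_le _ _).trans (Finset.sum_le_sum fun j₁ _ => ?_)
    rw [intervalIntegral.integral_finsetSum fun j₂ _ =>
      (continuousOn_finsetSum _ fun j₃ _ => hi j₁ j₂ j₃ k).intervalIntegrable_of_Icc ht]
    refine (enorm_sum_le _ _).trans (Finset.sum_le_sum fun j₂ _ => ?_)
    rw [intervalIntegral.integral_finsetSum fun j₃ _ =>
      (hi j₁ j₂ j₃ k).intervalIntegrable_of_Icc ht]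
    exact enorm_sum_le _ _
  exact (l2_mono h1).trans ((l2_sum_le _ _).trans (Finset.sum_le_sum fun j₁ _ =>
    (l2_sum_le _ _).trans (Finset.sum_le_sum fun j₂ _ => l2_sum_le _ _)))

end Time

/-- Fatou's lemma for the `ℓ²` norm. -/
theorem l2_le_of_tendsto {F : ℕ → ℤ → ℂ} {f : ℤ → ℂ} {B : ℝ≥0∞}
    (hF : ∀ N, l2 (fun k => ‖F N k‖ₑ) ≤ B)
    (hlim : ∀ k, Tendsto (fun N => F N k) atTop (𝓝 (f k))) : l2 (fun k => ‖f k‖ₑ) ≤ B := by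
  rw [l2_le_iff, ENNReal.tsum_eq_iSup_sum]
  refine iSup_le fun S => ?_
  have h1 : Tendsto (fun N => ∑ k ∈ S, ‖F N k‖ₑ ^ 2) atTop (𝓝 (∑ k ∈ S, ‖f k‖ₑ ^ 2)) :=
    tendsto_finsetSum _ fun k _ => (ENNReal.continuous_pow 2).continuousAt.tendsto.comp
      (hlim k).enorm
  exact le_of_tendsto h1 (Eventually.of_forall fun N =>
    (ENNReal.sum_le_tsum S).trans (l2_le_iff.1 (hF N)))

end TorusNLS

theorem lemma2p4 (γ ε A : ℝ) (hε : 0 < ε) (hα : 0 ≤ alpha γ ε) :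
    ∃ C : ℝ≥0, ∀ (m : Fin 4 → ℤ → ℂ), (∀ i, IsBVSymbol A (m i)) →
      ∀ (t₀ t₁ : ℝ), t₀ ≤ t₁ →
      ∀ (v w : ℝ → FourierSeq), HasTimeDeriv t₀ t₁ v w → xNorm γ t₀ t₁ v w < ⊤ →
      (γ < 0 → mixedNorm 3 4 t₀ t₁ (fun s => flow s (v s)) < ⊤) →
      torusNorm 2 (trilinearT m t₀ t₁ v) ≤
        C * ((∑' j : ℕ, ENNReal.ofReal ((2 : ℝ) ^ (-3 * γ * (j : ℝ))) *
              mixedNorm 3 6 t₀ t₁ (fun s => dyadic j (flow s (bessel γ (v s)))) ^ 3)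
          + ∑' j₁ : ℕ, ∑ j₂ ∈ Finset.range (j₁ + 1), ∑ j₃ ∈ Finset.range (j₂ + 1),
              ENNReal.ofReal ((2 : ℝ) ^ (-alpha γ ε * (j₁ : ℝ))) *
                xNorm γ t₀ t₁ (fun s => dyadic j₁ (v s)) (fun s => dyadic j₁ (w s)) *
                xNorm γ t₀ t₁ (fun s => dyadic j₂ (v s)) (fun s => dyadic j₂ (w s)) *
                xNorm γ t₀ t₁ (fun s => dyadic j₃ (v s)) (fun s => dyadic j₃ (w s))) := by
  obtain ⟨D, hD⟩ := exists_l2_integral_triSum_block_le γ A hε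
  refine ⟨(2 * π).toNNReal ^ (1 / 2 : ℝ) * (27 * D), fun m hm t₀ t₁ ht v w h hX h4 => ?_⟩
  set X : ℕ → ℝ≥0∞ := fun j =>
    xNorm γ t₀ t₁ (fun s => dyadic j (v s)) (fun s => dyadic j (w s)) with hXdef
  set y : ℕ → ℝ≥0∞ := fun j => ENNReal.ofReal ((2 : ℝ) ^ (-3 * γ * (j : ℝ))) *
    mixedNorm 3 6 t₀ t₁ (fun s => dyadic j (flow s (bessel γ (v s)))) ^ 3 with hy
  set Z : ℕ → ℕ → ℕ → ℝ≥0∞ := fun a b c =>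
    ENNReal.ofReal ((2 : ℝ) ^ (-alpha γ ε * ((max a (max b c) : ℕ) : ℝ))) * X a * X b * X c with hZ
  have hZord : ∑' j₁ : ℕ, ∑ j₂ ∈ Finset.range (j₁ + 1), ∑ j₃ ∈ Finset.range (j₂ + 1),
      ENNReal.ofReal ((2 : ℝ) ^ (-alpha γ ε * (j₁ : ℝ))) * X j₁ * X j₂ * X j₃ =
      ∑' j₁, ∑ j₂ ∈ Finset.range (j₁ + 1), ∑ j₃ ∈ Finset.range (j₂ + 1), Z j₁ j₂ j₃ := by
    refine tsum_congr fun j₁ => Finset.sum_congr rfl fun j₂ h₂ => Finset.sum_congr rfl fun j₃ h₃ => ?_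
    rw [Finset.mem_range] at h₂ h₃
    simp only [hZ]
    rw [show max j₁ (max j₂ j₃) = j₁ by omega]
  change _ ≤ _ * (∑' j, y j + ∑' j₁ : ℕ, ∑ j₂ ∈ Finset.range (j₁ + 1),
    ∑ j₃ ∈ Finset.range (j₂ + 1),
      ENNReal.ofReal ((2 : ℝ) ^ (-alpha γ ε * (j₁ : ℝ))) * X j₁ * X j₂ * X j₃)
  rw [hZord]
  set R := ∑' j, y j + ∑' j₁, ∑ j₂ ∈ Finset.range (j₁ + 1), ∑ j₃ ∈ Finset.range (j₂ + 1), Z j₁ j₂ j₃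
  have hl2 : l2 (fun k => ‖trilinearT m t₀ t₁ v k‖ₑ) ≤ 27 * D * R := by
    -- The blocks are bounded through the essential supremum in time, which needs `t₀ < t₁`; for
    -- `t₀ = t₁` the time integrals vanish.
    rcases ht.eq_or_lt with rfl | ht
    · simp [trilinearT, l2]
    · refine l2_le_of_tendsto (fun N => (h.l2_integral_triSum_low_le ht.le m N).trans ?_)
        fun k => tendsto_integral_triSum_low hm ht h hX h4 k
      calc _ ≤ ∑ j₁ ∈ Finset.range (N + 1), ∑ j₂ ∈ Finset.range (N + 1), ∑ j₃ ∈ Finset.range (N + 1),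
            D * ((if Comparable j₁ j₂ j₃ then y (min j₁ (min j₂ j₃)) else 0) + Z j₁ j₂ j₃) :=
            Finset.sum_le_sum fun j₁ _ => Finset.sum_le_sum fun j₂ _ => Finset.sum_le_sum fun j₃ _ =>
              hD m hm t₀ t₁ ht v w h j₁ j₂ j₃
        _ ≤ D * (27 * ∑' j, y j + 6 * ∑' j₁, ∑ j₂ ∈ Finset.range (j₁ + 1),
              ∑ j₃ ∈ Finset.range (j₂ + 1), Z j₁ j₂ j₃) := by
            simp only [← Finset.mul_sum, Finset.sum_add_distrib]
            refine mul_le_mul_right (add_le_add (sum_comparable_le _ y)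
              (sum_le_six_mul_ordered _ Z (fun a b c => ?_) fun a b c => ?_)) _
            · simp only [hZ]
              rw [max_left_comm]; ring
            · simp only [hZ]
              rw [max_comm b c]; ring
        _ ≤ D * (27 * ∑' j, y j + 27 * ∑' j₁, ∑ j₂ ∈ Finset.range (j₁ + 1),
              ∑ j₃ ∈ Finset.range (j₂ + 1), Z j₁ j₂ j₃) := by
            gcongr; norm_num
        _ = 27 * D * R := by rw [← mul_add]; ring
  refine (torusNorm_two_le _).trans ((mul_le_mul_right hl2 _).trans_eq ?_)
  push_cast
  rw [ENNReal.coe_rpow_of_nonneg _ (by norm_num)]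
  simp only [ENNReal.ofReal]
  ring
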